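/- **Setting.** Let $\mathcal X=\prod_{i=1}^D[\underline x_i,\overline x_i]$ with $\underline x_i<\overline x_i$, let $\overline N=(N_1,\dots,N_D)$ with integers $N_i\ge 1$, and let $\mathcal J=\{j:0\le j_i\le N_i\}$. Let $\tau:[-1,1]^D\to\mathcal X$, $\tau(z)_i=\overline x_i+\tfrac12(\underline x_i-\overline x_i)(1-z_i)$. For $j,k\in\mathcal J$ let $T_j(z)=\prod_i\cos(j_i\arccos z_i)$, $p_j(x)=T_j(\tau^{-1}(x))1_{\mathcal X}(x)$, $z^k_i=\cos(\pi k_i/N_i)$, $x^k=\tau(z^k)$. For values $v=(v_k)_{k\in\mathcal J}$ put $$c_j(v)=\Big(\prod_{i=1}^D\frac{2^{1_{\{0<j_i<N_i\}}}}{N_i}\Big)\sum_{k\in\mathcal J}{}^{''}v_k\,T_j(z^k),$$ where $\sum{}^{''}$ means a factor $\tfrac12$ for every coordinate $i$ with $k_i\in\{0,N_i\}$. Let $\mathcal P_{\overline N}=\mathrm{span}\{p_j:j\in\mathcal J\}$ with norm $\|p\|_\infty=\max_{x\in\mathcal X}|p(x)|$, and let $\Lambda_{\overline N}=\max_{x\in\mathcal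 X}\sum_{j\in\mathcal J}|\lambda^j(x)|$ be the Lebesgue constant, where $\lambda^j(x)=\prod_i\prod_{0\le k\le N_i,\,k\ne j_i}\frac{\tau^{-1}(x)_i-\cos(\pi k/N_i)}{\cos(\pi j_i/N_i)-\cos(\pi k/N_i)}$. For $\varrho\in(1,\infty)^D$ the generalized Bernstein ellipse $\mathcal B(\mathcal X,\varrho)\subset\mathbb C^D$ is the product over $i$ of the images under $w\mapsto\overline x_i+\tfrac12(\underline x_i-\overline x_i)(1-w)$ of the open regions bounded by the ellipses with foci $\pm1$ and semiaxes summing to $\varrho_i$. Put $$\varepsilon_{int}(\varrho,N,D,B)=2^{\frac D2+1}B\Big(\sum_{i=1}^D\varrho_i^{-2N_i}\prod_{j=1}^D\frac1{1-\varrho_j^{-2}}\Big)^{1/2}.$$ Let $X=(X_s)_{0\le s\le T}$ be a Markov process with state space $\mathbb R^D$ on a filtered probability space, with fixed Markov transition kernels through which $\mathbb E[h(X_s)\mid X_r=x]$ is defined for every $x$. Let $t_0<\dots<t_n=T$ be times in $[0,T]$, let $f:\mathbb R^2\to\mathbb R$ satisfy $|f(x_1,y_1)-f(x_2,y_2)|\le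 L_f(|x_1-x_2|+|y_1-y_2|)$, and let the value functions be given by $$V_T(x)=g(T,x),\qquad V_{t_u}(x)=f\big(g(t_u,x),\mathbb E[V_{t_{u+1}}(X_{t_{u+1}})\mid X_{t_u}=x]\big),\quad 0\le u<n,$$ where all these conditional expectations are assumed to exist (integrability). Write $\Gamma^k_{t_u}(h)=\mathbb E[h(X_{t_{u+1}})\mid X_{t_u}=x^k]$. Given linear maps $\widehat\Gamma^k_{t_u}:\mathcal P_{\overline N}\to\mathbb R$ ($0\le u<n$, $k\in\mathcal J$), the Dynamic Chebyshev method computes $\widehat V_{t_u}=\sum_{j\in\mathcal J}c_j(t_u)p_j$, where $c_j(t_u)=c_j(v(t_u))$ with nodal values $v_k(t_n)=g(T,x^k)$ and, for $u<n$, $v_k(t_u)=f\big(g(t_u,x^k),\sum_{j\in\mathcal J}c_j(t_{u+1})\widehat\Gamma^k_{t_u}(p_j)\big)$. **Theorem.** Fix $u\in\{0,\dots,n\}$. Assume that for each $j\in\{u,\dots,n\}$ the function $V_{t_j}|_{\mathcal X}$ has an analytic extension to $\mathcal B(\mathcal X,\varrho_{t_j})$, $\varrho_{t_j}\in(1,\infty)^D$,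 bounded there in absolute value by $B_{t_j}$, and that (TR) $\big|\mathbb E[V_{t_{v+1}}(X_{t_{v+1}})1_{\mathbb R^D\setminus\mathcal X}(X_{t_{v+1}})\mid X_{t_v}=x^k]\big|\le\varepsilon_{tr}$ for all $0\le v<n$, $k\in\mathcal J$. Suppose that one of the following holds. (GM) The $\widehat\Gamma^k_{t_v}$ are deterministic and $|\Gamma^k_{t_v}(p)-\widehat\Gamma^k_{t_v}(p)|\le\overline\delta$ for all $0\le v<n$, $k\in\mathcal J$ and $p\in\mathcal P_{\overline N}$ with $\|p\|_\infty=1$. Put $\varepsilon_{gm}=\overline\delta$ and $\varepsilon_{t_u}=\sup_{x\in\mathcal X}|V_{t_u}(x)-\widehat V_{t_u}(x)|$. (GM*) The $\widehat\Gamma^k_{t_v}$ are random linear maps (for example Monte Carlo estimators from $M$ samples) on a probability space, and for some $\delta^\star=\delta^\star(M)\ge0$ we have $\mathbb E|\Gamma^k_{t_v}(p)-\widehat\Gamma^k_{t_v}(p)|\le\delta^\star$ for all $0\le v<n$, $k\in\mathcal J$ and all random polynomials $p=\sum_ja_jp_j$ with $\sup_{x\in\mathcal X}\mathbb E|p(x)|=1$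 whose coefficients $a_j$ are random variables measurable with respect to the $\sigma$-algebra generated by the $\widehat\Gamma^{k'}_{t_w}$, $v<w<n$, $k'\in\mathcal J$ (the expectation being over the randomness of $\widehat\Gamma$ and $p$; $\Gamma^k_{t_v}$ acts on each realization of $p$). Put $\varepsilon_{gm}=\delta^\star$ and $\varepsilon_{t_u}=\sup_{x\in\mathcal X}\mathbb E|V_{t_u}(x)-\widehat V_{t_u}(x)|$. Then, in either case, $$\varepsilon_{t_u}\le\sum_{j=u}^nC^{j-u}\varepsilon_{int}^j+\Lambda_{\overline N}L_f\sum_{j=u+1}^nC^{j-(u+1)}\big(\varepsilon_{tr}+\varepsilon_{gm}\overline V_j\big),$$ where $C=\Lambda_{\overline N}L_f(1+\varepsilon_{gm})$, $\overline V_j=\max_{x\in\mathcal X}|V_{t_j}(x)|$ and $\varepsilon_{int}^j=\varepsilon_{int}(\varrho_{t_j},N,D,B_{t_j})$. -/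

import Mathlib

open MeasureTheory ProbabilityTheory
open scoped NNReal ENNReal

noncomputable section

namespace DynCheb

/-- The open region bounded by the ellipse with foci `±1` whose semiaxes sum up to `ρ > 1`;
the sum of the distances to the foci is twice the semimajor axis `(ρ + ρ⁻¹) / 2`. -/
def bernstein (ρ : ℝ) : Set ℂ := {z | ‖z - 1‖ + ‖z + 1‖ < ρ + ρ⁻¹}

/-! ### Tensorized Chebyshev interpolation on a hyperrectangle -/

/-- A nondegenerate hyperrectangle `∏ [lo i, hi i]` in `ℝ^D` together with the degrees
`N i ≥ 1` of the Chebyshev interpolation in each coordinate. -/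
structure Grid (D : ℕ) where
  lo : Fin D → ℝ
  hi : Fin D → ℝ
  lo_lt_hi : ∀ i, lo i < hi i
  N : Fin D → ℕ
  N_pos : ∀ i, 1 ≤ N i

namespace Grid

variable {D : ℕ} (G : Grid D)

/-- The hyperrectangle. -/
def box : Set (Fin D → ℝ) := {x | ∀ i, G.lo i ≤ x i ∧ x i ≤ G.hi i}

/-- The index set of all `j` with `0 ≤ j i ≤ N i`. -/
abbrev Idx : Type := (i : Fin D) → Fin (G.N i + 1)

/-- The componentwise affine map from `[-1,1]^D` onto the hyperrectangle. -/
def scale (z : Fin D → ℝ) : Fin D → ℝ :=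
  fun i => G.hi i + (1 / 2) * (G.lo i - G.hi i) * (1 - z i)

/-- The inverse of `scale`. -/
def unscale (x : Fin D → ℝ) : Fin D → ℝ :=
  fun i => 1 - 2 * (G.hi i - x i) / (G.hi i - G.lo i)

/-- The Chebyshev polynomial `T_j` on `[-1,1]^D`. -/
def chebT (j : G.Idx) (z : Fin D → ℝ) : ℝ :=
  ∏ i, Real.cos ((j i : ℕ) * Real.arccos (z i))

/-- The Chebyshev polynomial `p_j` on the hyperrectangle, extended by zero to `ℝ^D`. -/
def chebP (j : G.Idx) : (Fin D → ℝ) → ℝ :=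
  G.box.indicator fun x => G.chebT j (G.unscale x)

/-- The Chebyshev points `z^k` in `[-1,1]^D`. -/
def refNode (k : G.Idx) : Fin D → ℝ :=
  fun i => Real.cos (Real.pi * (k i : ℕ) / (G.N i : ℝ))

/-- The Chebyshev points `x^k` in the hyperrectangle. -/
def node (k : G.Idx) : Fin D → ℝ := G.scale (G.refNode k)

/-- The weight of the summand with index `k` in a doubly primed sum: one factor `1/2` for each
coordinate with `k i = 0` or `k i = N i`. -/
def primeWeight (k : G.Idx) : ℝ :=
  ∏ i, if (k i : ℕ) = 0 ∨ (k i : ℕ) = G.N i then (1 / 2 : ℝ) else 1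

/-- The Chebyshev coefficients computed from values `v k` at the Chebyshev points. -/
def chebCoeff (v : G.Idx → ℝ) (j : G.Idx) : ℝ :=
  (∏ i, (if 0 < (j i : ℕ) ∧ (j i : ℕ) < G.N i then (2 : ℝ) else 1) / (G.N i : ℝ)) *
    ∑ k, G.primeWeight k * (v k * G.chebT j (G.refNode k))

/-- The space spanned by the functions `p_j`. -/
def polySpace : Submodule ℝ ((Fin D → ℝ) → ℝ) := Submodule.span ℝ (Set.range G.chebP)

/-- The function `p_j` as an element of the space of polynomials. -/
def basisP (j : G.Idx) : G.polySpace := ⟨G.chebP j, Submodule.subset_span ⟨j, rfl⟩⟩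

/-- The element `∑ a_j p_j` of the space of polynomials. -/
def poly (a : G.Idx → ℝ) : G.polySpace := ∑ j, a j • G.basisP j

/-- The supremum norm of a function on the hyperrectangle. -/
def supNorm (h : (Fin D → ℝ) → ℝ) : ℝ := sSup ((fun x => |h x|) '' G.box)

/-- The Lagrange basis polynomials `λ^j` of the transformed Chebyshev points. -/
def lagrange (j : G.Idx) (x : Fin D → ℝ) : ℝ :=
  ∏ i, ∏ k ∈ Finset.univ.erase (j i),
    (G.unscale x i - Real.cos (Real.pi * (k : ℕ) / (G.N i : ℝ))) /
      (Real.cos (Real.pi * (j i : ℕ) / (G.N i : ℝ)) - Real.cos (Real.pi * (k : ℕ) / (G.N i : ℝ)))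

/-- The Lebesgue constant of the Chebyshev interpolation. -/
def lebesgue : ℝ := sSup ((fun x => ∑ j, |G.lagrange j x|) '' G.box)

/-! ### Generalized Bernstein ellipses -/

/-- The generalized Bernstein ellipse around the hyperrectangle. -/
def ellipse (ρ : Fin D → ℝ) : Set (Fin D → ℂ) :=
  {z | ∀ i, z i ∈ (fun w : ℂ => (G.hi i : ℂ) + ((G.lo i - G.hi i : ℝ) : ℂ) / 2 * (1 - w)) ''
    bernstein (ρ i)}

/-- `h`, restricted to the hyperrectangle, has an analytic extension to the generalized Bernstein
ellipse with parameter vector `ρ`, and the extension is bounded by `B` in absolute value. -/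
def HasAnalyticExtension (h : (Fin D → ℝ) → ℝ) (ρ : Fin D → ℝ) (B : ℝ) : Prop :=
  ∃ F : (Fin D → ℂ) → ℂ, AnalyticOnNhd ℂ F (G.ellipse ρ) ∧
    (∀ x ∈ G.box, F (fun i => (x i : ℂ)) = (h x : ℂ)) ∧ ∀ z ∈ G.ellipse ρ, ‖F z‖ ≤ B

/-- The interpolation error bound `ε_int(ρ, N, D, B)`. -/
def epsInt (ρ : Fin D → ℝ) (B : ℝ) : ℝ :=
  (2 : ℝ) ^ ((D : ℝ) / 2 + 1) * B *
    ((∑ i, ρ i ^ (-(2 * (G.N i : ℤ)))) * ∏ j, 1 / (1 - ρ j ^ (-2 : ℤ))) ^ (1 / 2 : ℝ)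

end Grid

/-! ### Markov processes and dynamic programming problems -/

/-- `X = (X_s)_{0 ≤ s ≤ T}` is a Markov process on the filtered probability space `(Ω, ℱ, P)`,
and `κ r s` is a version of its transition kernel from time `r` to time `s`, so that
`E[h(X_s) | X_r = x]` is the integral of `h` with respect to `κ r s x`. -/
structure IsMarkovProcess {D : ℕ} {Ω : Type*} [mΩ : MeasurableSpace Ω] (P : Measure Ω)
    (ℱ : Filtration ℝ≥0 mΩ) (T : ℝ≥0) (X : ℝ≥0 → Ω → Fin D → ℝ)
    (κ : ℝ≥0 → ℝ≥0 → Kernel (Fin D → ℝ) (Fin D → ℝ)) : Prop where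
  adapted : ∀ s, s ≤ T → Measurable[ℱ s] (X s)
  isMarkovKernel : ∀ r s, r ≤ s → s ≤ T → IsMarkovKernel (κ r s)
  markov : ∀ r s, r ≤ s → s ≤ T → ∀ A : Set (Fin D → ℝ), MeasurableSet A →
    P[(X s ⁻¹' A).indicator (fun _ => (1 : ℝ)) | ℱ r] =ᵐ[P] fun ω => (κ r s (X r ω)).real A

/-- `V u` is the value function at time `t u`, `u ≤ n`, of the dynamic programming problem with
data `g`, `f` and transition kernels `κ`. The conditional expectations are required to exist. -/
structure IsValueFunction {D : ℕ} (n : ℕ) (t : ℕ → ℝ≥0) (g : ℝ≥0 → (Fin D → ℝ) → ℝ)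
    (f : ℝ → ℝ → ℝ) (κ : ℝ≥0 → ℝ≥0 → Kernel (Fin D → ℝ) (Fin D → ℝ))
    (V : ℕ → (Fin D → ℝ) → ℝ) : Prop where
  terminal : ∀ x, V n x = g (t n) x
  integrable : ∀ u < n, ∀ x, Integrable (V (u + 1)) (κ (t u) (t (u + 1)) x)
  step : ∀ u < n, ∀ x, V u x = f (g (t u) x) (∫ y, V (u + 1) y ∂(κ (t u) (t (u + 1)) x))

section Method

variable {D : ℕ} (G : Grid D) (n : ℕ) (t : ℕ → ℝ≥0)

/-- The exact operator `Γ_{t_u}^k`, `h ↦ E[h(X_{t_{u+1}}) | X_{t_u} = x^k]`. -/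
def exactOp (κ : ℝ≥0 → ℝ≥0 → Kernel (Fin D → ℝ) (Fin D → ℝ)) (u : ℕ) (k : G.Idx)
    (h : (Fin D → ℝ) → ℝ) : ℝ :=
  ∫ y, h y ∂(κ (t u) (t (u + 1)) (G.node k))

/-- The Chebyshev coefficients `c_j(t_{n-m})` produced by `m` backward steps of the Dynamic
Chebyshev algorithm with the (approximate) generalized moments `Γ u k p_j`. -/
def coeffBack (g : ℝ≥0 → (Fin D → ℝ) → ℝ) (f : ℝ → ℝ → ℝ)
    (Γ : ℕ → G.Idx → (G.polySpace →ₗ[ℝ] ℝ)) : ℕ → G.Idx → ℝ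
  | 0 => G.chebCoeff fun k => g (t n) (G.node k)
  | m + 1 => G.chebCoeff fun k => f (g (t (n - (m + 1))) (G.node k))
      (∑ j, coeffBack g f Γ m j * Γ (n - (m + 1)) k (G.basisP j))

/-- The approximation of the value function at time `t u`, `u ≤ n`, computed by the Dynamic
Chebyshev algorithm. -/
def approxValue (g : ℝ≥0 → (Fin D → ℝ) → ℝ) (f : ℝ → ℝ → ℝ)
    (Γ : ℕ → G.Idx → (G.polySpace →ₗ[ℝ] ℝ)) (u : ℕ) : G.polySpace :=
  G.poly (coeffBack G n t g f Γ (n - u))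

/-- The error `sup_x |V_{t_u}(x) - V̂_{t_u}(x)|` for deterministic generalized moments. -/
def error (g : ℝ≥0 → (Fin D → ℝ) → ℝ) (f : ℝ → ℝ → ℝ) (V : ℕ → (Fin D → ℝ) → ℝ)
    (Γ : ℕ → G.Idx → (G.polySpace →ₗ[ℝ] ℝ)) (u : ℕ) : ℝ≥0∞ :=
  ⨆ x ∈ G.box, ‖V u x - (approxValue G n t g f Γ u : (Fin D → ℝ) → ℝ) x‖ₑ

/-- The error `sup_x E|V_{t_u}(x) - V̂_{t_u}(x)|` for random generalized moments. -/
def errorStar {Ω' : Type*} [MeasurableSpace Ω'] (P' : Measure Ω')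
    (g : ℝ≥0 → (Fin D → ℝ) → ℝ) (f : ℝ → ℝ → ℝ) (V : ℕ → (Fin D → ℝ) → ℝ)
    (Γ : ℕ → G.Idx → Ω' → (G.polySpace →ₗ[ℝ] ℝ)) (u : ℕ) : ℝ≥0∞ :=
  ⨆ x ∈ G.box, ∫⁻ ω,
    ‖V u x - (approxValue G n t g f (fun v k => Γ v k ω) u : (Fin D → ℝ) → ℝ) x‖ₑ ∂P'

/-- Deterministic approximation of the generalized moments: in the operator norm, the error of
each approximate operator on the space of polynomials is at most `δ`. -/
def GM (κ : ℝ≥0 → ℝ≥0 → Kernel (Fin D → ℝ) (Fin D → ℝ))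
    (Γ : ℕ → G.Idx → (G.polySpace →ₗ[ℝ] ℝ)) (δ : ℝ) : Prop :=
  ∀ u < n, ∀ k, ∀ p : G.polySpace, G.supNorm p = 1 → |exactOp G t κ u k p - Γ u k p| ≤ δ

/-- The σ-algebra generated by the random operators of the time steps `v` with `u < v < n`. -/
@[reducible] def laterSigma {Ω' : Type*} (Γ : ℕ → G.Idx → Ω' → (G.polySpace →ₗ[ℝ] ℝ)) (u : ℕ) :
    MeasurableSpace Ω' :=
  ⨆ v ∈ Set.Ioo u n, ⨆ k : G.Idx, ⨆ q : G.polySpace,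
    MeasurableSpace.comap (fun ω => Γ v k ω q) (borel ℝ)

/-- The norm `sup_x E|p(x)|` of a random polynomial. -/
def starNorm {Ω' : Type*} [MeasurableSpace Ω'] (P' : Measure Ω') (p : Ω' → G.polySpace) : ℝ≥0∞ :=
  ⨆ x ∈ G.box, ∫⁻ ω, ‖(p ω : (Fin D → ℝ) → ℝ) x‖ₑ ∂P'

/-- Stochastic approximation of the generalized moments: `E|Γ p - Γ̂ p| ≤ δ`, `δ ≥ 0`, for all polynomials
`p` with `sup_x E|p(x)| = 1` whose coefficients may be random, depending (measurably) on the
random operators of the later time steps, that is, of the steps the algorithm has already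
performed. -/
def GMStar {Ω' : Type*} [MeasurableSpace Ω'] (P' : Measure Ω')
    (κ : ℝ≥0 → ℝ≥0 → Kernel (Fin D → ℝ) (Fin D → ℝ))
    (Γ : ℕ → G.Idx → Ω' → (G.polySpace →ₗ[ℝ] ℝ)) (δ : ℝ) : Prop :=
  0 ≤ δ ∧ ∀ u < n, ∀ k, ∀ a : Ω' → G.Idx → ℝ,
    (∀ j, Measurable[laterSigma G n Γ u] fun ω => a ω j) →
    starNorm G P' (fun ω => G.poly (a ω)) = 1 →
    ∫⁻ ω, ‖exactOp G t κ u k (G.poly (a ω)) - Γ u k ω (G.poly (a ω))‖ₑ ∂P' ≤ ENNReal.ofReal δ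

/-- The truncation error is bounded by `ε`. -/
def TR (κ : ℝ≥0 → ℝ≥0 → Kernel (Fin D → ℝ) (Fin D → ℝ)) (V : ℕ → (Fin D → ℝ) → ℝ)
    (ε : ℝ) : Prop :=
  ∀ u < n, ∀ k, |exactOp G t κ u k (G.boxᶜ.indicator (V (u + 1)))| ≤ ε

end Method

/-- The right-hand side of the error estimate, with `C = Λ L (1 + ε_gm)`. -/
def errorBound (Λ L εgm εtr : ℝ) (εint Vbar : ℕ → ℝ) (u n : ℕ) : ℝ :=
  ∑ j ∈ Finset.Icc u n, (Λ * L * (1 + εgm)) ^ (j - u) * εint j +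
    Λ * L * ∑ j ∈ Finset.Icc (u + 1) n,
      (Λ * L * (1 + εgm)) ^ (j - (u + 1)) * (εtr + εgm * Vbar j)

end DynCheb

end

open MeasureTheory ProbabilityTheory
open scoped NNReal ENNReal

noncomputable section

namespace DynCheb

/-! ### Chebyshev extremal points and their Lagrange basis -/

/-! Error propagation. The difference V_{t_u} - V̂_{t_u} is the interpolation error of V_{t_u} plus
the interpolant of the nodal errors, hence at most ε_int^u plus Λ times the largest mean nodal error
(`errorStar_le`). By the Lipschitz condition a nodal error is at most L_f times three terms: the
truncation term, the exact operator applied to 1_X (V - V̂) at the next date, and the operator error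
on V̂ there. The second is at most ε_{t_{u+1}} because the kernels are probability measures
(Tonelli), the third at most ε_gm (V̄_{u+1} + ε_{t_{u+1}}) (`lintegral_nodalValue_sub_le`). The
resulting recursion, unrolled backward from t_n, gives the bound. The deterministic case is the
random one on a one-point space.

The main work is the interpolation bound with exactly the constant ε_int, for all ρ > 1 and N ≥ 1
(`mInterp_error_le`). Write Q_i = ρ_i^{-2N_i} and W_i = 2/(1 - ρ_i^{-2}); the square of the bound is
4 B² (∑ Q_i) ∏ W_i.

In one variable, pull F minus its interpolant back by w ↦ (w + 1/w)/2. The result vanishes at the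
2N-th roots of unity, so its quotient by w^N - w^{-N} is holomorphic on an annulus and odd under
inversion. A Cauchy formula represents this quotient on the unit circle, the interpolant drops out
of the integral, and Cauchy–Schwarz with explicit mean squares gives a bound that is good when Q is
small (`interp_error_sq_le`). For ρ close to 1 the logarithmic bound on the Lebesgue constant takes
over (`sum_abs_lag_le`). Between them the two cover all parameters.

In D variables, one coordinate is split off: F - IF = (F - I'F) + I'(F - I_0 F), where I'
interpolates in the other coordinates. The first term is the induction hypothesis. For the second,
I' is bounded on functions holomorphic on the product of ellipses, with norm at most ∏ √(0.92 W_i)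
(`norm_mInterp_le`). The sum stays below the target because the univariate error constant satisfies
0.92 e² ≤ 4Q(W - 1) (`two_sqrt_add_sqrt_mul_le`). -/

/-- The extremal point `cos (π k / N)` of the Chebyshev polynomial `T_N`. -/
def chebNode (N k : ℕ) : ℝ := Real.cos (Real.pi * k / N)

/-- The Lagrange basis polynomial of the extremal points of `T_N`. -/
def lag (N : ℕ) (k : Fin (N + 1)) (x : ℝ) : ℝ :=
  ∏ m ∈ Finset.univ.erase k, (x - chebNode N m) / (chebNode N k - chebNode N m)

/-- The factor `1/2` at both ends of the index range. -/
def endWeight (N k : ℕ) : ℝ := if k = 0 ∨ k = N then 1 / 2 else 1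

/-- The trapezoidal sum `∑'' cos (j α)`. -/
def cosTrap (N : ℕ) (α : ℝ) : ℝ := ∑ j ∈ Finset.range (N + 1), endWeight N j * Real.cos (j * α)

lemma sum_endWeight {N : ℕ} (hN : 1 ≤ N) (a : ℕ → ℝ) :
    ∑ j ∈ Finset.range (N + 1), endWeight N j * a j =
      ∑ j ∈ Finset.range N, (a j + a (j + 1)) / 2 := by
  obtain ⟨n, rfl⟩ : ∃ n, N = n + 1 := ⟨N - 1, by omega⟩
  rw [← Finset.sum_div, Finset.sum_add_distrib, Finset.sum_range_succ (fun j => a (j + 1)),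
    Finset.sum_range_succ' a, Finset.sum_range_succ, Finset.sum_range_succ']
  have h : ∀ j ∈ Finset.range n, endWeight (n + 1) (j + 1) * a (j + 1) = a (j + 1) := by
    intro j hj
    have := Finset.mem_range.1 hj
    rw [endWeight, if_neg (by omega), one_mul]
  rw [Finset.sum_congr rfl h]
  simp only [endWeight, true_or, or_true, if_true]
  ring

/-- Telescoping: sin(α/2) (cos jα + cos (j+1)α) = cos(α/2) (sin (j+1)α - sin jα). -/
lemma two_sin_mul_cosTrap {N : ℕ} (hN : 1 ≤ N) (α : ℝ) :
    2 * Real.sin (α / 2) * cosTrap N α = Real.sin (N * α) * Real.cos (α / 2) := by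
  rw [cosTrap, sum_endWeight hN (fun j : ℕ => Real.cos (j * α)), Finset.mul_sum]
  have h : ∀ j ∈ Finset.range N, 2 * Real.sin (α / 2) *
      ((Real.cos ((j : ℕ) * α) + Real.cos (((j + 1 : ℕ) : ℝ) * α)) / 2) =
      Real.cos (α / 2) * (Real.sin (((j + 1 : ℕ) : ℝ) * α) - Real.sin ((j : ℕ) * α)) := by
    intro j _
    have e1 : (j : ℝ) * α = (j * α + α / 2) - α / 2 := by ring
    have e2 : ((j + 1 : ℕ) : ℝ) * α = (j * α + α / 2) + α / 2 := by push_cast; ring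
    rw [e2, e1, sub_add_cancel]
    generalize (j : ℝ) * α + α / 2 = x
    rw [Real.cos_add, Real.sin_add, Real.cos_sub, Real.sin_sub]
    ring
  rw [Finset.sum_congr rfl h, ← Finset.mul_sum,
    Finset.sum_range_sub (fun j : ℕ => Real.sin ((j : ℕ) * α))]
  simp [mul_comm]

lemma cosTrap_of_sin_ne {N : ℕ} (hN : 1 ≤ N) {α : ℝ} (h : Real.sin (α / 2) ≠ 0) :
    cosTrap N α = Real.sin (N * α) / 2 * Real.cot (α / 2) := by
  have := two_sin_mul_cosTrap hN α
  rw [Real.cot_eq_cos_div_sin]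
  field_simp
  linarith

lemma cosTrap_zero {N : ℕ} (hN : 1 ≤ N) : cosTrap N 0 = N := by
  rw [cosTrap, sum_endWeight hN (fun j : ℕ => Real.cos (j * 0))]
  simp

lemma cosTrap_two_pi {N : ℕ} (hN : 1 ≤ N) : cosTrap N (2 * Real.pi) = N := by
  rw [← cosTrap_zero hN]
  simp only [cosTrap]
  refine Finset.sum_congr rfl fun j _ => ?_
  rw [Real.cos_nat_mul_two_pi]
  simp

lemma cosTrap_eq_zero {N : ℕ} (hN : 1 ≤ N) {α : ℝ} (h : Real.sin (α / 2) ≠ 0)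
    (h' : Real.sin (N * α) = 0) : cosTrap N α = 0 := by
  rw [cosTrap_of_sin_ne hN h, h']
  simp

/-- The Lagrange basis polynomial expressed through trapezoidal sums. -/
def lagTrig (N k : ℕ) (θ : ℝ) : ℝ :=
  endWeight N k / N *
    (cosTrap N (θ - Real.pi * k / N) + cosTrap N (θ + Real.pi * k / N))

lemma lagTrig_eq (N k : ℕ) (θ : ℝ) :
    lagTrig N k θ = ∑ j ∈ Finset.range (N + 1),
      endWeight N k * (2 / N * endWeight N j) * Real.cos (j * (Real.pi * k / N)) *
        Real.cos (j * θ) := by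
  rw [lagTrig, cosTrap, cosTrap, ← Finset.sum_add_distrib, Finset.mul_sum]
  refine Finset.sum_congr rfl fun j _ => ?_
  rw [mul_sub, mul_add (j : ℝ), Real.cos_sub, Real.cos_add]
  ring

/-- `cosTrap` vanishes at πd/N for 0 < |d| < 2N and equals N at 0 and 2π. At an interior node only
the difference argument contributes; at an end node both do, which the weight 1/2 compensates. -/
lemma lagTrig_node {N : ℕ} (hN : 1 ≤ N) {k m : ℕ} (hk : k ≤ N) (hm : m ≤ N) :
    lagTrig N k (Real.pi * m / N) = if m = k then 1 else 0 := by
  have hN0 : (N : ℝ) ≠ 0 := by positivity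
  have hNpos : (0 : ℝ) < N := by positivity
  have key : ∀ d : ℤ, d ≠ 0 → -(2 * N : ℤ) < d → d < 2 * N →
      cosTrap N (Real.pi * d / N) = 0 := by
    intro d hd h1 h2
    apply cosTrap_eq_zero hN
    · intro h
      obtain ⟨n, hn⟩ := Real.sin_eq_zero_iff.1 h
      have h3 : (n : ℝ) * (2 * N) = d := by
        field_simp at hn
        linarith
      have h4 : n * (2 * N) = d := by exact_mod_cast h3
      have h5 : n = 0 := by nlinarith
      exact hd (by rw [← h4, h5]; ring)
    · rw [mul_div_cancel₀ _ hN0, mul_comm]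
      exact Real.sin_int_mul_pi d
  have e1 : Real.pi * m / N - Real.pi * k / N = Real.pi * ((m - k : ℤ) : ℝ) / N := by
    push_cast; ring
  have e2 : Real.pi * m / N + Real.pi * k / N = Real.pi * ((m + k : ℤ) : ℝ) / N := by
    push_cast; ring
  rw [lagTrig]
  split_ifs with h
  · subst h
    rw [sub_self, cosTrap_zero hN]
    rcases Nat.eq_zero_or_pos m with h0 | h0
    · subst h0
      simp [cosTrap_zero hN, endWeight]
      field_simp
      norm_num
    · rcases hm.eq_or_lt with h1 | h1
      · subst h1
        rw [mul_div_assoc, div_self hN0, mul_one, ← two_mul, cosTrap_two_pi hN]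
        simp [endWeight]
        field_simp
        norm_num
      · rw [e2, key _ (by omega) (by omega) (by omega), endWeight, if_neg (by omega)]
        field_simp
        simp
  · rw [e1, e2, key _ (by omega) (by omega) (by omega), key _ (by omega) (by omega) (by omega)]
    simp

lemma chebNode_injOn {N : ℕ} (hN : 1 ≤ N) :
    Set.InjOn (fun k : Fin (N + 1) => chebNode N k) (Finset.univ : Finset (Fin (N + 1))) := by
  have hNpos : (0 : ℝ) < N := by positivity
  have mem : ∀ k : Fin (N + 1), Real.pi * (k : ℕ) / N ∈ Set.Icc 0 Real.pi := by
    intro k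
    refine ⟨by positivity, ?_⟩
    rw [div_le_iff₀ hNpos]
    have : ((k : ℕ) : ℝ) ≤ N := by exact_mod_cast Nat.lt_succ_iff.1 k.2
    gcongr
  intro a _ b _ h
  have := Real.injOn_cos (mem a) (mem b) h
  field_simp at this
  exact Fin.ext (by exact_mod_cast this)

lemma chebNode_mem (N k : ℕ) : chebNode N k ∈ Set.Icc (-1 : ℝ) 1 :=
  ⟨Real.neg_one_le_cos _, Real.cos_le_one _⟩

open Polynomial in
lemma lag_eq_basis (N : ℕ) (k : Fin (N + 1)) (x : ℝ) :
    lag N k x = (Lagrange.basis Finset.univ (fun k : Fin (N + 1) => chebNode N k) k).eval x := by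
  unfold lag Lagrange.basis
  rw [Polynomial.eval_prod]
  refine Finset.prod_congr rfl fun m _ => ?_
  change _ = Polynomial.eval x (Lagrange.basisDivisor (chebNode N k) (chebNode N m))
  unfold Lagrange.basisDivisor
  rw [Polynomial.eval_mul, Polynomial.eval_C, Polynomial.eval_sub,
    Polynomial.eval_X, Polynomial.eval_C]
  ring

lemma lag_node {N : ℕ} (hN : 1 ≤ N) (k m : Fin (N + 1)) :
    lag N k (chebNode N m) = if m = k then 1 else 0 := by
  rw [lag_eq_basis]
  split_ifs with h
  · subst h
    exact Lagrange.eval_basis_self (chebNode_injOn hN) (Finset.mem_univ _)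
  · exact Lagrange.eval_basis_of_ne (v := fun k : Fin (N + 1) => chebNode N k)
      (Ne.symm h) (Finset.mem_univ m)

/-- Both sides are polynomials of degree at most N in cos θ with the same values at the N + 1 nodes.
-/
lemma lag_cos {N : ℕ} (hN : 1 ≤ N) (k : Fin (N + 1)) (θ : ℝ) :
    lag N k (Real.cos θ) = lagTrig N k θ := by
  set P : Polynomial ℝ := ∑ j ∈ Finset.range (N + 1),
    Polynomial.C (endWeight N k * (2 / N * endWeight N j) * Real.cos (j * (Real.pi * k / N))) *
      Polynomial.Chebyshev.T ℝ (j : ℤ) with hP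
  have heval : ∀ θ, P.eval (Real.cos θ) = lagTrig N k θ := by
    intro θ
    rw [lagTrig_eq, hP, Polynomial.eval_finsetSum]
    refine Finset.sum_congr rfl fun j _ => ?_
    rw [Polynomial.eval_mul, Polynomial.eval_C, Polynomial.Chebyshev.T_real_cos]
    norm_cast
  rw [lag_eq_basis, ← heval]
  congr 1
  refine Polynomial.eq_of_degrees_lt_of_eval_index_eq
    (v := fun k : Fin (N + 1) => chebNode N k) Finset.univ (chebNode_injOn hN) ?_ ?_ ?_
  · rw [Lagrange.degree_basis (chebNode_injOn hN) (Finset.mem_univ _)]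
    simp only [Finset.card_univ, Fintype.card_fin]
    exact_mod_cast Nat.lt_succ_self _
  · rw [hP]
    refine (Polynomial.degree_sum_le _ _).trans_lt ?_
    rw [Finset.sup_lt_iff (by simp)]
    intro j hj
    rw [← Polynomial.smul_eq_C_mul]
    refine (Polynomial.degree_smul_le _ _).trans_lt ?_
    rw [Polynomial.Chebyshev.degree_T]
    have := Finset.mem_range.1 hj
    simpa using (by exact_mod_cast this : ((j : ℕ) : WithBot ℕ) < ((N + 1 : ℕ) : WithBot ℕ))
  · intro m _
    rw [← lag_eq_basis, lag_node hN, chebNode, heval,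
      lagTrig_node hN (Nat.lt_succ_iff.1 k.2) (Nat.lt_succ_iff.1 m.2)]
    simp [Fin.ext_iff]

/-! ### The Lebesgue constant in one variable -/

/-- The difference of the sides vanishes at 0 and has derivative (y/3)(sin y - y cos y), nonnegative
because y ≤ tan y. -/
lemma mul_cos_le_sin_mul {x : ℝ} (h0 : 0 ≤ x) (h1 : x < Real.pi / 2) :
    x * Real.cos x ≤ Real.sin x * (1 - x ^ 2 / 3) := by
  have hd : ∀ y : ℝ, HasDerivAt (fun y => Real.sin y * (1 - y ^ 2 / 3) - y * Real.cos y)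
      (y / 3 * (Real.sin y - y * Real.cos y)) y := by
    intro y
    have := ((Real.hasDerivAt_sin y).mul (((hasDerivAt_pow 2 y).div_const 3).const_sub 1)).sub
      ((hasDerivAt_id y).mul (Real.hasDerivAt_cos y))
    refine this.congr_deriv ?_
    simp
    ring
  have hm : MonotoneOn (fun y => Real.sin y * (1 - y ^ 2 / 3) - y * Real.cos y)
      (Set.Ico 0 (Real.pi / 2)) := by
    refine monotoneOn_of_deriv_nonneg (convex_Ico _ _)
      (fun y _ => (hd y).continuousAt.continuousWithinAt)
      (fun y _ => (hd y).differentiableAt.differentiableWithinAt) fun y hy => ?_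
    rw [interior_Ico] at hy
    rw [(hd y).deriv]
    have hc : 0 < Real.cos y := Real.cos_pos_of_mem_Ioo ⟨by linarith [hy.1, Real.pi_pos], hy.2⟩
    have ht := Real.le_tan hy.1.le hy.2
    rw [Real.tan_eq_sin_div_cos, le_div_iff₀ hc] at ht
    have := hy.1
    have h3 : 0 ≤ Real.sin y - y * Real.cos y := by linarith
    positivity
  have := hm ⟨le_rfl, by positivity⟩ ⟨h0, h1⟩ h0
  simp at this
  linarith

lemma cot_le {x : ℝ} (h0 : 0 < x) (h1 : x < Real.pi / 2) : Real.cot x ≤ 1 / x - x / 3 := by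
  have hs : 0 < Real.sin x := Real.sin_pos_of_pos_of_lt_pi h0 (by linarith [Real.pi_pos])
  rw [Real.cot_eq_cos_div_sin, div_le_iff₀ hs]
  have := mul_cos_le_sin_mul h0.le h1
  refine le_of_mul_le_mul_left (this.trans (le_of_eq ?_)) h0
  field_simp

lemma cot_add_pi (x : ℝ) : Real.cot (x + Real.pi) = Real.cot x := by
  simp [Real.cot_eq_cos_div_sin, Real.cos_add_pi, Real.sin_add_pi]

lemma cot_neg (x : ℝ) : Real.cot (-x) = -Real.cot x := by
  simp [Real.cot_eq_cos_div_sin, div_neg]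

/-- Monotonicity of sin(Nx)/sin x while Nx ≤ π/2, by induction from sin((n+1)x)/sin x = (sin nx /
sin x) cos x + cos nx, where every factor decreases. -/
lemma sin_mul_sin_nat_mul_le {N : ℕ} {x y : ℝ} (hx : 0 ≤ x) (hxy : x ≤ y)
    (hy : N * y ≤ Real.pi / 2) :
    Real.sin x * Real.sin (N * y) ≤ Real.sin y * Real.sin (N * x) := by
  have hpi := Real.pi_pos
  induction N with
  | zero => simp
  | succ n ih =>
    have hy0 : 0 ≤ y := hx.trans hxy
    push_cast at hy
    have hny : (n : ℝ) * y ≤ Real.pi / 2 := by nlinarith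
    have hy1 : y ≤ Real.pi / 2 := by nlinarith [mul_nonneg (Nat.cast_nonneg (α := ℝ) n) hy0]
    have hnx : (n : ℝ) * x ≤ n * y := by gcongr
    have h0nx : 0 ≤ (n : ℝ) * x := by positivity
    have i1 := ih hny
    have s1 : 0 ≤ Real.sin (n * x) := Real.sin_nonneg_of_nonneg_of_le_pi h0nx (by linarith)
    have s2 : 0 ≤ Real.sin x := Real.sin_nonneg_of_nonneg_of_le_pi hx (by linarith)
    have s3 : 0 ≤ Real.sin y := Real.sin_nonneg_of_nonneg_of_le_pi hy0 (by linarith)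
    have c1 : Real.cos y ≤ Real.cos x := Real.cos_le_cos_of_nonneg_of_le_pi hx (by linarith) hxy
    have c2 : Real.cos (n * y) ≤ Real.cos (n * x) :=
      Real.cos_le_cos_of_nonneg_of_le_pi h0nx (by linarith) hnx
    have c3 : 0 ≤ Real.cos y := Real.cos_nonneg_of_mem_Icc ⟨by linarith, hy1⟩
    push_cast
    rw [add_mul, add_mul, one_mul, one_mul, Real.sin_add, Real.sin_add]
    have a1 : Real.sin x * Real.sin (n * y) * Real.cos y ≤
        Real.sin y * Real.sin (n * x) * Real.cos x :=
      mul_le_mul i1 c1 c3 (mul_nonneg s3 s1)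
    have a2 : Real.sin x * Real.sin y * Real.cos (n * y) ≤
        Real.sin x * Real.sin y * Real.cos (n * x) :=
      mul_le_mul_of_nonneg_left c2 (mul_nonneg s2 s3)
    nlinarith

/-- Rearranged, this is 1 - cos v ≤ (1 - cos c)(1 - cos Nv), whose worst case is c = h = π/(2N). In
half angles it then compares sin(Nx)/sin x at |v|/2 and h/2, where sin²(Nh/2) = 1/2. -/
lemma cos_nat_mul_le {N : ℕ} (hN : 1 ≤ N) {v c : ℝ} (hv : |v| ≤ Real.pi / (2 * N))
    (hc : Real.pi / (2 * N) ≤ c) (hc' : c ≤ Real.pi) :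
    Real.cos (N * v) * (1 - Real.cos c) ≤ Real.cos v - Real.cos c := by
  have hpi := Real.pi_pos
  have hNpos : (0 : ℝ) < N := by positivity
  have h1N : (1 : ℝ) ≤ N := by exact_mod_cast hN
  set h := Real.pi / (2 * N) with hh
  have hNh : N * h = Real.pi / 2 := by rw [hh]; field_simp
  have hh0 : 0 < h := by positivity
  have hh1 : h ≤ Real.pi / 2 := by nlinarith
  have key := sin_mul_sin_nat_mul_le (N := N) (x := |v| / 2) (y := h / 2) (by positivity)
    (by linarith) (by linarith)
  have s1 : 0 ≤ Real.sin (|v| / 2) :=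
    Real.sin_nonneg_of_nonneg_of_le_pi (by positivity) (by linarith)
  have e1 : Real.sin (|v| / 2) ^ 2 = (1 - Real.cos v) / 2 := by
    rw [Real.sin_sq_eq_half_sub, mul_div_cancel₀ _ two_ne_zero, Real.cos_abs]; ring
  have e2 : Real.sin (h / 2) ^ 2 = (1 - Real.cos h) / 2 := by
    rw [Real.sin_sq_eq_half_sub, mul_div_cancel₀ _ two_ne_zero]; ring
  have e3 : Real.sin (N * (|v| / 2)) ^ 2 = (1 - Real.cos (N * v)) / 2 := by
    rw [Real.sin_sq_eq_half_sub, show 2 * (N * (|v| / 2)) = N * |v| by ring,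
      ← Real.cos_abs (N * v), abs_mul, Nat.abs_cast]
    ring
  have e4 : Real.sin (N * (h / 2)) ^ 2 = 1 / 2 := by
    rw [Real.sin_sq_eq_half_sub, show 2 * (N * (h / 2)) = N * h by ring, hNh, Real.cos_pi_div_two]
    norm_num
  have s2 : 0 ≤ Real.sin (N * (h / 2)) :=
    Real.sin_nonneg_of_nonneg_of_le_pi (by positivity) (by nlinarith)
  have k2 := mul_self_le_mul_self (mul_nonneg s1 s2) key
  have k3 : (1 - Real.cos v) / 2 * (1 / 2) ≤ (1 - Real.cos h) / 2 * ((1 - Real.cos (N * v)) / 2) := by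
    rw [← e1, ← e2, ← e3, ← e4]
    nlinarith
  have c1 : Real.cos c ≤ Real.cos h := Real.cos_le_cos_of_nonneg_of_le_pi hh0.le hc' hc
  have c2 := Real.cos_le_one (N * v)
  nlinarith

/-- The sum of `|cot|` over the `2N` equispaced points. -/
def cotSum (N : ℕ) (θ : ℝ) : ℝ := ∑ j ∈ Finset.range N,
  (|Real.cot ((θ + Real.pi * j / N) / 2)| + |Real.cot ((θ - Real.pi * (j + 1 : ℕ) / N) / 2)|)

lemma abs_cot_ends {N : ℕ} (hN : 1 ≤ N) (θ : ℝ) :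
    |Real.cot ((θ + Real.pi * N / N) / 2)| = |Real.cot ((θ - Real.pi * N / N) / 2)| := by
  have : (N : ℝ) ≠ 0 := by positivity
  rw [mul_div_cancel_right₀ _ this, ← cot_add_pi ((θ - Real.pi) / 2)]
  congr 2
  ring

/-- The shift moves each of the two chains of arguments by one place; the end terms match because
they differ by π, the period of cot. -/
lemma abs_sin_mul_cotSum_periodic {N : ℕ} (hN : 1 ≤ N) :
    Function.Periodic (fun θ => |Real.sin (N * θ)| * cotSum N θ) (Real.pi / N) := by
  intro θ
  have hN0 : (N : ℝ) ≠ 0 := by positivity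
  have h1 : |Real.sin (N * (θ + Real.pi / N))| = |Real.sin (N * θ)| := by
    rw [mul_add, mul_div_cancel₀ _ hN0, Real.sin_add_pi, abs_neg]
  have h2 : cotSum N (θ + Real.pi / N) = cotSum N θ := by
    simp only [cotSum, Finset.sum_add_distrib]
    have a1 : ∀ j ∈ Finset.range N, |Real.cot ((θ + Real.pi / N + Real.pi * j / N) / 2)| =
        |Real.cot ((θ + Real.pi * (j + 1 : ℕ) / N) / 2)| := by
      intro j _; push_cast; congr 3; ring
    have a2 : ∀ j ∈ Finset.range N, |Real.cot ((θ + Real.pi / N - Real.pi * (j + 1 : ℕ) / N) / 2)| =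
        |Real.cot ((θ - Real.pi * (j : ℕ) / N) / 2)| := by
      intro j _; push_cast; congr 3; ring
    rw [Finset.sum_congr rfl a1, Finset.sum_congr rfl a2]
    have b1 := Finset.sum_range_sub (fun j : ℕ => |Real.cot ((θ + Real.pi * j / N) / 2)|) N
    have b2 := Finset.sum_range_sub (fun j : ℕ => |Real.cot ((θ - Real.pi * j / N) / 2)|) N
    rw [Finset.sum_sub_distrib] at b1 b2
    have b3 := abs_cot_ends hN θ
    simp only [Nat.cast_zero, mul_zero, zero_div, add_zero, sub_zero] at b1 b2
    linarith
  simp only [h1, h2]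

lemma abs_cosTrap {N : ℕ} (hN : 1 ≤ N) {θ : ℝ} (h : Real.sin (N * θ) ≠ 0) (k : ℤ) :
    |cosTrap N (θ + Real.pi * k / N)| =
      |Real.sin (N * θ)| / 2 * |Real.cot ((θ + Real.pi * k / N) / 2)| := by
  have hN0 : (N : ℝ) ≠ 0 := by positivity
  have h1 : |Real.sin (N * (θ + Real.pi * k / N))| = |Real.sin (N * θ)| := by
    rw [mul_add, mul_div_cancel₀ _ hN0, mul_comm Real.pi, Real.sin_add_int_mul_pi, abs_mul]
    simp
  rw [cosTrap_of_sin_ne hN, abs_mul, abs_div, h1, abs_two]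
  intro h2
  obtain ⟨n, hn⟩ := Real.sin_eq_zero_iff.1 h2
  apply h
  rw [← abs_eq_zero, ← h1, abs_eq_zero, Real.sin_eq_zero_iff]
  exact ⟨N * (2 * n), by push_cast; linear_combination 2 * (N : ℝ) * hn⟩

/-- Triangle inequality in `lagTrig`; the end weights merge the two families of cotangents into one
sum over 2N equispaced points. -/
lemma sum_abs_lag_le_cotSum {N : ℕ} (hN : 1 ≤ N) {θ : ℝ} (h : Real.sin (N * θ) ≠ 0) :
    ∑ k, |lag N k (Real.cos θ)| ≤ |Real.sin (N * θ)| * cotSum N θ / (2 * N) := by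
  have hN0 : (N : ℝ) ≠ 0 := by positivity
  have h1 : ∀ k : ℕ, |lagTrig N k θ| ≤ endWeight N k * (|Real.sin (N * θ)| / (2 * N) *
      (|Real.cot ((θ - Real.pi * k / N) / 2)| + |Real.cot ((θ + Real.pi * k / N) / 2)|)) := by
    intro k
    have hw : 0 ≤ endWeight N k := by rw [endWeight]; split_ifs <;> norm_num
    rw [lagTrig, abs_mul, abs_of_nonneg (by positivity)]
    have t1 := abs_cosTrap hN h (k : ℤ)
    have t2 := abs_cosTrap hN h (-k : ℤ)
    have e : θ + Real.pi * ((-k : ℤ) : ℝ) / N = θ - Real.pi * k / N := by push_cast; ring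
    rw [e] at t2
    simp only [Int.cast_natCast] at t1
    calc _ ≤ endWeight N k / N * (|cosTrap N (θ - Real.pi * k / N)| +
          |cosTrap N (θ + Real.pi * k / N)|) := by
          gcongr
          exact abs_add_le _ _
      _ = _ := by
          rw [t1, t2]
          field_simp
  calc ∑ k : Fin (N + 1), |lag N k (Real.cos θ)| = ∑ k : Fin (N + 1), |lagTrig N k θ| := by
        simp_rw [lag_cos hN]
    _ = ∑ k ∈ Finset.range (N + 1), |lagTrig N k θ| :=
        Fin.sum_univ_eq_sum_range (fun k => |lagTrig N k θ|) (N + 1)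
    _ ≤ _ := Finset.sum_le_sum fun k _ => h1 k
    _ = |Real.sin (N * θ)| * cotSum N θ / (2 * N) := by
        rw [sum_endWeight hN (fun k : ℕ => |Real.sin (N * θ)| / (2 * N) *
          (|Real.cot ((θ - Real.pi * k / N) / 2)| + |Real.cot ((θ + Real.pi * k / N) / 2)|))]
        have b1 := Finset.sum_range_sub (fun j : ℕ => |Real.cot ((θ + Real.pi * j / N) / 2)|) N
        have b2 := Finset.sum_range_sub (fun j : ℕ => |Real.cot ((θ - Real.pi * j / N) / 2)|) N
        rw [Finset.sum_sub_distrib] at b1 b2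
        have b3 := abs_cot_ends hN θ
        simp only [Nat.cast_zero, mul_zero, zero_div, add_zero, sub_zero] at b1 b2
        rw [cotSum, ← Finset.sum_div, Finset.sum_add_distrib, ← Finset.mul_sum, ← Finset.mul_sum,
          Finset.sum_add_distrib, Finset.sum_add_distrib, Finset.sum_add_distrib]
        linear_combination |Real.sin (N * θ)| / (4 * N) * (b1 - b2 + b3)

/-- Each pair of terms is largest at θ = π/(2N). If a and -b are the half-arguments, a + b does not
depend on θ and sin(Nθ) = cos(N(a - b)). Since cot a + cot b = sin(a+b)/(sin a sin b) and 2 sin a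
sin b = cos(a-b) - cos(a+b), the claim is `cos_nat_mul_le` with v = a - b and c = a + b. -/
lemma sin_mul_cot_pair {N : ℕ} (hN : 1 ≤ N) {θ : ℝ} (h0 : 0 < θ) (h1 : θ < Real.pi / N)
    {j : ℕ} (hj : j < N) :
    |Real.sin (N * θ)| * (|Real.cot ((θ + Real.pi * j / N) / 2)| +
      |Real.cot ((θ - Real.pi * (j + 1 : ℕ) / N) / 2)|) ≤
      2 * Real.cot ((2 * j + 1) * Real.pi / (4 * N)) := by
  have hpi := Real.pi_pos
  have hN0 : (0 : ℝ) < N := by positivity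
  set h := Real.pi / (2 * N) with hh
  have hNh : N * h = Real.pi / 2 := by rw [hh]; field_simp
  have hh0 : 0 < h := by positivity
  have h1' : θ < 2 * h := by rw [hh]; convert h1 using 1; field_simp
  have hj' : (j : ℝ) + 1 ≤ N := by exact_mod_cast hj
  have hj0 : (0 : ℝ) ≤ j := Nat.cast_nonneg j
  set a := (θ + 2 * j * h) / 2 with ha
  set b := (2 * (j + 1) * h - θ) / 2 with hb
  have ea : (θ + Real.pi * j / N) / 2 = a := by rw [ha, hh]; field_simp
  have eb : (θ - Real.pi * (j + 1 : ℕ) / N) / 2 = -b := by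
    rw [hb, hh]; push_cast; field_simp; ring
  have hjh : ((j : ℝ) + 1) * h ≤ Real.pi / 2 := by rw [← hNh]; gcongr
  have ec : (2 * j + 1) * Real.pi / (4 * N) = (a + b) / 2 := by rw [ha, hb, hh]; field_simp; ring
  have a0 : 0 < a := by positivity
  have b0 : 0 < b := by
    rw [hb]
    nlinarith [mul_nonneg hj0 hh0.le]
  have a1 : a < Real.pi / 2 := by rw [ha]; nlinarith
  have b1 : b < Real.pi / 2 := by rw [hb]; nlinarith
  have hsN : Real.sin (N * θ) = Real.cos (N * (a - b)) := by
    rw [show (N : ℝ) * (a - b) = N * θ - Real.pi / 2 by rw [ha, hb, ← hNh]; ring,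
      Real.cos_sub_pi_div_two]
  have hN1 : N * θ ≤ Real.pi := by
    have := mul_le_mul_of_nonneg_left h1'.le hN0.le
    linarith
  rw [ea, eb, cot_neg, abs_neg, ec, abs_of_nonneg (Real.sin_nonneg_of_nonneg_of_le_pi
    (by positivity) hN1), hsN]
  have sa := Real.sin_pos_of_pos_of_lt_pi a0 (by linarith)
  have sb := Real.sin_pos_of_pos_of_lt_pi b0 (by linarith)
  have ca := Real.cos_pos_of_mem_Ioo ⟨by linarith, a1⟩
  have cb := Real.cos_pos_of_mem_Ioo ⟨by linarith, b1⟩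
  have hkey := cos_nat_mul_le hN (v := a - b) (c := a + b)
    (by rw [abs_le]; constructor <;> (rw [ha, hb]; linarith))
    (by rw [ha, hb]; nlinarith [mul_nonneg hj0 hh0.le]) (by linarith)
  rw [Real.cos_sub a b] at hkey
  set c2 := (a + b) / 2 with hc2
  have s2 := Real.sin_pos_of_pos_of_lt_pi (show 0 < c2 by positivity) (by linarith)
  have k2 := Real.cos_pos_of_mem_Ioo (x := c2) ⟨by linarith, by linarith⟩
  have e1 : 1 - Real.cos (a + b) = 2 * Real.sin c2 ^ 2 := by
    rw [Real.sin_sq_eq_half_sub, hc2, mul_div_cancel₀ _ two_ne_zero]; ring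
  have e2 : Real.sin (a + b) = 2 * Real.sin c2 * Real.cos c2 := by
    rw [← Real.sin_two_mul, hc2, mul_div_cancel₀ _ two_ne_zero]
  have e3 : Real.cot a + Real.cot b = Real.sin (a + b) / (Real.sin a * Real.sin b) := by
    rw [Real.cot_eq_cos_div_sin, Real.cot_eq_cos_div_sin, Real.sin_add]
    field_simp
    ring
  have pa : 0 < Real.cot a := by rw [Real.cot_eq_cos_div_sin]; positivity
  have pb : 0 < Real.cot b := by rw [Real.cot_eq_cos_div_sin]; positivity
  rw [abs_of_pos pa, abs_of_pos pb, e3, e2, Real.cot_eq_cos_div_sin, ← mul_div_assoc,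
    ← mul_div_assoc, div_le_div_iff₀ (by positivity) s2]
  rw [e1, Real.cos_add a b] at hkey
  have : Real.cos (N * (a - b)) * Real.sin c2 ^ 2 ≤ Real.sin a * Real.sin b := by linarith
  have := mul_le_mul_of_nonneg_left this (show 0 ≤ 2 * Real.cos c2 by positivity)
  nlinarith

lemma sum_inv_odd_le {N : ℕ} (hN : 1 ≤ N) :
    ∑ j ∈ Finset.range N, (1 : ℝ) / (2 * j + 1) ≤ 1 + Real.log N / 2 := by
  induction N, hN using Nat.le_induction with
  | base => simp
  | succ n hn ih =>
    rw [Finset.sum_range_succ]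
    have hn0 : (0 : ℝ) < n := by positivity
    have := Real.le_log_one_add_of_nonneg (x := 1 / (n : ℝ)) (by positivity)
    have e1 : 2 * (1 / (n : ℝ)) / (1 / (n : ℝ) + 2) = 2 * (1 / (2 * n + 1)) := by
      field_simp
      ring
    have e2 : Real.log (1 + 1 / (n : ℝ)) = Real.log ((n + 1 : ℕ) : ℝ) - Real.log n := by
      rw [← Real.log_div (by positivity) (by positivity)]
      congr 1
      push_cast
      field_simp
    rw [e1, e2] at this
    linarith

/-- With cot x ≤ 1/x - x/3, the reciprocals of odd numbers produce the logarithm, and the odd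
numbers sum to N², which produces -π/12. -/
lemma sum_cot_le {N : ℕ} (hN : 1 ≤ N) :
    ∑ j ∈ Finset.range N, Real.cot ((2 * j + 1) * Real.pi / (4 * N)) ≤
      N * (4 / Real.pi - Real.pi / 12 + 2 / Real.pi * Real.log N) := by
  have hpi := Real.pi_pos
  have hN0 : (0 : ℝ) < N := by positivity
  have h1 : ∀ j ∈ Finset.range N, Real.cot ((2 * (j : ℝ) + 1) * Real.pi / (4 * N)) ≤
      4 * N / Real.pi * (1 / (2 * j + 1)) - Real.pi / (12 * N) * (2 * j + 1) := by
    intro j hj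
    have hj' : (j : ℝ) + 1 ≤ N := by exact_mod_cast Finset.mem_range.1 hj
    refine (cot_le (by positivity) ?_).trans (le_of_eq ?_)
    · rw [div_lt_div_iff₀ (by positivity) (by positivity)]
      nlinarith
    · field_simp
      ring
  have h2 : ∑ j ∈ Finset.range N, (2 * (j : ℝ) + 1) = N ^ 2 := by
    clear h1 hN0 hN
    induction N with
    | zero => simp
    | succ n ih => rw [Finset.sum_range_succ, ih]; push_cast; ring
  refine (Finset.sum_le_sum h1).trans ?_
  rw [Finset.sum_sub_distrib, ← Finset.mul_sum, ← Finset.mul_sum, h2]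
  have := mul_le_mul_of_nonneg_left (sum_inv_odd_le hN)
    (show 0 ≤ 4 * N / Real.pi by positivity)
  refine (sub_le_sub_right this _).trans (le_of_eq ?_)
  field_simp
  ring

lemma one_le_lebesgueBound (N : ℕ) :
    1 ≤ 4 / Real.pi - Real.pi / 12 + 2 / Real.pi * Real.log N := by
  have h3 := Real.pi_gt_three
  have h4 := Real.pi_lt_d2
  have hl : 0 ≤ Real.log N := Real.log_natCast_nonneg N
  have : 1 ≤ 4 / Real.pi - Real.pi / 12 := by
    rw [div_sub_div _ _ (by positivity) (by positivity), le_div_iff₀ (by positivity)]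
    nlinarith
  have : 0 ≤ 2 / Real.pi * Real.log N := by positivity
  linarith

/-- The Lebesgue constant of the Chebyshev extremal points grows at most logarithmically. -/
lemma sum_abs_lag_le {N : ℕ} (hN : 1 ≤ N) {x : ℝ} (hx : x ∈ Set.Icc (-1 : ℝ) 1) :
    ∑ k, |lag N k x| ≤ 4 / Real.pi - Real.pi / 12 + 2 / Real.pi * Real.log N := by
  have hpi := Real.pi_pos
  have hN0 : (0 : ℝ) < N := by positivity
  set θ := Real.arccos x with hθ
  have hxθ : x = Real.cos θ := (Real.cos_arccos hx.1 hx.2).symm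
  rw [hxθ]
  by_cases h : Real.sin (N * θ) = 0
  -- Here cos θ is itself a node, where the Lebesgue function equals 1.
  · obtain ⟨n, hn⟩ := Real.sin_eq_zero_iff.1 h
    have hθ0 : 0 ≤ θ := Real.arccos_nonneg x
    have hθ1 : θ ≤ Real.pi := Real.arccos_le_pi x
    have n0 : (0 : ℝ) ≤ n := by
      by_contra hneg
      push Not at hneg
      nlinarith [mul_nonneg hN0.le hθ0]
    have n1 : (n : ℝ) ≤ N := by
      by_contra hneg
      push Not at hneg
      nlinarith [mul_le_mul_of_nonneg_left hθ1 hN0.le]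
    obtain ⟨m, rfl⟩ := Int.eq_ofNat_of_zero_le (by exact_mod_cast n0 : 0 ≤ n)
    have hm : m < N + 1 := by
      have : m ≤ N := by exact_mod_cast n1
      omega
    have : Real.cos θ = chebNode N (⟨m, hm⟩ : Fin (N + 1)) := by
      rw [chebNode]
      congr 1
      have hn' : (m : ℝ) * Real.pi = N * θ := by exact_mod_cast hn
      field_simp
      linarith
    rw [this]
    simp_rw [fun k => lag_node hN k ⟨m, hm⟩]
    refine le_trans (le_of_eq ?_) (one_le_lebesgueBound N)
    simp [apply_ite abs]
  · refine (sum_abs_lag_le_cotSum hN h).trans ?_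
    rw [div_le_iff₀ (by positivity)]
    have hp : 0 < Real.pi / N := by positivity
    obtain ⟨θ', h1, h2⟩ := (abs_sin_mul_cotSum_periodic hN).exists_mem_Ico₀ hp θ
    rw [h2]
    rcases h1.1.eq_or_lt with h0 | h0
    · rw [← h0]
      have := one_le_lebesgueBound N
      simp only [mul_zero, Real.sin_zero, abs_zero, zero_mul]
      positivity
    · rw [cotSum, Finset.mul_sum]
      refine (Finset.sum_le_sum fun j hj =>
        sin_mul_cot_pair hN h0 h1.2 (Finset.mem_range.1 hj)).trans ?_
      rw [← Finset.mul_sum]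
      have := sum_cot_le hN
      linarith

/-! ### Contour representation of the interpolation error -/

open Complex Metric Real in
lemma circleAverage_inv {f : ℂ → ℂ} (R : ℝ) :
    circleAverage f 0 R = circleAverage (fun u => f u⁻¹) 0 R⁻¹ := by
  rw [circleAverage_eq_circleAverage_zero_one, ← circleAverage_zero_one_congr_inv,
    circleAverage_eq_circleAverage_zero_one (R := R⁻¹)]
  congr 1
  ext z
  simp [mul_comm]

open Complex Metric Real in
lemma circleAverage_inv_real {f : ℂ → ℝ} (R : ℝ) :
    circleAverage f 0 R = circleAverage (fun u => f u⁻¹) 0 R⁻¹ := by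
  rw [circleAverage_eq_circleAverage_zero_one, ← circleAverage_zero_one_congr_inv,
    circleAverage_eq_circleAverage_zero_one (R := R⁻¹)]
  congr 1
  ext z
  simp [mul_comm]

open Real in
lemma norm_circleAverage_le (f : ℂ → ℂ) (R : ℝ) :
    ‖circleAverage f 0 R‖ ≤ circleAverage (fun z => ‖f z‖) 0 R := by
  rw [circleAverage, circleAverage, smul_eq_mul, norm_smul, Real.norm_eq_abs,
    abs_of_pos (inv_pos.2 two_pi_pos)]
  gcongr
  exact intervalIntegral.norm_integral_le_integral_norm two_pi_pos.le

/-- `dslope` divides out one zero at a time: the quotient stays holomorphic and still vanishes at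
the remaining points. -/
lemma exists_eq_prod_sub_mul {U : Set ℂ} (hU : IsOpen U) (s : Finset ℂ) :
    ∀ {E : ℂ → ℂ}, DifferentiableOn ℂ E U → (∀ a ∈ s, a ∈ U) → (∀ a ∈ s, E a = 0) →
      ∃ k : ℂ → ℂ, DifferentiableOn ℂ k U ∧ ∀ w, E w = (∏ a ∈ s, (w - a)) * k w := by
  classical
  induction s using Finset.induction_on with
  | empty => intro E hE _ _; exact ⟨E, hE, fun w => by simp⟩
  | insert a s ha ih =>
    intro E hE hsU h0
    have hd : DifferentiableOn ℂ (dslope E a) U :=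
      (Complex.differentiableOn_dslope
        (hU.mem_nhds (hsU a (Finset.mem_insert_self _ _)))).2 hE
    have hEa : E a = 0 := h0 a (Finset.mem_insert_self _ _)
    obtain ⟨k, hk, hk'⟩ := ih hd (fun b hb => hsU b (Finset.mem_insert_of_mem hb)) (by
      intro b hb
      have hne : b ≠ a := fun h => ha (h ▸ hb)
      rw [dslope_of_ne _ hne, slope_def_field, h0 b (Finset.mem_insert_of_mem hb), hEa]
      simp)
    refine ⟨k, hk, fun w => ?_⟩
    rw [Finset.prod_insert ha, mul_assoc, ← hk' w]
    have := sub_smul_dslope E a w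
    rw [smul_eq_mul, hEa, sub_zero] at this
    exact this.symm

/-- The kernel `∑ (ζ^k - ζ^{-k}) w^{-k}`. -/
def sineKernel (ζ w : ℂ) : ℂ := ζ / (w - ζ) - ζ⁻¹ / (w - ζ⁻¹)

-- The average is (2πi)⁻¹ ∮ H(w)/w dw, so this is Cauchy's theorem on an annulus.
open Complex Metric Real in
lemma circleAverage_eq_of_annulus {ρ R : ℝ} (hR : 1 < R) (hRρ : R < ρ) {H : ℂ → ℂ}
    (hH : DifferentiableOn ℂ H {w | ρ⁻¹ < ‖w‖ ∧ ‖w‖ < ρ}) :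
    circleAverage H 0 R = circleAverage H 0 R⁻¹ := by
  have h0 : 0 < R := by linarith
  have hopen : IsOpen {w : ℂ | ρ⁻¹ < ‖w‖ ∧ ‖w‖ < ρ} :=
    (isOpen_lt continuous_const continuous_norm).inter (isOpen_lt continuous_norm continuous_const)
  have hinv : ρ⁻¹ < R⁻¹ := by gcongr
  have hle : R⁻¹ ≤ R := (inv_le_one_of_one_le₀ hR.le).trans hR.le
  rw [circleAverage_eq_circleIntegral h0.ne', circleAverage_eq_circleIntegral (inv_pos.2 h0).ne']
  congr 1
  refine circleIntegral_sub_center_inv_smul_eq_of_differentiable_on_annulus_off_countable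
    (inv_pos.2 h0) hle Set.countable_empty ?_ ?_
  · refine hH.continuousOn.mono fun w hw => ?_
    simp only [Set.mem_sdiff, mem_closedBall, dist_zero_right, mem_ball, not_lt] at hw
    exact ⟨hinv.trans_le hw.2, hw.1.trans_lt hRρ⟩
  · intro w hw
    simp only [Set.sdiff_empty, Set.mem_sdiff, mem_closedBall, dist_zero_right, mem_ball,
      not_le] at hw
    exact hH.differentiableAt (hopen.mem_nhds ⟨hinv.trans hw.2, hw.1.trans hRρ⟩)

-- Oddness under inversion makes the Laurent series ∑ g_k (w^k - w^{-k}), and pairing with the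
-- kernel recovers it. Instead of using series, Cauchy's formula expresses G ζ through both boundary
-- circles, and w ↦ w⁻¹ folds the inner circle onto the outer one.
open Complex Metric Real in
lemma eq_circleAverage_sineKernel {ρ R : ℝ} (hR : 1 < R) (hRρ : R < ρ) {G : ℂ → ℂ}
    (hG : DifferentiableOn ℂ G {w | ρ⁻¹ < ‖w‖ ∧ ‖w‖ < ρ})
    (hanti : ∀ w, ‖w‖ = R → G w⁻¹ = -G w) {ζ : ℂ} (hζ : ‖ζ‖ = 1) :
    G ζ = circleAverage (fun w => G w * sineKernel ζ w) 0 R := by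
  have h0 : 0 < R := by linarith
  have hRi : R⁻¹ < 1 := inv_lt_one_of_one_lt₀ hR
  have hRi0 : 0 < R⁻¹ := inv_pos.2 h0
  have hζ0 : ζ ≠ 0 := norm_pos_iff.1 (by rw [hζ]; norm_num)
  have hopen : IsOpen {w : ℂ | ρ⁻¹ < ‖w‖ ∧ ‖w‖ < ρ} :=
    (isOpen_lt continuous_const continuous_norm).inter (isOpen_lt continuous_norm continuous_const)
  have hinv : ρ⁻¹ < R⁻¹ := by gcongr
  have hne : ∀ {r : ℝ}, 0 < r → ∀ w ∈ sphere (0 : ℂ) |r|, ‖w‖ = r := by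
    intro r hr w hw
    simpa [abs_of_pos hr] using hw
  have hGR : ContinuousOn G (sphere 0 |R|) :=
    hG.continuousOn.mono fun w hw => by
      have := hne h0 w hw
      exact ⟨by rw [this]; linarith, by rw [this]; exact hRρ⟩
  have hGRi : ContinuousOn G (sphere 0 |R⁻¹|) :=
    hG.continuousOn.mono fun w hw => by
      have := hne hRi0 w hw
      exact ⟨by rw [this]; exact hinv, by rw [this]; linarith⟩
  have hsub : ∀ {r : ℝ}, 0 < r → r ≠ 1 → ∀ w ∈ sphere (0 : ℂ) |r|, w - ζ ≠ 0 := by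
    intro r hr hr1 w hw h
    have := hne hr w hw
    rw [sub_eq_zero.1 h, hζ] at this
    exact hr1 this.symm
  have hcont : ∀ {r : ℝ}, 0 < r → r ≠ 1 →
      ContinuousOn (fun w : ℂ => w / (w - ζ)) (sphere 0 |r|) := by
    intro r hr hr1
    exact continuousOn_id.div (continuousOn_id.sub continuousOn_const) (hsub hr hr1)
  -- the difference quotient integrates to the same value on both circles
  have hH : DifferentiableOn ℂ (fun w => w * dslope G ζ w) {w | ρ⁻¹ < ‖w‖ ∧ ‖w‖ < ρ} :=
    differentiableOn_id.mul ((Complex.differentiableOn_dslope (hopen.mem_nhds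
      ⟨by rw [hζ]; linarith, by rw [hζ]; linarith⟩)).2 hG)
  have hsplit : ∀ {r : ℝ}, 0 < r → r ≠ 1 → ContinuousOn G (sphere 0 |r|) →
      circleAverage (fun w => w * dslope G ζ w) 0 r =
        circleAverage (fun w => w / (w - ζ) * G w) 0 r -
          circleAverage (fun w => w / (w - ζ)) 0 r * G ζ := by
    intro r hr hr1 hGr
    have e1 : circleAverage (fun w => w * dslope G ζ w) 0 r =
        circleAverage (fun w => w / (w - ζ) * G w - G ζ • (w / (w - ζ))) 0 r := by
      refine circleAverage_congr_sphere fun w hw => ?_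
      have hw1 := hsub hr hr1 w hw
      rw [dslope_of_ne _ (sub_ne_zero.1 hw1), slope_def_field, smul_eq_mul]
      field_simp
    rw [e1, circleAverage_fun_sub
      (show CircleIntegrable (fun w => w / (w - ζ) * G w) 0 r from
        ((hcont hr hr1).mul hGr).circleIntegrable')
      (show CircleIntegrable (fun w => G ζ • (w / (w - ζ))) 0 r from
        ((hcont hr hr1).const_smul (G ζ)).circleIntegrable'),
      circleAverage_fun_smul, smul_eq_mul, mul_comm (G ζ)]
  have avgR : circleAverage (fun w => w / (w - ζ)) 0 R = 1 := by
    have := DiffContOnCl.circleAverage_smul_div (f := fun _ => (1 : ℂ)) (c := 0) (R := R) (w := ζ)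
      diffContOnCl_const (by simp [hζ, abs_of_pos h0, hR])
    simpa using this
  have avgRi : circleAverage (fun w => w / (w - ζ)) 0 R⁻¹ = 0 := by
    have : DiffContOnCl ℂ (fun w => w / (w - ζ)) (ball 0 |R⁻¹|) := by
      refine DifferentiableOn.diffContOnCl ?_
      refine differentiableOn_id.div (differentiableOn_id.sub_const _) ?_
      intro w hw h
      have h1 := closure_ball_subset_closedBall hw
      simp only [mem_closedBall, dist_zero_right, abs_of_pos hRi0] at h1
      rw [sub_eq_zero.1 h, hζ] at h1
      linarith
    rw [this.circleAverage]
    simp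
  have eqH := circleAverage_eq_of_annulus hR hRρ hH
  rw [hsplit h0 hR.ne' hGR, hsplit hRi0 hRi.ne hGRi, avgR, avgRi] at eqH
  -- the inner circle, reflected
  have inner : circleAverage (fun w => w / (w - ζ) * G w) 0 R⁻¹ =
      circleAverage (fun w => ζ⁻¹ / (w - ζ⁻¹) * G w) 0 R := by
    rw [circleAverage_inv (R := R⁻¹), inv_inv]
    refine circleAverage_congr_sphere fun w hw => ?_
    have hwR := hne h0 w hw
    have hw0 : w ≠ 0 := norm_pos_iff.1 (by rw [hwR]; exact h0)
    have h1 : w - ζ⁻¹ ≠ 0 := by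
      intro h
      rw [sub_eq_zero.1 h, norm_inv, hζ] at hwR
      simp at hwR
      exact hR.ne hwR
    have h2 : w⁻¹ - ζ ≠ 0 := by
      intro h
      apply h1
      rw [← sub_eq_zero.1 h, inv_inv, sub_self]
    rw [hanti w hwR]
    have h3 : (1 : ℂ) - w * ζ ≠ 0 := by
      intro h
      apply h2
      field_simp
      rw [h, mul_zero]
    have h4 : w * ζ - 1 ≠ 0 := by
      intro h
      apply h3
      linear_combination -h
    field_simp
    ring
  -- The constant Laurent coefficient vanishes by oddness; hence w/(w - ζ) = 1 + ζ/(w - ζ) may be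
  -- replaced by ζ/(w - ζ).
  have avgG : circleAverage G 0 R = 0 := by
    have h1 := circleAverage_eq_of_annulus hR hRρ hG
    have h2 : circleAverage G 0 R⁻¹ = -circleAverage G 0 R := by
      rw [circleAverage_inv (R := R⁻¹), inv_inv, ← neg_one_smul ℂ (circleAverage G 0 R),
        ← circleAverage_fun_smul]
      refine circleAverage_congr_sphere fun w hw => ?_
      simp [hanti w (hne h0 w hw)]
    rw [h2] at h1
    exact CharZero.eq_neg_self_iff.1 h1
  have hcont' : ContinuousOn (fun w : ℂ => ζ⁻¹ / (w - ζ⁻¹)) (sphere 0 |R|) := by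
    refine continuousOn_const.div (continuousOn_id.sub continuousOn_const) ?_
    intro w hw h
    have hwR := hne h0 w hw
    rw [sub_eq_zero.1 h, norm_inv, hζ] at hwR
    simp at hwR
    exact hR.ne hwR
  have final : circleAverage (fun w => G w * sineKernel ζ w) 0 R =
      circleAverage (fun w => (w / (w - ζ) * G w - G w) - ζ⁻¹ / (w - ζ⁻¹) * G w) 0 R := by
    refine circleAverage_congr_sphere fun w hw => ?_
    have h1 := hsub h0 hR.ne' w hw
    simp only [sineKernel]
    have : w / (w - ζ) = 1 + ζ / (w - ζ) := by field_simp; ring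
    rw [this]
    ring
  have i1 : CircleIntegrable (fun w => w / (w - ζ) * G w) 0 R :=
    ((hcont h0 hR.ne').mul hGR).circleIntegrable'
  have i2 : CircleIntegrable (fun w => ζ⁻¹ / (w - ζ⁻¹) * G w) 0 R :=
    (hcont'.mul hGR).circleIntegrable'
  rw [final, circleAverage_fun_sub
    (show CircleIntegrable (fun w => w / (w - ζ) * G w - G w) 0 R from
      i1.sub hGR.circleIntegrable') i2,
    circleAverage_fun_sub i1 hGR.circleIntegrable', avgG, ← inner]
  linear_combination -eqH

/-! ### Mean squares of the kernels -/

/-- The Joukowski map. -/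
def joukowski (w : ℂ) : ℂ := (w + w⁻¹) / 2

lemma joukowski_inv (w : ℂ) : joukowski w⁻¹ = joukowski w := by
  rw [joukowski, joukowski, inv_inv, add_comm]

/-- J(w) ∓ 1 = (w ∓ 1)²/(2w), so the parallelogram law applies; circles about 0 are mapped into
ellipses with foci ±1. -/
lemma norm_sub_one_add_norm_add_one_joukowski {w : ℂ} (hw : w ≠ 0) :
    ‖joukowski w - 1‖ + ‖joukowski w + 1‖ = ‖w‖ + ‖w‖⁻¹ := by
  have h1 : joukowski w - 1 = (w - 1) ^ 2 / (2 * w) := by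
    rw [joukowski]; field_simp; ring
  have h2 : joukowski w + 1 = (w + 1) ^ 2 / (2 * w) := by
    rw [joukowski]; field_simp; ring
  have h0 : 0 < ‖w‖ := norm_pos_iff.2 hw
  rw [h1, h2, norm_div, norm_div, norm_pow, norm_pow, norm_mul, ← add_div]
  have := parallelogram_law_with_norm ℝ w 1
  rw [norm_one] at this
  have h3 : ‖w - 1‖ ^ 2 + ‖w + 1‖ ^ 2 = 2 * (‖w‖ ^ 2 + 1) := by nlinarith
  rw [h3]
  simp
  field_simp

lemma joukowski_mem_bernstein {ρ : ℝ} (hρ : 1 < ρ) {w : ℂ} (h1 : ρ⁻¹ < ‖w‖) (h2 : ‖w‖ < ρ) :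
    joukowski w ∈ bernstein ρ := by
  have hρ0 : 0 < ρ := by linarith
  have h0 : 0 < ‖w‖ := (inv_pos.2 hρ0).trans h1
  have hw : w ≠ 0 := norm_pos_iff.1 h0
  change ‖joukowski w - 1‖ + ‖joukowski w + 1‖ < ρ + ρ⁻¹
  rw [norm_sub_one_add_norm_add_one_joukowski hw]
  have h3 : 1 < ‖w‖ * ρ := by rwa [inv_lt_iff_one_lt_mul₀ hρ0] at h1
  have : 0 < (ρ - ‖w‖) * (‖w‖ * ρ - 1) / (‖w‖ * ρ) := by
    apply div_pos (mul_pos (by linarith) (by linarith)) (by positivity)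
  have e : (ρ - ‖w‖) * (‖w‖ * ρ - 1) / (‖w‖ * ρ) = ρ + ρ⁻¹ - (‖w‖ + ‖w‖⁻¹) := by
    field_simp
    ring
  linarith

lemma ofReal_mem_bernstein {ρ : ℝ} (hρ : 1 < ρ) {x : ℝ} (hx : x ∈ Set.Icc (-1 : ℝ) 1) :
    (x : ℂ) ∈ bernstein ρ := by
  change ‖(x : ℂ) - 1‖ + ‖(x : ℂ) + 1‖ < ρ + ρ⁻¹
  rw [← Complex.ofReal_one, ← Complex.ofReal_sub, ← Complex.ofReal_add, Complex.norm_real,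
    Complex.norm_real, Real.norm_eq_abs, Real.norm_eq_abs, abs_of_nonpos (by linarith [hx.2]),
    abs_of_nonneg (by linarith [hx.1])]
  have h0 : 0 < ρ := by linarith
  have : 0 < (ρ - 1) ^ 2 / ρ := by
    have : 0 < ρ - 1 := by linarith
    positivity
  have e : (ρ - 1) ^ 2 / ρ = ρ + ρ⁻¹ - 2 := by field_simp; ring
  linarith

open Complex Metric Real in
lemma circleAverage_re_eq {f : ℂ → ℂ} {r : ℝ} (hf : DiffContOnCl ℂ f (ball 0 |r|)) (hr : r ≠ 0) :
    circleAverage (fun z => (f z).re) 0 r = (f 0).re := by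
  have hc : ContinuousOn f (sphere 0 |r|) := by
    refine hf.2.mono ?_
    rw [closure_ball _ (abs_pos.2 hr).ne']
    exact sphere_subset_closedBall
  have := Complex.reCLM.circleAverage_comp_comm (f := f) (c := 0) (R := r) hc.circleIntegrable'
  rw [hf.circleAverage] at this
  exact this

/-- The Poisson kernel: it exhibits 1/|1 - z|² as a multiple, constant on circles, of the real part
of a holomorphic function, so that the mean value property evaluates averages. -/
lemma inv_norm_one_sub_sq {z : ℂ} (hz : ‖z‖ < 1) :
    1 / ‖1 - z‖ ^ 2 = 1 / (1 - ‖z‖ ^ 2) * ((1 + z) / (1 - z)).re := by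
  have h1 : 1 - z ≠ 0 := by
    intro h
    rw [← sub_eq_zero.1 h, norm_one] at hz
    exact lt_irrefl _ hz
  have h2 : (0 : ℝ) < 1 - ‖z‖ ^ 2 := by nlinarith [norm_nonneg z]
  have h3 : (0 : ℝ) < ‖1 - z‖ ^ 2 := by have := norm_pos_iff.2 h1; positivity
  have h4 : ((1 + z) / (1 - z)).re = (1 - ‖z‖ ^ 2) / ‖1 - z‖ ^ 2 := by
    rw [Complex.div_re, ← Complex.normSq_eq_norm_sq, ← Complex.normSq_eq_norm_sq, ← add_div]
    congr 1
    simp [Complex.normSq_apply]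
    ring
  rw [h4]
  field_simp

open Complex Metric Real in
lemma circleAverage_inv_norm_one_sub_pow {r : ℝ} (hr0 : 0 < r) (hr : r < 1) (a : ℂ) (ha : ‖a‖ = 1)
    {m : ℕ} (hm : 1 ≤ m) :
    circleAverage (fun u => 1 / ‖1 - a * u ^ m‖ ^ 2) 0 r = 1 / (1 - (r ^ m) ^ 2) := by
  have hnorm : ∀ u : ℂ, ‖a * u ^ m‖ = ‖u‖ ^ m := by intro u; simp [ha]
  have hlt : ∀ u : ℂ, ‖u‖ ≤ r → ‖a * u ^ m‖ < 1 := by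
    intro u hu
    rw [hnorm]
    exact pow_lt_one₀ (norm_nonneg _) (hu.trans_lt hr) (by omega)
  have e1 : circleAverage (fun u => 1 / ‖1 - a * u ^ m‖ ^ 2) 0 r =
      circleAverage (fun u => (1 / (1 - (r ^ m) ^ 2)) •
        ((1 + a * u ^ m) / (1 - a * u ^ m)).re) 0 r := by
    refine circleAverage_congr_sphere fun u hu => ?_
    have hu' : ‖u‖ = r := by simpa [abs_of_pos hr0] using hu
    rw [inv_norm_one_sub_sq (hlt u hu'.le), hnorm, hu', smul_eq_mul]
  have hd : DiffContOnCl ℂ (fun u => (1 + a * u ^ m) / (1 - a * u ^ m)) (ball 0 |r|) := by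
    refine DifferentiableOn.diffContOnCl ?_
    refine DifferentiableOn.div (by fun_prop) (by fun_prop) ?_
    intro u hu h
    have h1 := closure_ball_subset_closedBall hu
    simp only [mem_closedBall, dist_zero_right, abs_of_pos hr0] at h1
    have := hlt u h1
    rw [← sub_eq_zero.1 h, norm_one] at this
    exact lt_irrefl _ this
  rw [e1, circleAverage_fun_smul, circleAverage_re_eq hd hr0.ne']
  have : m ≠ 0 := by omega
  simp [this]

open Complex Metric Real in
/-- The mean square of `(w^N - w^{-N})⁻¹`. -/
lemma circleAverage_inv_pow_sub {R : ℝ} (hR : 1 < R) {N : ℕ} (hN : 1 ≤ N) :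
    circleAverage (fun w => ‖(w ^ N - (w ^ N)⁻¹)⁻¹‖ ^ 2) 0 R =
      (R⁻¹ ^ 2) ^ N / (1 - ((R⁻¹ ^ 2) ^ N) ^ 2) := by
  have h0 : 0 < R⁻¹ := inv_pos.2 (by linarith)
  have h1 : R⁻¹ < 1 := inv_lt_one_of_one_lt₀ hR
  have e1 : circleAverage (fun w => ‖(w ^ N - (w ^ N)⁻¹)⁻¹‖ ^ 2) 0 R =
      circleAverage (fun u => ((R⁻¹ ^ 2) ^ N) • (1 / ‖1 - 1 * u ^ (2 * N)‖ ^ 2)) 0 R⁻¹ := by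
    rw [circleAverage_inv_real]
    refine circleAverage_congr_sphere fun u hu => ?_
    have hu' : ‖u‖ = R⁻¹ := by
      rw [mem_sphere_zero_iff_norm, abs_of_pos h0] at hu
      exact hu
    have hu0 : u ≠ 0 := norm_pos_iff.1 (by rw [hu']; exact h0)
    have : u⁻¹ ^ N - (u⁻¹ ^ N)⁻¹ = (1 - 1 * u ^ (2 * N)) / u ^ N := by
      rw [inv_pow, inv_inv, pow_mul']
      field_simp
    rw [this, inv_div, norm_div, div_pow, norm_pow, hu', smul_eq_mul]
    ring
  rw [e1, circleAverage_fun_smul,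
    circleAverage_inv_norm_one_sub_pow h0 h1 1 (by simp) (by omega), smul_eq_mul]
  ring

open Complex Metric Real in
/-- The mean square of the sine kernel. -/
lemma circleAverage_sineKernel_sq_le {R : ℝ} (hR : 1 < R) {ζ : ℂ} (hζ : ‖ζ‖ = 1) :
    circleAverage (fun w => ‖sineKernel ζ w‖ ^ 2) 0 R ≤
      4 * (R⁻¹ ^ 2 / (1 - (R⁻¹ ^ 2) ^ 2)) := by
  set r := R⁻¹ with hr
  have h0 : 0 < r := inv_pos.2 (by linarith)
  have h1 : r < 1 := inv_lt_one_of_one_lt₀ hR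
  set q := r ^ 2 with hq
  have q0 : 0 < q := by positivity
  have q1 : q < 1 := pow_lt_one₀ h0.le h1 (by norm_num)
  have hqr : q < r := by rw [hq]; nlinarith
  have hζ0 : ζ ≠ 0 := norm_pos_iff.1 (by rw [hζ]; norm_num)
  have hζi : ζ⁻¹ = (starRingEnd ℂ) ζ := by
    rw [Complex.inv_def, Complex.normSq_eq_norm_sq, hζ]; simp
  have hne : ∀ a : ℂ, ‖a‖ = 1 → ∀ u : ℂ, ‖u‖ ≤ r → 1 - a * u ≠ 0 := by
    intro a ha u hu h
    have : ‖a * u‖ = 1 := by rw [← sub_eq_zero.1 h, norm_one]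
    rw [norm_mul, ha, one_mul] at this
    linarith
  have hζ1 : ‖ζ⁻¹‖ = 1 := by rw [norm_inv, hζ, inv_one]
  have sph : ∀ u ∈ sphere (0 : ℂ) |r|, ‖u‖ = r := by
    intro u hu
    rwa [mem_sphere_zero_iff_norm, abs_of_pos h0] at hu
  have clb : ∀ u ∈ closure (ball (0 : ℂ) |r|), ‖u‖ ≤ r := by
    intro u hu
    have h1 := closure_ball_subset_closedBall hu
    simpa only [mem_closedBall, dist_zero_right, abs_of_pos h0] using h1
  -- In u = 1/w the kernel is a difference of two terms, whose squares have mean q/(1-q) each. For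
  -- the cross term, conj u = q/u on the circle turns the conjugated factor into qζ/(u - qζ), and
  -- Cauchy's formula at qζ gives the mean 2 Re P(qζ).
  set P : ℂ → ℂ := fun u => q * ζ ^ 2 / (1 - ζ * u) with hP
  have hPd : DiffContOnCl ℂ P (ball 0 |r|) := by
    refine DifferentiableOn.diffContOnCl ?_
    exact DifferentiableOn.div (by fun_prop) (by fun_prop) fun u hu => hne ζ hζ u (clb u hu)
  have hw : (q * ζ : ℂ) ∈ ball (0 : ℂ) |r| := by
    simp [hζ, abs_of_pos q0, abs_of_pos h0, hqr]
  have pt : ∀ u ∈ sphere (0 : ℂ) |r|, ‖sineKernel ζ u⁻¹‖ ^ 2 =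
      (q * (1 / ‖1 - ζ * u ^ 1‖ ^ 2) + q * (1 / ‖1 - ζ⁻¹ * u ^ 1‖ ^ 2)) -
        2 * (u / (u - q * ζ) * P u).re := by
    intro u hu
    have hur := sph u hu
    have hu0 : u ≠ 0 := norm_pos_iff.1 (by rw [hur]; exact h0)
    have n1 := hne ζ hζ u hur.le
    have n2 := hne ζ⁻¹ hζ1 u hur.le
    have hconj : (starRingEnd ℂ) u = q / u := by
      rw [eq_div_iff hu0, mul_comm, Complex.mul_conj, Complex.normSq_eq_norm_sq, hur]
    have e1 : sineKernel ζ u⁻¹ = ζ * u / (1 - ζ * u) - ζ⁻¹ * u / (1 - ζ⁻¹ * u) := by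
      rw [sineKernel]
      congr 1
      · rw [show u⁻¹ - ζ = (1 - ζ * u) / u by field_simp]
        field_simp
      · rw [show u⁻¹ - ζ⁻¹ = (1 - ζ⁻¹ * u) / u by field_simp]
        field_simp
    have n3 : u - q * ζ ≠ 0 := by
      intro h
      have : ‖u‖ = q := by rw [sub_eq_zero.1 h]; simp [hζ, abs_of_pos q0]
      linarith
    have e2 : u / (u - q * ζ) * P u =
        ζ * u / (1 - ζ * u) * (starRingEnd ℂ) (ζ⁻¹ * u / (1 - ζ⁻¹ * u)) := by
      have : (starRingEnd ℂ) (ζ⁻¹ * u / (1 - ζ⁻¹ * u)) = q * ζ / (u - q * ζ) := by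
        rw [map_div₀, map_sub, map_mul, map_one, hconj, hζi, Complex.conj_conj]
        rw [show (1 : ℂ) - ζ * (q / u) = (u - q * ζ) / u by field_simp]
        field_simp
      rw [this, hP]
      field_simp
    have e3 : ∀ a : ℂ, ‖a‖ = 1 → q * (1 / ‖1 - a * u ^ 1‖ ^ 2) = ‖a * u / (1 - a * u)‖ ^ 2 := by
      intro a ha
      rw [pow_one, norm_div, norm_mul, ha, hur, div_pow, one_mul, ← hq]
      ring
    rw [e1, e2, e3 ζ hζ, e3 ζ⁻¹ hζ1, ← Complex.normSq_eq_norm_sq, ← Complex.normSq_eq_norm_sq,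
      ← Complex.normSq_eq_norm_sq, Complex.normSq_sub]
  have c1 : ∀ a : ℂ, ‖a‖ = 1 →
      CircleIntegrable (fun u => q * (1 / ‖1 - a * u ^ 1‖ ^ 2)) 0 r := by
    intro a ha
    refine ContinuousOn.circleIntegrable' (ContinuousOn.mul continuousOn_const
      (ContinuousOn.div continuousOn_const (by fun_prop) ?_))
    intro u hu
    have := norm_pos_iff.2 (hne a ha u (sph u hu).le)
    rw [pow_one]
    positivity
  have cP : ContinuousOn (fun u => u / (u - q * ζ) * P u) (sphere 0 |r|) := by
    refine ContinuousOn.mul (ContinuousOn.div (by fun_prop) (by fun_prop) ?_)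
      (ContinuousOn.div (by fun_prop) (by fun_prop) fun u hu => hne ζ hζ u (sph u hu).le)
    intro u hu h
    have h3 := sph u hu
    have : ‖u‖ = q := by rw [sub_eq_zero.1 h]; simp [hζ, abs_of_pos q0]
    linarith
  have avgP : circleAverage (fun u => 2 * (u / (u - q * ζ) * P u).re) 0 r =
      2 * (P (q * ζ)).re := by
    have h3 := hPd.circleAverage_smul_div hw
    simp only [sub_zero, smul_eq_mul] at h3
    have h4 := Complex.reCLM.circleAverage_comp_comm (c := 0) (R := r)
      (f := fun u => u / (u - q * ζ) * P u) cP.circleIntegrable'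
    rw [h3] at h4
    have h5 := circleAverage_fun_smul (a := (2 : ℝ)) (c := (0 : ℂ)) (R := r)
      (f := fun u => (u / (u - q * ζ) * P u).re)
    simp only [smul_eq_mul] at h5
    rw [h5]
    congr 1
  have cPre : CircleIntegrable (fun u => 2 * (u / (u - q * ζ) * P u).re) 0 r :=
    ContinuousOn.circleIntegrable' (continuousOn_const.mul (Complex.continuous_re.comp_continuousOn cP))
  have avg1 : ∀ a : ℂ, ‖a‖ = 1 →
      circleAverage (fun u => q * (1 / ‖1 - a * u ^ 1‖ ^ 2)) 0 r = q * (1 / (1 - q ^ 2 / r ^ 2)) := by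
    intro a ha
    have h5 := circleAverage_fun_smul (a := q) (c := (0 : ℂ)) (R := r)
      (f := fun u : ℂ => 1 / ‖1 - a * u ^ 1‖ ^ 2)
    simp only [smul_eq_mul] at h5
    rw [h5, circleAverage_inv_norm_one_sub_pow h0 h1 a ha le_rfl]
    congr 3
    rw [hq]
    field_simp
  have hmain : circleAverage (fun w => ‖sineKernel ζ w‖ ^ 2) 0 R =
      2 * (q / (1 - q)) - 2 * (P (q * ζ)).re := by
    rw [circleAverage_inv_real, ← hr]
    rw [circleAverage_congr_sphere pt, circleAverage_fun_sub
      (show CircleIntegrable (fun u => q * (1 / ‖1 - ζ * u ^ 1‖ ^ 2) +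
        q * (1 / ‖1 - ζ⁻¹ * u ^ 1‖ ^ 2)) 0 r from (c1 ζ hζ).add (c1 ζ⁻¹ hζ1)) cPre,
      circleAverage_fun_add (c1 ζ hζ) (c1 ζ⁻¹ hζ1), avg1 ζ hζ, avg1 ζ⁻¹ hζ1, avgP]
    have : q ^ 2 / r ^ 2 = q := by rw [← hq]; field_simp
    rw [this]
    ring
  -- On |z| = q the real part of z/(1 - z) is smallest at z = -q.
  have hre : -(q / (1 + q)) ≤ (P (q * ζ)).re := by
    set z : ℂ := q * ζ ^ 2 with hz
    have hPz : P (q * ζ) = z / (1 - z) := by rw [hP]; simp only; rw [hz]; congr 2; ring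
    have hzn : ‖z‖ = q := by rw [hz]; simp [hζ, abs_of_pos q0]
    have hn2 : Complex.normSq z = q ^ 2 := by rw [Complex.normSq_eq_norm_sq, hzn]
    have hz1 : 1 - z ≠ 0 := by
      intro h
      rw [← sub_eq_zero.1 h, norm_one] at hzn
      linarith
    have hpos : 0 < Complex.normSq (1 - z) := Complex.normSq_pos.2 hz1
    have hre1 : -q ≤ z.re := by
      have := Complex.abs_re_le_norm z
      rw [hzn] at this
      exact (abs_le.1 this).1
    rw [hPz, Complex.div_re, ← add_div, neg_le_iff_add_nonneg, div_add_div _ _ hpos.ne' (by positivity)]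
    refine div_nonneg ?_ (by positivity)
    rw [Complex.normSq_apply] at hn2
    rw [Complex.normSq_apply]
    simp only [Complex.sub_re, Complex.sub_im, Complex.one_re, Complex.one_im]
    have : (0 : ℝ) ≤ (1 - q) * (z.re + q) := mul_nonneg (by linarith) (by linarith)
    nlinarith
  rw [hmain]
  have e : 4 * (q / (1 - q ^ 2)) = 2 * (q / (1 - q)) + 2 * (q / (1 + q)) := by
    have : 1 - q ≠ 0 := by linarith
    have : 1 - q ^ 2 ≠ 0 := by nlinarith
    field_simp
    ring
  rw [e]
  linarith

/-! ### The interpolation error in one variable -/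

/-- Interpolation of a function of a complex variable at the Chebyshev extremal points, evaluated
at a real point. -/
def interp (N : ℕ) (F : ℂ → ℂ) (x : ℝ) : ℂ := ∑ k : Fin (N + 1), (lag N k x : ℂ) * F (chebNode N k)

open Polynomial in
lemma exists_interp_polynomial {N : ℕ} (hN : 1 ≤ N) (F : ℂ → ℂ) :
    ∃ p : ℂ[X], p.natDegree ≤ N ∧ (∀ x : ℝ, p.eval (x : ℂ) = interp N F x) ∧
      ∀ k ≤ N, p.eval (chebNode N k : ℂ) = F (chebNode N k) := by
  have hev : ∀ x : ℝ, (∑ k : Fin (N + 1), C (F (chebNode N k)) *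
      (Lagrange.basis Finset.univ (fun k : Fin (N + 1) => chebNode N k) k).map
        (algebraMap ℝ ℂ)).eval (x : ℂ) = interp N F x := by
    intro x
    rw [eval_finsetSum, interp]
    refine Finset.sum_congr rfl fun k _ => ?_
    rw [eval_mul, eval_C, lag_eq_basis, mul_comm]
    congr 1
    have := eval_map_algebraMap (B := ℂ)
      (Lagrange.basis Finset.univ (fun k : Fin (N + 1) => chebNode N k) k) (x : ℂ)
    rw [this]
    exact aeval_algebraMap_apply_eq_algebraMap_eval x _
  refine ⟨_, ?_, hev, ?_⟩
  · refine natDegree_sum_le_of_forall_le _ _ fun k _ => ?_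
    refine (natDegree_C_mul_le _ _).trans (natDegree_map_le.trans ?_)
    rw [Lagrange.natDegree_basis (chebNode_injOn hN) (Finset.mem_univ _)]
    simp
  · intro k hk
    rw [hev, interp, Finset.sum_eq_single (⟨k, by omega⟩ : Fin (N + 1))]
    · have := lag_node hN ⟨k, by omega⟩ ⟨k, by omega⟩
      simp only [if_true] at this
      rw [this]
      simp
    · intro b _ hb
      have := lag_node hN b ⟨k, by omega⟩
      rw [if_neg hb.symm] at this
      simp only at this
      rw [this]
      simp
    · simp

-- In u = 1/w the factor u^N supplied by (w^N - w^{-N})⁻¹ clears the poles of p(J(w)), which is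
-- where the degree bound enters. The kernel vanishes at u = 0, so the average, being the value at
-- the centre, is 0. This removes the interpolant from the representation of the error.
open Complex Metric Real Polynomial in
lemma circleAverage_polynomial_eq_zero {R : ℝ} (hR : 1 < R) {N : ℕ} (hN : 1 ≤ N) {ζ : ℂ}
    (hζ : ‖ζ‖ = 1) {p : ℂ[X]} (hp : p.natDegree ≤ N) :
    circleAverage (fun w => p.eval (joukowski w) * (w ^ N - (w ^ N)⁻¹)⁻¹ * sineKernel ζ w) 0 R =
      0 := by
  set r := R⁻¹ with hr
  have h0 : 0 < r := inv_pos.2 (by linarith)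
  have h1 : r < 1 := inv_lt_one_of_one_lt₀ hR
  have hζ0 : ζ ≠ 0 := norm_pos_iff.1 (by rw [hζ]; norm_num)
  have hζ1 : ‖ζ⁻¹‖ = 1 := by rw [norm_inv, hζ, inv_one]
  have hne : ∀ a : ℂ, ‖a‖ = 1 → ∀ m : ℕ, 1 ≤ m → ∀ u : ℂ, ‖u‖ ≤ r → 1 - a * u ^ m ≠ 0 := by
    intro a ha m hm u hu h
    have h2 : ‖a * u ^ m‖ = 1 := by rw [← sub_eq_zero.1 h, norm_one]
    rw [norm_mul, ha, one_mul, norm_pow] at h2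
    have := pow_lt_one₀ (norm_nonneg u) (hu.trans_lt h1) (by omega : m ≠ 0)
    linarith
  set f : ℂ → ℂ := fun u => (∑ j ∈ Finset.range (N + 1),
    p.coeff j * (((1 + u ^ 2) / 2) ^ j * u ^ (N - j))) / (1 - 1 * u ^ (2 * N)) *
      (ζ * u / (1 - ζ * u ^ 1) - ζ⁻¹ * u / (1 - ζ⁻¹ * u ^ 1)) with hf
  have clb : ∀ u ∈ closure (ball (0 : ℂ) |r|), ‖u‖ ≤ r := by
    intro u hu
    have h1 := closure_ball_subset_closedBall hu
    simpa only [mem_closedBall, dist_zero_right, abs_of_pos h0] using h1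
  have hd : DiffContOnCl ℂ f (ball 0 |r|) := by
    refine DifferentiableOn.diffContOnCl ?_
    refine DifferentiableOn.mul (DifferentiableOn.div (by fun_prop) (by fun_prop) fun u hu =>
      hne 1 (by simp) _ (by omega) u (clb u hu)) (DifferentiableOn.sub
      (DifferentiableOn.div (by fun_prop) (by fun_prop) fun u hu => hne ζ hζ 1 le_rfl u (clb u hu))
      (DifferentiableOn.div (by fun_prop) (by fun_prop) fun u hu =>
        hne ζ⁻¹ hζ1 1 le_rfl u (clb u hu)))
  rw [circleAverage_inv, ← hr]
  have e : circleAverage (fun u => p.eval (joukowski u⁻¹) * (u⁻¹ ^ N - (u⁻¹ ^ N)⁻¹)⁻¹ *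
      sineKernel ζ u⁻¹) 0 r = circleAverage f 0 r := by
    refine circleAverage_congr_sphere fun u hu => ?_
    rw [mem_sphere_zero_iff_norm, abs_of_pos h0] at hu
    have hu0 : u ≠ 0 := norm_pos_iff.1 (by rw [hu]; exact h0)
    have n1 := hne ζ hζ 1 le_rfl u hu.le
    have n2 := hne ζ⁻¹ hζ1 1 le_rfl u hu.le
    have n3 := hne 1 (by simp) (2 * N) (by omega) u hu.le
    have e1 : sineKernel ζ u⁻¹ = ζ * u / (1 - ζ * u ^ 1) - ζ⁻¹ * u / (1 - ζ⁻¹ * u ^ 1) := by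
      rw [pow_one] at n1 n2 ⊢
      rw [sineKernel]
      congr 1
      · rw [show u⁻¹ - ζ = (1 - ζ * u) / u by field_simp]
        field_simp
      · rw [show u⁻¹ - ζ⁻¹ = (1 - ζ⁻¹ * u) / u by field_simp]
        field_simp
    have e2 : (u⁻¹ ^ N - (u⁻¹ ^ N)⁻¹)⁻¹ = u ^ N / (1 - 1 * u ^ (2 * N)) := by
      have : u⁻¹ ^ N - (u⁻¹ ^ N)⁻¹ = (1 - 1 * u ^ (2 * N)) / u ^ N := by
        rw [inv_pow, inv_inv, pow_mul']
        field_simp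
      rw [this, inv_div]
    have e3 : p.eval (joukowski u⁻¹) * u ^ N = ∑ j ∈ Finset.range (N + 1),
        p.coeff j * (((1 + u ^ 2) / 2) ^ j * u ^ (N - j)) := by
      rw [eval_eq_sum_range' (Nat.lt_succ_of_le hp), Finset.sum_mul]
      refine Finset.sum_congr rfl fun j hj => ?_
      have hj' : j ≤ N := Nat.lt_succ_iff.1 (Finset.mem_range.1 hj)
      have : joukowski u⁻¹ = (1 + u ^ 2) / 2 / u := by
        rw [joukowski, inv_inv]
        field_simp
      obtain ⟨m, rfl⟩ := Nat.exists_eq_add_of_le hj'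
      rw [this, div_pow ((1 + u ^ 2) / 2), Nat.add_sub_cancel_left, pow_add]
      field_simp
    simp only [hf]
    rw [e1, e2, ← e3]
    ring
  rw [e, hd.circleAverage, hf]
  simp

/-- On the unit circle the Joukowski map is the cosine of the argument, here a multiple of π/N. It
locates the zeros of the pulled back error. -/
lemma exists_joukowski_eq_chebNode {N : ℕ} (hN : 1 ≤ N) {w : ℂ} (hw : w ^ (2 * N) = 1) :
    ∃ k ≤ N, joukowski w = chebNode N k := by
  have hN0 : (N : ℝ) ≠ 0 := by positivity
  have hNpos : (0 : ℝ) < N := by positivity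
  have hpi := Real.pi_pos
  have hn : ‖w‖ = 1 := Complex.norm_eq_one_of_pow_eq_one hw (by omega)
  have hexp : w = Complex.exp (w.arg * Complex.I) := by
    have := Complex.norm_mul_exp_arg_mul_I w
    rw [hn] at this
    simpa using this.symm
  have hJ : joukowski w = Real.cos w.arg := by
    rw [joukowski, Complex.ofReal_cos, Complex.cos]
    conv_lhs => rw [hexp]
    rw [← Complex.exp_neg]
    ring_nf
  have h2 : Complex.exp ((2 * N : ℕ) * (w.arg * Complex.I)) = 1 := by
    rw [Complex.exp_nat_mul, ← hexp, hw]
  obtain ⟨n, hn⟩ := Complex.exp_eq_one_iff.1 h2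
  have h3 : N * w.arg = n * Real.pi := by
    have h4 : ((2 * N * w.arg : ℝ) : ℂ) * Complex.I = ((n * (2 * Real.pi) : ℝ) : ℂ) * Complex.I := by
      push_cast at hn ⊢
      linear_combination hn
    have := Complex.ofReal_injective (mul_right_cancel₀ Complex.I_ne_zero h4)
    linarith
  have habs : |w.arg| = Real.pi * (n.natAbs : ℕ) / N := by
    rw [eq_div_iff hN0, mul_comm]
    have := congrArg abs h3
    rw [abs_mul, abs_mul, Nat.abs_cast, abs_of_pos hpi] at this
    rw [this, mul_comm, Nat.cast_natAbs, Int.cast_abs]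
  refine ⟨n.natAbs, ?_, ?_⟩
  · have h5 := Complex.abs_arg_le_pi w
    rw [habs, div_le_iff₀ hNpos] at h5
    exact_mod_cast le_of_mul_le_mul_left h5 hpi
  · rw [hJ, chebNode, ← habs, Real.cos_abs]

/-- A route to Cauchy–Schwarz: the hypothesis is the integrated arithmetic–geometric inequality, and
t = X/a turns it into the product form. -/
lemma sq_le_mul_of_forall {X a s : ℝ} (hX : 0 ≤ X) (hs : 0 ≤ s) (ha : 0 < a)
    (h : ∀ t : ℝ, 0 < t → X ≤ (t * a + s / t) / 2) : X ^ 2 ≤ a * s := by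
  rcases hX.eq_or_lt with h0 | h0
  · rw [← h0]; simp only [ne_eq, OfNat.ofNat_ne_zero, not_false_eq_true, zero_pow]; positivity
  · have := h (X / a) (by positivity)
    rw [div_mul_cancel₀ _ ha.ne', div_div_eq_mul_div] at this
    have h2 : X ≤ s * a / X := by linarith
    rw [le_div_iff₀ h0] at h2
    nlinarith

-- The core contour argument. At |ζ| = 1 the error is at most 2|G ζ|, because |ζ^{2N} - 1| ≤ 2,
-- where G is the pulled back error over w^N - w^{-N}. The integral for G ζ contains only F, bounded
-- by B, and Cauchy–Schwarz separates the two explicit factors. The constant 16 is 2² times the 4 in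
-- the mean square of the kernel.
open Complex Metric Real in
lemma interp_error_sq_le_of_lt {ρ R : ℝ} (hR : 1 < R) (hRρ : R < ρ) {N : ℕ} (hN : 1 ≤ N)
    {F : ℂ → ℂ} {B : ℝ} (hF : DifferentiableOn ℂ F (bernstein ρ))
    (hB : ∀ z ∈ bernstein ρ, ‖F z‖ ≤ B) {x : ℝ} (hx : x ∈ Set.Icc (-1 : ℝ) 1) :
    ‖F x - interp N F x‖ ^ 2 ≤ 16 * B ^ 2 *
      ((R⁻¹ ^ 2) ^ N / (1 - ((R⁻¹ ^ 2) ^ N) ^ 2) * (R⁻¹ ^ 2 / (1 - (R⁻¹ ^ 2) ^ 2))) := by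
  have hρ : 1 < ρ := hR.trans hRρ
  have h0 : 0 < R := by linarith
  have hB0 : 0 ≤ B := (norm_nonneg _).trans (hB _ (ofReal_mem_bernstein hρ hx))
  set A : Set ℂ := {w | ρ⁻¹ < ‖w‖ ∧ ‖w‖ < ρ} with hA
  have hAopen : IsOpen A :=
    (isOpen_lt continuous_const continuous_norm).inter (isOpen_lt continuous_norm continuous_const)
  have hρi : ρ⁻¹ < 1 := inv_lt_one_of_one_lt₀ hρ
  have hA0 : ∀ w ∈ A, w ≠ 0 := fun w hw =>
    norm_pos_iff.1 ((inv_pos.2 (by linarith)).trans hw.1)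
  have hJA : Set.MapsTo joukowski A (bernstein ρ) := fun w hw =>
    joukowski_mem_bernstein hρ hw.1 hw.2
  have hJd : DifferentiableOn ℂ joukowski A := by
    intro w hw
    exact (((differentiableAt_id).add (differentiableAt_inv (hA0 w hw))).div_const
      2).differentiableWithinAt
  obtain ⟨p, hpdeg, hpeval, hpnode⟩ := exists_interp_polynomial hN F
  set E : ℂ → ℂ := fun w => F (joukowski w) - p.eval (joukowski w) with hE
  have hEd : DifferentiableOn ℂ E A :=
    (hF.comp hJd hJA).sub (p.differentiable.comp_differentiableOn hJd)
  set s : Finset ℂ := Polynomial.nthRootsFinset (2 * N) (1 : ℂ) with hs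
  have hmem : ∀ a ∈ s, a ^ (2 * N) = 1 := fun a ha =>
    (Polynomial.mem_nthRootsFinset (by omega) _).1 ha
  obtain ⟨k, hk, hEk⟩ := exists_eq_prod_sub_mul hAopen s hEd (by
      intro a ha
      have : ‖a‖ = 1 := Complex.norm_eq_one_of_pow_eq_one (hmem a ha) (by omega)
      exact ⟨by rw [this]; exact hρi, by rw [this]; exact hρ⟩) (by
      intro a ha
      obtain ⟨m, hm, hJm⟩ := exists_joukowski_eq_chebNode hN (hmem a ha)
      simp only [hE]
      rw [hJm, hpnode m hm, sub_self])
  have hprod : ∀ w : ℂ, ∏ a ∈ s, (w - a) = w ^ (2 * N) - 1 := by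
    intro w
    have := Polynomial.X_pow_sub_one_eq_prod (R := ℂ) (n := 2 * N) (by omega)
      (Complex.isPrimitiveRoot_exp (2 * N) (by omega))
    have := congrArg (Polynomial.eval w) this
    rw [Polynomial.eval_prod] at this
    simpa using this.symm
  simp only [hprod] at hEk
  -- The quotient E/(w^N - w^{-N}) in a form that is defined on the unit circle as well.
  set G : ℂ → ℂ := fun w => w ^ N * k w with hG
  have hGd : DifferentiableOn ℂ G A := (differentiableOn_pow N).mul hk
  have hne : ∀ w : ℂ, ‖w‖ = R → w ^ (2 * N) - 1 ≠ 0 := by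
    intro w hw h
    have : ‖w ^ (2 * N)‖ = 1 := by rw [sub_eq_zero.1 h, norm_one]
    rw [norm_pow, hw] at this
    have := one_lt_pow₀ hR (by omega : 2 * N ≠ 0)
    linarith
  have hw0 : ∀ w : ℂ, ‖w‖ = R → w ≠ 0 := fun w hw => norm_pos_iff.1 (by rw [hw]; exact h0)
  have hne' : ∀ w : ℂ, ‖w‖ = R → w ^ N - (w ^ N)⁻¹ ≠ 0 := by
    intro w hw h
    have := hw0 w hw
    apply hne w hw
    have h2 : w ^ (2 * N) - 1 = w ^ N * (w ^ N - (w ^ N)⁻¹) := by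
      rw [pow_mul']
      field_simp
    rw [h2, h, mul_zero]
  have hGE : ∀ w : ℂ, ‖w‖ = R → G w = E w * (w ^ N - (w ^ N)⁻¹)⁻¹ := by
    intro w hw
    have h1 := hw0 w hw
    have h2 := hne' w hw
    rw [eq_mul_inv_iff_mul_eq₀ h2, hEk w, hG, pow_mul']
    field_simp
  have hanti : ∀ w : ℂ, ‖w‖ = R → G w⁻¹ = -G w := by
    intro w hw
    have h1 := hw0 w hw
    have h2 : E w⁻¹ = E w := by simp only [hE, joukowski_inv]
    rw [hEk, hEk] at h2
    have h3 := hne w hw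
    have h4 : (w⁻¹ ^ (2 * N) - 1) = -(w ^ (2 * N) - 1) / w ^ (2 * N) := by
      rw [inv_pow]
      field_simp
      ring
    rw [h4] at h2
    have h5 : k w⁻¹ = -w ^ (2 * N) * k w := by
      have h6 : (w ^ (2 * N) - 1) * (k w⁻¹) = (w ^ (2 * N) - 1) * (-w ^ (2 * N) * k w) := by
        generalize k w⁻¹ = c at h2 ⊢
        have h7 : w ^ (2 * N) ≠ 0 := pow_ne_zero _ h1
        rw [div_mul_eq_mul_div, div_eq_iff h7] at h2
        linear_combination (-1 : ℂ) * h2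
      exact mul_left_cancel₀ h3 h6
    simp only [hG]
    rw [h5, inv_pow, pow_mul']
    field_simp
  -- the point of evaluation
  set θ := Real.arccos x with hθ
  set ζ : ℂ := Complex.exp (θ * I) with hζdef
  have hζ : ‖ζ‖ = 1 := Complex.norm_exp_ofReal_mul_I θ
  have hJζ : joukowski ζ = x := by
    rw [← Real.cos_arccos hx.1 hx.2, Complex.ofReal_cos, Complex.cos, joukowski, hζdef,
      ← Complex.exp_neg, neg_mul]
  have herr : F x - interp N F x = E ζ := by
    simp only [hE]
    rw [hJζ, hpeval]
  have hEG : ‖E ζ‖ ≤ 2 * ‖G ζ‖ := by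
    rw [hEk ζ, hG, norm_mul, norm_mul, norm_pow, hζ, one_pow, one_mul]
    have : ‖ζ ^ (2 * N) - 1‖ ≤ 2 := by
      refine (norm_sub_le _ _).trans ?_
      rw [norm_pow, hζ, one_pow, norm_one]
      norm_num
    gcongr
  have sph : ∀ w ∈ sphere (0 : ℂ) |R|, ‖w‖ = R := by
    intro w hw
    rwa [mem_sphere_zero_iff_norm, abs_of_pos h0] at hw
  have sphA : ∀ w ∈ sphere (0 : ℂ) |R|, w ∈ A := by
    intro w hw
    have := sph w hw
    exact ⟨by rw [this]; linarith, by rw [this]; exact hRρ⟩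
  have cA : ContinuousOn (fun w : ℂ => (w ^ N - (w ^ N)⁻¹)⁻¹) (sphere 0 |R|) := by
    refine ContinuousOn.inv₀ ((continuousOn_pow N).sub ((continuousOn_pow N).inv₀ ?_)) ?_
    · intro w hw
      exact pow_ne_zero _ (hw0 w (sph w hw))
    · intro w hw
      exact hne' w (sph w hw)
  have cS : ContinuousOn (fun w : ℂ => sineKernel ζ w) (sphere 0 |R|) := by
    have aux : ∀ a : ℂ, ‖a‖ = 1 → ContinuousOn (fun w : ℂ => a / (w - a)) (sphere 0 |R|) := by
      intro a ha
      refine continuousOn_const.div (continuousOn_id.sub continuousOn_const) ?_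
      intro w hw h
      have h1 := sph w hw
      rw [show w = a from sub_eq_zero.1 h, ha] at h1
      linarith
    exact (aux ζ hζ).sub (aux ζ⁻¹ (by rw [norm_inv, hζ, inv_one]))
  have cF : ContinuousOn (fun w : ℂ => F (joukowski w)) (sphere 0 |R|) :=
    (hF.comp hJd hJA).continuousOn.mono sphA
  have cp : ContinuousOn (fun w : ℂ => p.eval (joukowski w)) (sphere 0 |R|) :=
    (p.differentiable.comp_differentiableOn hJd).continuousOn.mono sphA
  have hGζ : G ζ = circleAverage
      (fun w => F (joukowski w) * (w ^ N - (w ^ N)⁻¹)⁻¹ * sineKernel ζ w) 0 R := by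
    rw [eq_circleAverage_sineKernel hR hRρ hGd hanti hζ]
    have e : circleAverage (fun w => G w * sineKernel ζ w) 0 R = circleAverage (fun w =>
        F (joukowski w) * (w ^ N - (w ^ N)⁻¹)⁻¹ * sineKernel ζ w -
        p.eval (joukowski w) * (w ^ N - (w ^ N)⁻¹)⁻¹ * sineKernel ζ w) 0 R := by
      refine circleAverage_congr_sphere fun w hw => ?_
      rw [hGE w (sph w hw)]
      simp only [hE]
      ring
    rw [e, circleAverage_fun_sub
      (show CircleIntegrable (fun w => F (joukowski w) * (w ^ N - (w ^ N)⁻¹)⁻¹ * sineKernel ζ w)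
        0 R from ((cF.mul cA).mul cS).circleIntegrable')
      (show CircleIntegrable (fun w => p.eval (joukowski w) * (w ^ N - (w ^ N)⁻¹)⁻¹ *
        sineKernel ζ w) 0 R from ((cp.mul cA).mul cS).circleIntegrable'), circleAverage_polynomial_eq_zero hR hN hζ hpdeg,
      sub_zero]
  set q := R⁻¹ ^ 2 with hq
  have q0 : 0 < q := by positivity
  have q1 : q < 1 := pow_lt_one₀ (inv_pos.2 h0).le (inv_lt_one_of_one_lt₀ hR) (by norm_num)
  have Q0 : 0 < q ^ N := by positivity
  have Q1 : q ^ N < 1 := pow_lt_one₀ q0.le q1 (by omega)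
  have a0 : 0 < q ^ N / (1 - (q ^ N) ^ 2) := div_pos Q0 (by nlinarith)
  have s0 : 0 < q / (1 - q ^ 2) := div_pos q0 (by nlinarith)
  have avgA := circleAverage_inv_pow_sub hR hN
  have avgS := circleAverage_sineKernel_sq_le hR hζ
  rw [← hq] at avgA avgS
  have iA : CircleIntegrable (fun w : ℂ => ‖(w ^ N - (w ^ N)⁻¹)⁻¹‖ ^ 2) 0 R :=
    (cA.norm.pow 2).circleIntegrable'
  have iS : CircleIntegrable (fun w : ℂ => ‖sineKernel ζ w‖ ^ 2) 0 R :=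
    (cS.norm.pow 2).circleIntegrable'
  have hbound : ‖G ζ‖ ≤ B * circleAverage
      (fun w => ‖(w ^ N - (w ^ N)⁻¹)⁻¹‖ * ‖sineKernel ζ w‖) 0 R := by
    rw [hGζ, ← smul_eq_mul B, ← circleAverage_fun_smul]
    refine (norm_circleAverage_le _ _).trans (circleAverage_mono
      (((cF.mul cA).mul cS).norm).circleIntegrable'
      ((cA.norm.mul cS.norm).const_smul B).circleIntegrable' ?_)
    intro w hw
    simp only [smul_eq_mul]
    rw [norm_mul, norm_mul, mul_assoc]
    gcongr
    exact hB _ (hJA (sphA w hw))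
  have hX0 : 0 ≤ circleAverage (fun w => ‖(w ^ N - (w ^ N)⁻¹)⁻¹‖ * ‖sineKernel ζ w‖) 0 R :=
    circleAverage_nonneg_of_nonneg fun w _ => by positivity
  have hcs := sq_le_mul_of_forall hX0 (s := 4 * (q / (1 - q ^ 2))) (by positivity) a0 (by
    intro t ht
    have h1 : circleAverage (fun w => ‖(w ^ N - (w ^ N)⁻¹)⁻¹‖ * ‖sineKernel ζ w‖) 0 R ≤
        circleAverage (fun w => (t / 2) • ‖(w ^ N - (w ^ N)⁻¹)⁻¹‖ ^ 2 +
          (1 / (2 * t)) • ‖sineKernel ζ w‖ ^ 2) 0 R := by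
      refine circleAverage_mono (cA.norm.mul cS.norm).circleIntegrable'
        ((iA.const_smul).add (iS.const_smul)) fun w _ => ?_
      simp only [smul_eq_mul]
      have h2 := sq_nonneg (t * ‖(w ^ N - (w ^ N)⁻¹)⁻¹‖ - ‖sineKernel ζ w‖)
      have h3 : t / 2 * ‖(w ^ N - (w ^ N)⁻¹)⁻¹‖ ^ 2 + 1 / (2 * t) * ‖sineKernel ζ w‖ ^ 2 =
        ‖(w ^ N - (w ^ N)⁻¹)⁻¹‖ * ‖sineKernel ζ w‖ +
          (t * ‖(w ^ N - (w ^ N)⁻¹)⁻¹‖ - ‖sineKernel ζ w‖) ^ 2 / (2 * t) := by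
        field_simp
        ring
      rw [h3]
      have : 0 ≤ (t * ‖(w ^ N - (w ^ N)⁻¹)⁻¹‖ - ‖sineKernel ζ w‖) ^ 2 / (2 * t) := by positivity
      linarith
    refine h1.trans ?_
    rw [circleAverage_fun_add
      (show CircleIntegrable (fun w : ℂ => (t / 2) • ‖(w ^ N - (w ^ N)⁻¹)⁻¹‖ ^ 2) 0 R from
        iA.const_smul)
      (show CircleIntegrable (fun w : ℂ => (1 / (2 * t)) • ‖sineKernel ζ w‖ ^ 2) 0 R from
        iS.const_smul), circleAverage_fun_smul,
      circleAverage_fun_smul, avgA, smul_eq_mul, smul_eq_mul]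
    have h4 := mul_le_mul_of_nonneg_left avgS (show 0 ≤ 1 / (2 * t) by positivity)
    refine (add_le_add_right h4 _).trans (le_of_eq ?_)
    field_simp)
  rw [herr]
  have h6 : ‖E ζ‖ ≤ 2 * B * circleAverage
      (fun w => ‖(w ^ N - (w ^ N)⁻¹)⁻¹‖ * ‖sineKernel ζ w‖) 0 R := by
    refine hEG.trans ?_
    linarith
  calc ‖E ζ‖ ^ 2 ≤ (2 * B * circleAverage
      (fun w => ‖(w ^ N - (w ^ N)⁻¹)⁻¹‖ * ‖sineKernel ζ w‖) 0 R) ^ 2 := by gcongr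
    _ = 4 * B ^ 2 * (circleAverage
      (fun w => ‖(w ^ N - (w ^ N)⁻¹)⁻¹‖ * ‖sineKernel ζ w‖) 0 R) ^ 2 := by ring
    _ ≤ 4 * B ^ 2 * (q ^ N / (1 - (q ^ N) ^ 2) * (4 * (q / (1 - q ^ 2)))) := by gcongr
    _ = _ := by ring

open Filter Topology in
/-- Interpolation error for functions that are bounded and holomorphic in a Bernstein ellipse. -/
lemma interp_error_sq_le {ρ : ℝ} (hρ : 1 < ρ) {N : ℕ} (hN : 1 ≤ N)
    {F : ℂ → ℂ} {B : ℝ} (hF : DifferentiableOn ℂ F (bernstein ρ))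
    (hB : ∀ z ∈ bernstein ρ, ‖F z‖ ≤ B) {x : ℝ} (hx : x ∈ Set.Icc (-1 : ℝ) 1) :
    ‖F x - interp N F x‖ ^ 2 ≤ 16 * B ^ 2 *
      ((ρ⁻¹ ^ 2) ^ N / (1 - ((ρ⁻¹ ^ 2) ^ N) ^ 2) * (ρ⁻¹ ^ 2 / (1 - (ρ⁻¹ ^ 2) ^ 2))) := by
  have h0 : 0 < ρ := by linarith
  have q1 : ρ⁻¹ ^ 2 < 1 :=
    pow_lt_one₀ (inv_pos.2 h0).le (inv_lt_one_of_one_lt₀ hρ) (by norm_num)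
  have q0 : 0 < ρ⁻¹ ^ 2 := by positivity
  have Q0 : 0 < (ρ⁻¹ ^ 2) ^ N := by positivity
  have Q1 : (ρ⁻¹ ^ 2) ^ N < 1 := pow_lt_one₀ q0.le q1 (by omega)
  have hc : ContinuousAt (fun R : ℝ => 16 * B ^ 2 *
      ((R⁻¹ ^ 2) ^ N / (1 - ((R⁻¹ ^ 2) ^ N) ^ 2) * (R⁻¹ ^ 2 / (1 - (R⁻¹ ^ 2) ^ 2)))) ρ := by
    have hi : ContinuousAt (fun R : ℝ => R⁻¹) ρ := continuousAt_inv₀ h0.ne'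
    have n1 : 1 - ((ρ⁻¹ ^ 2) ^ N) ^ 2 ≠ 0 := by nlinarith
    have n2 : 1 - (ρ⁻¹ ^ 2) ^ 2 ≠ 0 := by nlinarith
    fun_prop (disch := assumption)
  refine ge_of_tendsto (hc.tendsto.mono_left (nhdsWithin_le_nhds (s := Set.Iio ρ))) ?_
  filter_upwards [Ioo_mem_nhdsLT hρ] with R hR
  exact interp_error_sq_le_of_lt hR.1 hR.2 hN hF hB hx

/-! ### Numerical estimates -/

/-- A numerical upper bound for the Lebesgue constant. -/
def lebNum (N : ℕ) : ℝ := 1.0115 + 0.63663 * Real.log N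

lemma lebesgueBound_le_lebNum (N : ℕ) :
    4 / Real.pi - Real.pi / 12 + 2 / Real.pi * Real.log N ≤ lebNum N := by
  have h1 := Real.pi_gt_d6
  have h2 := Real.pi_lt_d6
  have hl : 0 ≤ Real.log N := Real.log_natCast_nonneg N
  have e1 : 4 / Real.pi - Real.pi / 12 ≤ 1.0115 := by
    have : 4 / Real.pi ≤ 4 / 3.141592 := by gcongr
    have : (4 : ℝ) / 3.141592 - 3.141592 / 12 ≤ 1.0115 := by norm_num
    linarith
  have e2 : 2 / Real.pi ≤ 0.63663 := by
    have : 2 / Real.pi ≤ 2 / 3.141592 := by gcongr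
    have : (2 : ℝ) / 3.141592 ≤ 0.63663 := by norm_num
    linarith
  rw [lebNum]
  have := mul_le_mul_of_nonneg_right e2 hl
  linarith

lemma lebNum_nonneg (N : ℕ) : 0 ≤ lebNum N := by
  have hl : 0 ≤ Real.log N := Real.log_natCast_nonneg N
  rw [lebNum]
  positivity

/-- Equivalent to y ≤ artanh y. -/
lemma cayley_le_exp {y : ℝ} (h0 : 0 ≤ y) (h1 : y < 1) :
    (1 - y) / (1 + y) ≤ Real.exp (-(2 * y)) := by
  have hy : 0 < 1 - y := by linarith
  have h := Real.le_log_one_add_of_nonneg (x := 2 * y / (1 - y)) (by positivity)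
  have e1 : 2 * (2 * y / (1 - y)) / (2 * y / (1 - y) + 2) = 2 * y := by
    rw [show 2 * y / (1 - y) + 2 = 2 / (1 - y) by field_simp; ring]
    field_simp
  have e2 : 1 + 2 * y / (1 - y) = (1 + y) / (1 - y) := by field_simp; ring
  rw [e1, e2, Real.le_log_iff_exp_le (by positivity)] at h
  rw [Real.exp_neg, ← one_div, le_div_iff₀ (Real.exp_pos _), div_mul_eq_mul_div,
    div_le_one (by positivity)]
  rw [le_div_iff₀ hy] at h
  linarith

lemma cayley_pow_le_exp {y : ℝ} (h0 : 0 ≤ y) (h1 : y < 1) (N : ℕ) :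
    ((1 - y) / (1 + y)) ^ N ≤ Real.exp (-(2 * (N * y))) := by
  have hy : 0 < 1 - y := by linarith
  refine (pow_le_pow_left₀ (by positivity) (cayley_le_exp h0 h1) N).trans (le_of_eq ?_)
  rw [← Real.exp_nat_mul]
  congr 1
  ring

lemma cayley_anti {y z : ℝ} (h0 : 0 ≤ y) (h : y ≤ z) : (1 - z) / (1 + z) ≤ (1 - y) / (1 + y) := by
  rw [div_le_div_iff₀ (by linarith) (by linarith)]
  nlinarith

/-- The tangent to log at e^s; s is tuned at each use. -/
lemma log_le_mul_exp_neg {x : ℝ} (hx : 0 < x) (s : ℝ) :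
    Real.log x ≤ x * Real.exp (-s) - 1 + s := by
  have := Real.log_le_sub_one_of_pos (mul_pos hx (Real.exp_pos (-s)))
  rw [Real.log_mul hx.ne' (Real.exp_pos _).ne', Real.log_exp] at this
  linarith

lemma exp_neg_le {s c : ℝ} (hs : 0 ≤ s) (n : ℕ) (hc : 0 < c)
    (h : 1 / c ≤ ∑ i ∈ Finset.range n, s ^ i / (i.factorial : ℝ)) : Real.exp (-s) ≤ c := by
  have := h.trans (Real.sum_le_exp_of_nonneg hs n)
  rw [Real.exp_neg, inv_le_comm₀ (Real.exp_pos _) hc, ← one_div]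
  exact this

lemma lebNum_sq_le {N : ℕ} (hN : 1 ≤ N) : lebNum N ^ 2 ≤ 0.92 + 0.7 * N := by
  have hN0 : (0 : ℝ) < N := by positivity
  set x := Real.sqrt N with hx
  have hx0 : 0 < x := Real.sqrt_pos.2 hN0
  have hxN : x ^ 2 = N := Real.sq_sqrt hN0.le
  have hlog : Real.log N = 2 * Real.log x := by rw [← hxN, Real.log_pow]; norm_num
  have h1 := log_le_mul_exp_neg hx0 0.6
  have h2 : Real.exp (-0.6) ≤ 0.5541 :=
    exp_neg_le (by norm_num) 4 (by norm_num) (by norm_num [Finset.sum_range_succ, Nat.factorial])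
  have h3 : Real.log x ≤ x * 0.5541 - 0.4 := by
    have := mul_le_mul_of_nonneg_left h2 hx0.le
    linarith
  -- The line (0.92 + 1.26 x)/1.7856 is almost the tangent of √(0.92 + 0.7 x²) at x = 1.8; with s =
  -- 0.6 the logarithm is touched nearby, at e^0.6 ≈ 1.82.
  have h4 : 1.7856 * lebNum N ≤ 0.92 + 1.26 * x := by
    rw [lebNum, hlog]
    linarith
  have h0 := lebNum_nonneg N
  have h5 : (1.7856 * lebNum N) ^ 2 ≤ (0.92 + 1.26 * x) ^ 2 := by gcongr
  rw [← hxN]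
  nlinarith [sq_nonneg (x - 1.8)]

/-- Either the Lebesgue constant or the contour estimate bounds the norm of the interpolation
operator. -/
lemma interp_norm_dichotomy {N : ℕ} (hN : 1 ≤ N) {y : ℝ} (h0 : 0 < y) (h1 : y < 1) :
    lebNum N ^ 2 ≤ 0.92 * ((1 + y) / y) ∨
    ∀ e : ℝ, 0 ≤ e → e ^ 2 ≤ 4 * ((((1 - y) / (1 + y)) ^ N) * (1 - y ^ 2) /
      ((1 - (((1 - y) / (1 + y)) ^ N) ^ 2) * y)) → (1 + e) ^ 2 ≤ 0.92 * ((1 + y) / y) := by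
  -- Since 0.7 · 1.314 < 0.92, the bound 0.92 + 0.7 N suffices up to this threshold; beyond it Q is
  -- at most e^{-2.628}.
  rcases le_or_gt (N * y) 1.314 with h | h
  · left
    refine (lebNum_sq_le hN).trans ?_
    rw [← mul_div_assoc, le_div_iff₀ h0]
    nlinarith
  · right
    intro e he hee
    set Q := ((1 - y) / (1 + y)) ^ N with hQ
    have hy : 0 < 1 - y := by linarith
    have Q0 : 0 < Q := by positivity
    have hQ1 : Q ≤ 0.07223 := by
      refine (cayley_pow_le_exp h0.le h1 N).trans ?_
      have h2 : Real.exp (-(2 * (N * y))) ≤ Real.exp (-2.628) := Real.exp_le_exp.2 (by linarith)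
      refine h2.trans (exp_neg_le (by norm_num) 12 (by norm_num) ?_)
      norm_num [Finset.sum_range_succ, Nat.factorial]
    have hD : 0 < (1 - Q ^ 2) := by nlinarith
    have hκ : 4 * (Q * (1 - y ^ 2) / ((1 - Q ^ 2) * y)) ≤ 0.2905 * ((1 - y ^ 2) / y) := by
      have h3 : 4 * Q / (1 - Q ^ 2) ≤ 0.2905 := by
        rw [div_le_iff₀ hD]
        nlinarith
      have h4 : 0 ≤ (1 - y ^ 2) / y := div_nonneg (by nlinarith) h0.le
      refine le_trans (le_of_eq ?_) (mul_le_mul_of_nonneg_right h3 h4)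
      field_simp
    have hee2 := hee.trans hκ
    rw [← mul_div_assoc, le_div_iff₀ h0] at hee2
    rw [← mul_div_assoc, le_div_iff₀ h0]
    -- Weighted arithmetic–geometric inequality, sharp at e = 0.67. What remains is a quadratic in y
    -- whose minimum, near 0.518, is barely positive.
    have h5 : (1 + e) ^ 2 ≤ 1.67 * (1 + e ^ 2 / 0.67) := by
      have := sq_nonneg (e - 0.67)
      norm_num at this ⊢
      linarith
    have h6 := mul_le_mul_of_nonneg_right h5 h0.le
    refine h6.trans ?_
    have h7 : 1.67 * (1 + e ^ 2 / 0.67) * y = 1.67 * y + (1.67 / 0.67) * (e ^ 2 * y) := by ring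
    rw [h7]
    have h8 : (1.67 / 0.67 : ℝ) * (e ^ 2 * y) ≤ (1.67 / 0.67) * (0.2905 * (1 - y ^ 2)) := by gcongr
    have h9 : (1.67 / 0.67 : ℝ) * 0.2905 ≤ 0.7241 := by norm_num
    have h10 : (1.67 / 0.67 : ℝ) * (0.2905 * (1 - y ^ 2)) ≤ 0.7241 * (1 - y ^ 2) := by
      rw [← mul_assoc]
      have : 0 ≤ 1 - y ^ 2 := by nlinarith
      gcongr
    nlinarith [sq_nonneg (y - 0.518)]

/-- With x = N^{1/5}, the tangent to log gives 1 + `lebNum N` ≤ 2.227 x. As N y = x (y x⁴), having y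
x⁴ > 1/2 would force Q ≤ e^{-x}, too small for the hypothesis. So y x⁴ ≤ 1/2, and (1 + `lebNum N`)²
y is at most a multiple of x² y ≤ √(y/2), which 4Q > 4 √(0.77 y) dominates. -/
lemma one_add_lebNum_sq_le_of_small {N : ℕ} (hN : 1 ≤ N) {y : ℝ} (h0 : 0 < y) (h1 : y < 1)
    (hQ : 0.77 * y < (((1 - y) / (1 + y)) ^ N) ^ 2) :
    (1 + lebNum N) ^ 2 ≤ 4 * ((1 - y) / (1 + y)) ^ N / y := by
  have hN0 : (0 : ℝ) < N := by positivity
  set Q := ((1 - y) / (1 + y)) ^ N with hQdef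
  have hy : 0 < 1 - y := by linarith
  have Q0 : 0 < Q := by positivity
  set x := Real.exp (Real.log N / 5) with hx
  have hx0 : 0 < x := Real.exp_pos _
  have hx5 : x ^ 5 = N := by
    rw [hx, ← Real.exp_nat_mul]
    push_cast
    rw [mul_div_cancel₀ _ (by norm_num), Real.exp_log hN0]
  have hlog : Real.log N = 5 * Real.log x := by rw [hx, Real.log_exp]; ring
  have hell : 1 + lebNum N ≤ 2.227 * x := by
    have h2 : Real.exp (-0.36) ≤ 0.6985 :=
      exp_neg_le (by norm_num) 4 (by norm_num) (by norm_num [Finset.sum_range_succ, Nat.factorial])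
    have h3 := log_le_mul_exp_neg hx0 0.36
    have := mul_le_mul_of_nonneg_left h2 hx0.le
    rw [lebNum, hlog]
    linarith
  have hyx : y * x ^ 4 ≤ 0.5 := by
    by_contra hcon
    push Not at hcon
    have h2 : Q ≤ Real.exp (-x) := by
      refine (cayley_pow_le_exp h0.le h1 N).trans (Real.exp_le_exp.2 ?_)
      rw [← hx5]
      nlinarith
    have h3 : Q ^ 2 ≤ Real.exp (-x) ^ 2 := by gcongr
    have h4 : x / 2 * Real.exp 1 ≤ Real.exp (x / 2) := by
      have := Real.add_one_le_exp (x / 2 - 1)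
      rw [Real.exp_sub, le_div_iff₀ (Real.exp_pos _)] at this
      linarith
    have h5 : x * 1.35 ≤ Real.exp (x / 2) := by
      have := Real.exp_one_gt_d9
      nlinarith
    have h6 : (x * 1.35) ^ 4 ≤ Real.exp (x / 2) ^ 4 := by gcongr
    have h7 : Real.exp (x / 2) ^ 4 * Real.exp (-x) ^ 2 = 1 := by
      rw [← Real.exp_nat_mul, ← Real.exp_nat_mul, ← Real.exp_add, ← Real.exp_zero]
      congr 1
      push_cast
      ring
    have h8 : (x * 1.35) ^ 4 * Real.exp (-x) ^ 2 ≤ 1 := by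
      rw [← h7]
      gcongr
    have h9 : 0.77 * y < Real.exp (-x) ^ 2 := hQ.trans_le h3
    have h10 : (x * 1.35) ^ 4 * (0.77 * y) ≤ 1 :=
      (mul_le_mul_of_nonneg_left h9.le (by positivity)).trans h8
    nlinarith
  rw [le_div_iff₀ h0]
  have hl := lebNum_nonneg N
  have h2 : (1 + lebNum N) ^ 2 ≤ (2.227 * x) ^ 2 := by gcongr
  have h3 : (1 + lebNum N) ^ 2 * y ≤ (2.227 * x) ^ 2 * y := by gcongr
  refine h3.trans (abs_le_of_sq_le_sq' ?_ (by positivity)).2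
  have h4 : ((2.227 * x) ^ 2 * y) ^ 2 = 2.227 ^ 4 * (y * x ^ 4) * y := by ring
  have h5 : 2.227 ^ 4 * (y * x ^ 4) * y ≤ 2.227 ^ 4 * 0.5 * y := by gcongr
  rw [h4]
  refine h5.trans ?_
  norm_num at hQ ⊢
  linarith

/-- Either the contour estimate or the Lebesgue constant gives the interpolation error bound. -/
lemma interp_error_dichotomy {N : ℕ} (hN : 1 ≤ N) {y : ℝ} (h0 : 0 < y) (h1 : y < 1) :
    ((((1 - y) / (1 + y)) ^ N) ^ 2 ≤ y ∧
      (((1 - y) / (1 + y)) ^ N) ^ 2 ≤ 0.08 + 0.92 * y ^ 2) ∨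
    ((1 + lebNum N) ^ 2 ≤ 4 * ((1 - y) / (1 + y)) ^ N * (1 + y) / y ∧
      0.92 * (1 + lebNum N) ^ 2 ≤ 4 * ((1 - y) / (1 + y)) ^ N / y) := by
  set q := (1 - y) / (1 + y) with hq
  have hy : 0 < 1 - y := by linarith
  have q0 : 0 < q := by positivity
  -- With Q = q^N and W = (1 + y)/y, the first alternative is what makes the contour constant e
  -- satisfy e² ≤ 4QW and 0.92 e² ≤ 4Q(W - 1). For y ≤ 0.12 one has 0.77 y ≤ 0.08 + 0.92 y², so Q² ≤
  -- 0.77 y is enough.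
  rcases le_or_gt y 0.12 with hs | hs
  · rcases le_or_gt ((q ^ N) ^ 2) (0.77 * y) with h | h
    · left
      constructor <;> nlinarith
    · right
      have := one_add_lebNum_sq_le_of_small hN h0 h1 h
      rw [← hq] at this
      refine ⟨this.trans ?_, ?_⟩
      · rw [mul_div_assoc (4 * q ^ N), mul_div_assoc 4]
        have h2 : 4 * (q ^ N / y) ≤ 4 * (q ^ N / y) * (1 + y) :=
          le_mul_of_one_le_right (by positivity) (by linarith)
        refine h2.trans (le_of_eq ?_)
        ring
      · have h2 := sq_nonneg (1 + lebNum N)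
        linarith
  -- The first alternative persists when y or N grows; for fixed N, within y > 0.12, the sufficient
  -- condition for the second persists when y decreases. Hence for each N ≤ 4 one value of y at
  -- which both can be checked settles everything, and for N ≥ 5 the value 0.12 already gives the
  -- first.
  · have large : ∀ z : ℝ, z ≤ y → 0 ≤ z → ∀ M ≤ N, (((1 - z) / (1 + z)) ^ M) ^ 2 ≤ z →
        (((1 - z) / (1 + z)) ^ M) ^ 2 ≤ 0.08 + 0.92 * z ^ 2 →
        (q ^ N) ^ 2 ≤ y ∧ (q ^ N) ^ 2 ≤ 0.08 + 0.92 * y ^ 2 := by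
      intro z hz hz0 M hM e1 e2
      have q1 : q ≤ 1 := by rw [hq, div_le_one (by linarith)]; linarith
      have a1 : q ^ N ≤ ((1 - z) / (1 + z)) ^ M :=
        (pow_le_pow_of_le_one q0.le q1 hM).trans (pow_le_pow_left₀ q0.le (cayley_anti hz0 hz) M)
      have a2 : (q ^ N) ^ 2 ≤ (((1 - z) / (1 + z)) ^ M) ^ 2 := by gcongr
      exact ⟨by linarith, by nlinarith⟩
    have small : ∀ z : ℝ, y ≤ z → z < 1 → ∀ l : ℝ, lebNum N ≤ l →
        0.92 * (1 + l) ^ 2 ≤ 4 * ((1 - z) / (1 + z)) ^ N / z →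
        (1 + lebNum N) ^ 2 ≤ 4 * q ^ N * (1 + y) / y ∧
          0.92 * (1 + lebNum N) ^ 2 ≤ 4 * q ^ N / y := by
      intro z hz hz1 l hl e1
      have hl0 := lebNum_nonneg N
      have a0 : (0 : ℝ) ≤ (1 - z) / (1 + z) := div_nonneg (by linarith) (by linarith)
      have a1 : ((1 - z) / (1 + z)) ^ N ≤ q ^ N := pow_le_pow_left₀ a0 (cayley_anti h0.le hz) N
      have a2 : 4 * ((1 - z) / (1 + z)) ^ N / z ≤ 4 * q ^ N / y := by gcongr
      have a3 : (1 + lebNum N) ^ 2 ≤ (1 + l) ^ 2 := by gcongr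
      have a4 : 0.92 * (1 + lebNum N) ^ 2 ≤ 4 * q ^ N / y := by linarith
      refine ⟨?_, a4⟩
      have a5 : 4 * q ^ N * (1 + y) / y = 4 * q ^ N / y * (1 + y) := by ring
      rw [a5]
      have a6 : 4 * q ^ N / y * 1.12 ≤ 4 * q ^ N / y * (1 + y) := by
        gcongr
        linarith
      have := sq_nonneg (1 + lebNum N)
      linarith
    have l2 := Real.log_two_lt_d9
    rcases Nat.lt_or_ge N 5 with h5 | h5
    · interval_cases N
      · rcases le_or_gt 0.4 y with h | h
        · exact Or.inl (large 0.4 h (by norm_num) 1 le_rfl (by norm_num) (by norm_num))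
        · exact Or.inr (small 0.4 h.le (by norm_num) 1.0115 (by norm_num [lebNum]) (by norm_num))
      · rcases le_or_gt 0.25 y with h | h
        · exact Or.inl (large 0.25 h (by norm_num) 2 le_rfl (by norm_num) (by norm_num))
        · exact Or.inr (small 0.25 h.le (by norm_num) 1.453
            (by rw [lebNum]; push_cast; linarith) (by norm_num))
      · have l3 : Real.log 3 ≤ 1.103 := by
          have a1 := Real.log_le_sub_one_of_pos (show (0 : ℝ) < 9 / 8 by norm_num)
          have a2 : Real.log (9 / 8) = 2 * Real.log 3 - 3 * Real.log 2 := by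
            rw [Real.log_div (by norm_num) (by norm_num), show (9 : ℝ) = 3 ^ 2 by norm_num,
              show (8 : ℝ) = 2 ^ 3 by norm_num, Real.log_pow, Real.log_pow]
            norm_num
          rw [a2] at a1
          linarith
        rcases le_or_gt 0.185 y with h | h
        · exact Or.inl (large 0.185 h (by norm_num) 3 le_rfl (by norm_num) (by norm_num))
        · exact Or.inr (small 0.185 h.le (by norm_num) 1.714
            (by rw [lebNum]; push_cast; linarith) (by norm_num))
      · have l4 : Real.log 4 = 2 * Real.log 2 := by
          rw [show (4 : ℝ) = 2 ^ 2 by norm_num, Real.log_pow]; norm_num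
        rcases le_or_gt 0.15 y with h | h
        · exact Or.inl (large 0.15 h (by norm_num) 4 le_rfl (by norm_num) (by norm_num))
        · exact Or.inr (small 0.15 h.le (by norm_num) 1.895
            (by rw [lebNum]; push_cast; rw [l4]; linarith) (by norm_num))
    · exact Or.inl (large 0.12 hs.le (by norm_num) 5 h5 (by norm_num) (by norm_num))

/-! ### Norm and error of the univariate interpolation -/

/-- The factor that each coordinate contributes to the square of the error bound. -/
def ellipseFactor (ρ : ℝ) : ℝ := 2 / (1 - ρ⁻¹ ^ 2)

lemma norm_interp_le_lebNum {N : ℕ} (hN : 1 ≤ N) {F : ℂ → ℂ} {B : ℝ}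
    (hB : ∀ k : Fin (N + 1), ‖F (chebNode N k)‖ ≤ B) {x : ℝ} (hx : x ∈ Set.Icc (-1 : ℝ) 1) :
    ‖interp N F x‖ ≤ lebNum N * B := by
  have hB0 : 0 ≤ B := (norm_nonneg _).trans (hB 0)
  calc ‖interp N F x‖ ≤ ∑ k : Fin (N + 1), |lag N k x| * B := by
        refine (norm_sum_le _ _).trans (Finset.sum_le_sum fun k _ => ?_)
        rw [norm_mul, Complex.norm_real, Real.norm_eq_abs]
        exact mul_le_mul_of_nonneg_left (hB k) (abs_nonneg _)
    _ ≤ lebNum N * B := by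
        rw [← Finset.sum_mul]
        exact mul_le_mul_of_nonneg_right
          ((sum_abs_lag_le hN hx).trans (lebesgueBound_le_lebNum N)) hB0

/-- The Cayley transform of `ρ⁻²`, in which the numerical estimates are expressed. -/
lemma exists_cayley {ρ : ℝ} (hρ : 1 < ρ) : ∃ y : ℝ, 0 < y ∧ y < 1 ∧
    (1 - y) / (1 + y) = ρ⁻¹ ^ 2 ∧ (1 + y) / y = ellipseFactor ρ ∧
    ρ⁻¹ ^ 2 / (1 - (ρ⁻¹ ^ 2) ^ 2) = (1 - y ^ 2) / (4 * y) := by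
  have h0 : 0 < ρ⁻¹ := by positivity
  have h1 : ρ⁻¹ < 1 := inv_lt_one_of_one_lt₀ hρ
  have q0 : 0 < ρ⁻¹ ^ 2 := by positivity
  have q1 : ρ⁻¹ ^ 2 < 1 := by nlinarith
  rw [ellipseFactor]
  set q := ρ⁻¹ ^ 2
  have a1 : 0 < 1 - q := by linarith
  have a2 : 0 < 1 + q := by linarith
  have a3 : 1 - q ^ 2 ≠ 0 := by nlinarith
  refine ⟨(1 - q) / (1 + q), by positivity, ?_, ?_, ?_, ?_⟩
  · rw [div_lt_one a2]; linarith
  · have : 1 - (1 - q) / (1 + q) = 2 * q / (1 + q) := by field_simp; ring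
    have h : 1 + (1 - q) / (1 + q) = 2 / (1 + q) := by field_simp; ring
    rw [this, h]; field_simp
  · have h : 1 + (1 - q) / (1 + q) = 2 / (1 + q) := by field_simp; ring
    rw [h]; field_simp
  · rw [div_eq_div_iff a3 (by positivity)]
    field_simp
    ring

lemma two_le_ellipseFactor {ρ : ℝ} (hρ : 1 < ρ) : 2 < ellipseFactor ρ := by
  have h1 : ρ⁻¹ < 1 := inv_lt_one_of_one_lt₀ hρ
  have h0 : 0 < ρ⁻¹ := by positivity
  rw [ellipseFactor, lt_div_iff₀ (by nlinarith)]
  nlinarith [pow_pos h0 2]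

/-- The contour estimate of the interpolation error, with the best constant it gives. -/
lemma interp_error_le_contour {ρ y : ℝ} (hρ : 1 < ρ)
    (hy : (1 - y) / (1 + y) = ρ⁻¹ ^ 2)
    (hy' : ρ⁻¹ ^ 2 / (1 - (ρ⁻¹ ^ 2) ^ 2) = (1 - y ^ 2) / (4 * y))
    {N : ℕ} (hN : 1 ≤ N) {F : ℂ → ℂ} {B : ℝ} (hF : DifferentiableOn ℂ F (bernstein ρ))
    (hB : ∀ z ∈ bernstein ρ, ‖F z‖ ≤ B) {x : ℝ} (hx : x ∈ Set.Icc (-1 : ℝ) 1) :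
    ‖F x - interp N F x‖ ≤ Real.sqrt (4 * ((((1 - y) / (1 + y)) ^ N) * (1 - y ^ 2) /
      ((1 - (((1 - y) / (1 + y)) ^ N) ^ 2) * y))) * B := by
  have hB0 : 0 ≤ B := (norm_nonneg _).trans (hB _ (ofReal_mem_bernstein hρ hx))
  have h := interp_error_sq_le hρ hN hF hB hx
  rw [hy', ← hy] at h
  rw [← Real.sqrt_sq hB0, ← Real.sqrt_mul' _ (sq_nonneg B)]
  refine Real.le_sqrt_of_sq_le (h.trans (le_of_eq ?_))
  rw [div_mul_div_comm, mul_comm (1 - _) y, ← mul_div_assoc, ← mul_div_assoc, div_mul_eq_mul_div,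
    show (1 - (((1 - y) / (1 + y)) ^ N) ^ 2) * (4 * y) = 4 * (y * (1 - (((1 - y) / (1 + y)) ^ N) ^ 2))
      by ring, show ∀ a b c : ℝ, 16 * a * (b * c) = 4 * (4 * (b * c) * a) by intros; ring,
    mul_div_mul_left _ _ (by norm_num : (4 : ℝ) ≠ 0)]

/-- Because B bounds F on the whole ellipse, the constant may depend on ρ: it comes from the
Lebesgue constant, or from 1 + e with e the contour constant. The slack 0.92 allows the relaxed
condition 0.92 e² ≤ 4Q(W - 1) in the induction on the dimension. -/
lemma norm_interp_le {ρ : ℝ} (hρ : 1 < ρ) {N : ℕ} (hN : 1 ≤ N) {F : ℂ → ℂ} {B : ℝ}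
    (hF : DifferentiableOn ℂ F (bernstein ρ)) (hB : ∀ z ∈ bernstein ρ, ‖F z‖ ≤ B) {x : ℝ}
    (hx : x ∈ Set.Icc (-1 : ℝ) 1) :
    ‖interp N F x‖ ≤ Real.sqrt (0.92 * ellipseFactor ρ) * B := by
  have hB0 : 0 ≤ B := (norm_nonneg _).trans (hB _ (ofReal_mem_bernstein hρ hx))
  obtain ⟨y, h0, h1, hy, hW, hy'⟩ := exists_cayley hρ
  rw [← hW]
  rcases interp_norm_dichotomy hN h0 h1 with h | h
  · refine (norm_interp_le_lebNum hN
      (fun k => hB _ (ofReal_mem_bernstein hρ (chebNode_mem N k))) hx).trans ?_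
    exact mul_le_mul_of_nonneg_right (Real.le_sqrt_of_sq_le h) hB0
  · have h2 := interp_error_le_contour hρ hy hy' hN hF hB hx
    set e := Real.sqrt (4 * ((((1 - y) / (1 + y)) ^ N) * (1 - y ^ 2) /
      ((1 - (((1 - y) / (1 + y)) ^ N) ^ 2) * y))) with he
    have h3 := h e (Real.sqrt_nonneg _) (by
      rw [he, Real.sq_sqrt]
      have a0 : 0 ≤ (1 - y) / (1 + y) := div_nonneg (by linarith) (by linarith)
      have a1 : (1 - y) / (1 + y) ≤ 1 := by rw [div_le_one (by linarith)]; linarith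
      have a2 := pow_le_one₀ (n := N) a0 a1
      have a3 := pow_nonneg a0 N
      have a4 : 0 ≤ 1 - (((1 - y) / (1 + y)) ^ N) ^ 2 := by nlinarith
      have a5 : 0 ≤ 1 - y ^ 2 := by nlinarith
      positivity)
    calc ‖interp N F x‖ = ‖F x - (F x - interp N F x)‖ := by rw [sub_sub_cancel]
      _ ≤ B + e * B := (norm_sub_le _ _).trans
          (add_le_add (hB _ (ofReal_mem_bernstein hρ hx)) h2)
      _ = (1 + e) * B := by ring
      _ ≤ _ := mul_le_mul_of_nonneg_right (Real.le_sqrt_of_sq_le h3) hB0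

/-- One constant with two bounds: the one with W settles dimension one, the one with W - 1 is
consumed by the induction step. -/
lemma exists_interp_error_le {ρ : ℝ} (hρ : 1 < ρ) {N : ℕ} (hN : 1 ≤ N) :
    ∃ e : ℝ, 0 ≤ e ∧ e ^ 2 ≤ 4 * (ρ⁻¹ ^ 2) ^ N * ellipseFactor ρ ∧
      0.92 * e ^ 2 ≤ 4 * (ρ⁻¹ ^ 2) ^ N * (ellipseFactor ρ - 1) ∧
      ∀ (F : ℂ → ℂ) (B : ℝ), DifferentiableOn ℂ F (bernstein ρ) →
        (∀ z ∈ bernstein ρ, ‖F z‖ ≤ B) → ∀ x ∈ Set.Icc (-1 : ℝ) 1,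
        ‖F x - interp N F x‖ ≤ e * B := by
  obtain ⟨y, h0, h1, hy, hW, hy'⟩ := exists_cayley hρ
  have hW1 : ellipseFactor ρ - 1 = 1 / y := by rw [← hW]; field_simp; ring
  rw [hW1, ← hW, ← hy]
  have a0 : 0 < (1 - y) / (1 + y) := div_pos (by linarith) (by linarith)
  have a1 : (1 - y) / (1 + y) < 1 := by rw [div_lt_one (by linarith)]; linarith
  have a2 := pow_lt_one₀ a0.le a1 (by omega : N ≠ 0)
  have a3 := pow_pos a0 N
  rcases interp_error_dichotomy hN h0 h1 with ⟨h2, h3⟩ | ⟨h2, h3⟩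
  · refine ⟨_, Real.sqrt_nonneg _, ?_, ?_, fun F B hF hB x hx =>
      interp_error_le_contour hρ hy hy' hN hF hB hx⟩
    all_goals
      set Q := ((1 - y) / (1 + y)) ^ N
      have a4 : 0 < 1 - Q ^ 2 := by nlinarith
      have a5 : 0 ≤ 1 - y ^ 2 := by nlinarith
      rw [Real.sq_sqrt (by positivity)]
    · rw [← mul_div_assoc, ← mul_div_assoc, div_le_div_iff₀ (by positivity) h0]
      have : (1 - y) * (1 + y) ≤ (1 - Q ^ 2) * (1 + y) := by gcongr
      have := mul_le_mul_of_nonneg_left this (show 0 ≤ 4 * Q * y by positivity)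
      linarith
    · rw [← mul_div_assoc, ← mul_div_assoc, ← mul_div_assoc, div_le_div_iff₀ (by positivity) h0]
      have : 0.92 * (1 - y ^ 2) ≤ (1 - Q ^ 2) := by linarith
      have := mul_le_mul_of_nonneg_left this (show 0 ≤ 4 * Q * y by positivity)
      linarith
  · refine ⟨1 + lebNum N, by linarith [lebNum_nonneg N], by rwa [← mul_div_assoc],
      by rwa [mul_one_div], fun F B _ hB x hx => ?_⟩
    have h4 := norm_interp_le_lebNum hN
      (fun k => hB _ (ofReal_mem_bernstein hρ (chebNode_mem N k))) hx
    have h5 := hB _ (ofReal_mem_bernstein hρ hx)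
    calc _ ≤ B + lebNum N * B := (norm_sub_le _ _).trans (add_le_add h5 h4)
      _ = _ := by ring

/-! ### Multivariate interpolation -/

/-- The function `F` on the product of Bernstein ellipses is separately holomorphic and bounded
by `B`. -/
structure SepHolo {D : ℕ} (ρ : Fin D → ℝ) (F : (Fin D → ℂ) → ℂ) (B : ℝ) : Prop where
  holo : ∀ z, (∀ i, z i ∈ bernstein (ρ i)) → ∀ i,
    DifferentiableOn ℂ (fun w => F (Function.update z i w)) (bernstein (ρ i))
  bound : ∀ z, (∀ i, z i ∈ bernstein (ρ i)) → ‖F z‖ ≤ B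

/-- The tensor product interpolation at the Chebyshev points. -/
def mInterp {D : ℕ} (N : Fin D → ℕ) (F : (Fin D → ℂ) → ℂ) (x : Fin D → ℝ) : ℂ :=
  ∑ k : (i : Fin D) → Fin (N i + 1), (∏ i, (lag (N i) (k i) (x i) : ℂ)) *
    F fun i => (chebNode (N i) (k i) : ℂ)

lemma mInterp_succ {D : ℕ} (N : Fin (D + 1) → ℕ) (F : (Fin (D + 1) → ℂ) → ℂ)
    (x : Fin (D + 1) → ℝ) :
    mInterp N F x = ∑ k₀ : Fin (N 0 + 1), (lag (N 0) k₀ (x 0) : ℂ) *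
      mInterp (fun i => N i.succ) (fun z => F (Fin.cons (chebNode (N 0) k₀ : ℂ) z))
        (fun i => x i.succ) := by
  simp only [mInterp, Finset.mul_sum]
  rw [← Fintype.sum_prod_type']
  refine (Fintype.sum_equiv (Fin.consEquiv fun i => Fin (N i + 1)) _ _ fun k => ?_).symm
  rw [Fin.prod_univ_succ, mul_assoc]
  simp only [Fin.consEquiv_apply, Fin.cons_zero, Fin.cons_succ]
  congr 3
  funext i
  refine Fin.cases ?_ (fun i => ?_) i <;> simp

lemma mInterp_succ_eq_interp {D : ℕ} (N : Fin (D + 1) → ℕ) (F : (Fin (D + 1) → ℂ) → ℂ)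
    (x : Fin (D + 1) → ℝ) :
    mInterp N F x = interp (N 0) (fun w => mInterp (fun i => N i.succ)
      (fun z => F (Fin.cons w z)) (fun i => x i.succ)) (x 0) :=
  mInterp_succ N F x

/-- Coordinate 0 is interpolated first rather than last; this order exposes the univariate error
inside the interpolation in the other coordinates. -/
lemma mInterp_succ_eq_mInterp {D : ℕ} (N : Fin (D + 1) → ℕ) (F : (Fin (D + 1) → ℂ) → ℂ)
    (x : Fin (D + 1) → ℝ) :
    mInterp N F x = mInterp (fun i => N i.succ)
      (fun z => interp (N 0) (fun w => F (Fin.cons w z)) (x 0)) (fun i => x i.succ) := by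
  rw [mInterp_succ]
  simp only [mInterp, interp, Finset.mul_sum]
  rw [Finset.sum_comm]
  refine Finset.sum_congr rfl fun k _ => Finset.sum_congr rfl fun k₀ _ => ?_
  ring

lemma mInterp_sub {D : ℕ} (N : Fin D → ℕ) (F H : (Fin D → ℂ) → ℂ) (x : Fin D → ℝ) :
    mInterp N (fun z => F z - H z) x = mInterp N F x - mInterp N H x := by
  simp only [mInterp, mul_sub, Finset.sum_sub_distrib]

namespace SepHolo

variable {D : ℕ} {ρ : Fin (D + 1) → ℝ} {F : (Fin (D + 1) → ℂ) → ℂ} {B : ℝ}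

lemma tail (hF : SepHolo ρ F B) {w : ℂ} (hw : w ∈ bernstein (ρ 0)) :
    SepHolo (fun i => ρ i.succ) (fun z => F (Fin.cons w z)) B where
  holo z hz i := by
    have := hF.holo (Fin.cons w z) (Fin.cases (by simpa) (by simpa)) i.succ
    simpa only [Fin.cons_update] using this
  bound z hz := hF.bound _ (Fin.cases (by simpa) (by simpa))

lemma head (hF : SepHolo ρ F B) {z : Fin D → ℂ} (hz : ∀ i, z i ∈ bernstein (ρ i.succ))
    (hne : (bernstein (ρ 0)).Nonempty) :
    DifferentiableOn ℂ (fun w => F (Fin.cons w z)) (bernstein (ρ 0)) := by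
  obtain ⟨w, hw⟩ := hne
  have := hF.holo (Fin.cons w z) (Fin.cases (by simpa) (by simpa)) 0
  simpa only [Fin.update_cons_zero] using this

lemma bound_cons (hF : SepHolo ρ F B) {z : Fin D → ℂ} (hz : ∀ i, z i ∈ bernstein (ρ i.succ))
    {w : ℂ} (hw : w ∈ bernstein (ρ 0)) : ‖F (Fin.cons w z)‖ ≤ B :=
  hF.bound _ (Fin.cases (by simpa) (by simpa))

end SepHolo

lemma bernstein_nonempty {ρ : ℝ} (hρ : 1 < ρ) : (bernstein ρ).Nonempty :=
  ⟨_, ofReal_mem_bernstein hρ (x := 0) (by norm_num)⟩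

/-- Induction with coordinate 0 outermost: the inner interpolant is a finite combination of
functions holomorphic in w, bounded on the ellipse by the induction hypothesis. -/
lemma norm_mInterp_le : ∀ {D : ℕ} {ρ : Fin D → ℝ} {N : Fin D → ℕ} {F : (Fin D → ℂ) → ℂ} {B : ℝ}
    {x : Fin D → ℝ}, (∀ i, 1 < ρ i) → (∀ i, 1 ≤ N i) → SepHolo ρ F B →
    (∀ i, x i ∈ Set.Icc (-1 : ℝ) 1) →
    ‖mInterp N F x‖ ≤ (∏ i, Real.sqrt (0.92 * ellipseFactor (ρ i))) * B
  | 0, ρ, N, F, B, x, _, _, hF, _ => by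
    simp only [mInterp, Fin.prod_univ_zero, one_mul, Fintype.sum_unique]
    exact hF.bound _ (fun i => i.elim0)
  | D + 1, ρ, N, F, B, x, hρ, hN, hF, hx => by
    rw [mInterp_succ_eq_interp, Fin.prod_univ_succ, mul_assoc]
    refine norm_interp_le (hρ 0) (hN 0) ?_ (fun w hw => ?_) (hx 0)
    · simp only [mInterp]
      refine DifferentiableOn.fun_sum fun k _ => DifferentiableOn.const_mul ?_ _
      exact hF.head (fun i => ofReal_mem_bernstein (hρ _) (chebNode_mem _ _))
        (bernstein_nonempty (hρ 0))
    · exact norm_mInterp_le (fun i => hρ i.succ) (fun i => hN i.succ) (hF.tail hw)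
        (fun i => hx i.succ)

/-- The univariate error at a fixed real x remains holomorphic in the other variables, with the
smaller bound e * B, so `norm_mInterp_le` applies to it. -/
lemma SepHolo.interp_error {D : ℕ} {ρ : Fin (D + 1) → ℝ} {F : (Fin (D + 1) → ℂ) → ℂ} {B : ℝ}
    (hF : SepHolo ρ F B) (hρ : ∀ i, 1 < ρ i) {N : ℕ} {e x : ℝ} (hx : x ∈ Set.Icc (-1 : ℝ) 1)
    (he : ∀ (F : ℂ → ℂ) (B : ℝ), DifferentiableOn ℂ F (bernstein (ρ 0)) →
        (∀ z ∈ bernstein (ρ 0), ‖F z‖ ≤ B) → ∀ x ∈ Set.Icc (-1 : ℝ) 1,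
        ‖F x - interp N F x‖ ≤ e * B) :
    SepHolo (fun i => ρ i.succ)
      (fun z => F (Fin.cons (x : ℂ) z) - interp N (fun w => F (Fin.cons w z)) x) (e * B) where
  holo z hz i := by
    refine ((hF.tail (ofReal_mem_bernstein (hρ 0) hx)).holo z hz i).sub ?_
    simp only [interp]
    refine DifferentiableOn.fun_sum fun k _ => DifferentiableOn.const_mul ?_ _
    exact (hF.tail (ofReal_mem_bernstein (hρ 0) (chebNode_mem _ k))).holo z hz i
  bound z hz := he _ B (hF.head hz (bernstein_nonempty (hρ 0)))
    (fun _ hw => hF.bound_cons hz hw) x hx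

/-- The estimate of one step of the induction on the dimension. -/
lemma two_sqrt_add_sqrt_mul_le {A P Q W e : ℝ} (hA : 0 ≤ A) (hP : 0 ≤ P)
    (hW : 1 < W) (he : 0.92 * e ^ 2 ≤ 4 * Q * (W - 1)) :
    Real.sqrt (4 * (A * P)) + Real.sqrt (0.92 * P) * e ≤ Real.sqrt (4 * ((Q + A) * (W * P))) := by
  have h1 : Real.sqrt (4 * (A * P)) = Real.sqrt P * (2 * Real.sqrt A) := by
    rw [show 4 * (A * P) = P * (2 ^ 2 * A) by ring, Real.sqrt_mul hP, Real.sqrt_mul (by norm_num),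
      Real.sqrt_sq (by norm_num)]
  have h2 : Real.sqrt (0.92 * P) = Real.sqrt P * Real.sqrt 0.92 := by
    rw [mul_comm, Real.sqrt_mul hP]
  have h3 : Real.sqrt (4 * ((Q + A) * (W * P))) = Real.sqrt P * Real.sqrt (4 * (Q + A) * W) := by
    rw [← Real.sqrt_mul hP]
    congr 1
    ring
  rw [h1, h2, h3, mul_assoc, ← mul_add]
  refine mul_le_mul_of_nonneg_left (Real.le_sqrt_of_sq_le ?_) (Real.sqrt_nonneg _)
  have hs := Real.sq_sqrt hA
  set s := Real.sqrt A
  set d := Real.sqrt 0.92 * e with hd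
  have hd2 : d ^ 2 ≤ 4 * Q * (W - 1) := by
    rw [hd, mul_pow, Real.sq_sqrt (by norm_num)]
    exact he
  rw [← hs]
  have hW' : 0 < W - 1 := by linarith
  -- The weight W - 1 splits the cross term so that the total becomes 4 s² W + d² W/(W - 1), at most
  -- 4(A + Q)W.
  have h4 : 4 * s * d ≤ 4 * s ^ 2 * (W - 1) + d ^ 2 / (W - 1) := by
    have h := sq_nonneg (2 * s * (W - 1) - d)
    rw [← sub_nonneg]
    have : 4 * s ^ 2 * (W - 1) + d ^ 2 / (W - 1) - 4 * s * d
        = (2 * s * (W - 1) - d) ^ 2 / (W - 1) := by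
      field_simp
      ring
    rw [this]
    positivity
  have h5 : d ^ 2 / (W - 1) ≤ 4 * Q := by rwa [div_le_iff₀ hW']
  nlinarith

/-- With at least one coordinate, one factor 0.92 survives and the others are bounded by 1. -/
lemma prod_sqrt_ellipseFactor_le {D : ℕ} {ρ : Fin (D + 1) → ℝ} (hρ : ∀ i, 1 < ρ i) :
    ∏ i, Real.sqrt (0.92 * ellipseFactor (ρ i)) ≤ Real.sqrt (0.92 * ∏ i, ellipseFactor (ρ i)) := by
  have h0 : ∀ i, 0 ≤ ellipseFactor (ρ i) := fun i => by linarith [two_le_ellipseFactor (hρ i)]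
  rw [← Real.sqrt_prod _ (fun i _ => mul_nonneg (by norm_num) (h0 i)), Finset.prod_mul_distrib]
  refine Real.sqrt_le_sqrt (mul_le_mul_of_nonneg_right ?_ (Finset.prod_nonneg fun i _ => h0 i))
  rw [Finset.prod_const, Finset.card_univ, Fintype.card_fin, pow_succ]
  exact mul_le_of_le_one_left (by norm_num) (pow_le_one₀ (by norm_num) (by norm_num))

/-- The error of the tensor product interpolation of holomorphic functions. -/
theorem mInterp_error_le : ∀ {D : ℕ} {ρ : Fin D → ℝ} {N : Fin D → ℕ} {F : (Fin D → ℂ) → ℂ}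
    {B : ℝ} {x : Fin D → ℝ}, (∀ i, 1 < ρ i) → (∀ i, 1 ≤ N i) → SepHolo ρ F B →
    (∀ i, x i ∈ Set.Icc (-1 : ℝ) 1) →
    ‖F (fun i => (x i : ℂ)) - mInterp N F x‖ ≤
      Real.sqrt (4 * ((∑ i, ((ρ i)⁻¹ ^ 2) ^ N i) * ∏ i, ellipseFactor (ρ i))) * B
  | 0, ρ, N, F, B, x, _, _, _, _ => by
    simp only [mInterp, Fin.prod_univ_zero, one_mul, Fintype.sum_unique, Fin.sum_univ_zero,
      zero_mul, mul_zero, Real.sqrt_zero]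
    rw [Subsingleton.elim (fun i : Fin 0 => (x i : ℂ)), sub_self, norm_zero]
  | D + 1, ρ, N, F, B, x, hρ, hN, hF, hx => by
    have hB0 : 0 ≤ B := (norm_nonneg _).trans
      (hF.bound _ fun i => ofReal_mem_bernstein (hρ i) (hx i))
    obtain ⟨e, he0, he1, he2, he⟩ := exists_interp_error_le (hρ 0) (hN 0)
    have ih := mInterp_error_le (N := fun i => N i.succ) (fun i => hρ i.succ) (fun i => hN i.succ)
      (hF.tail (ofReal_mem_bernstein (hρ 0) (hx 0))) (fun i => hx i.succ)
    have hH := norm_mInterp_le (N := fun i => N i.succ) (fun i => hρ i.succ) (fun i => hN i.succ)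
      (hF.interp_error hρ (hx 0) he) (fun i => hx i.succ)
    rw [mInterp_sub] at hH
    have hcons : (Fin.cons (x 0 : ℂ) fun i : Fin D => (x i.succ : ℂ)) = fun i => (x i : ℂ) := by
      funext i
      refine Fin.cases ?_ (fun i => ?_) i <;> simp
    rw [hcons] at ih
    have hsplit : F (fun i => (x i : ℂ)) - mInterp N F x =
        (F (fun i => (x i : ℂ)) - mInterp (fun i => N i.succ)
          (fun z => F (Fin.cons (x 0 : ℂ) z)) (fun i => x i.succ)) +
        (mInterp (fun i => N i.succ) (fun z => F (Fin.cons (x 0 : ℂ) z)) (fun i => x i.succ) -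
          mInterp (fun i => N i.succ) (fun z => interp (N 0) (fun w => F (Fin.cons w z)) (x 0))
            (fun i => x i.succ)) := by
      rw [mInterp_succ_eq_mInterp]
      ring
    rw [hsplit]
    refine (norm_add_le_of_le ih hH).trans ?_
    rw [← mul_assoc (∏ i, _) e B, ← add_mul, Fin.sum_univ_succ, Fin.prod_univ_succ]
    refine mul_le_mul_of_nonneg_right ?_ hB0
    -- Without further coordinates the empty product provides no factor 0.92, so the first bound on
    -- e is used.
    cases D with
    | zero =>
      simp only [Fin.prod_univ_zero, Fin.sum_univ_zero, mul_zero, Real.sqrt_zero, zero_add,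
        one_mul, add_zero, mul_one]
      exact Real.le_sqrt_of_sq_le (by linarith)
    | succ D =>
      refine le_trans ?_ (two_sqrt_add_sqrt_mul_le (Finset.sum_nonneg fun i _ => by positivity)
        (Finset.prod_nonneg fun i _ => ?_) (by linarith [two_le_ellipseFactor (hρ 0)]) he2)
      · gcongr
        exact prod_sqrt_ellipseFactor_le fun i => hρ i.succ
      · linarith [two_le_ellipseFactor (hρ i.succ)]

namespace Grid

variable {D : ℕ} (G : Grid D)

/-! ### Chebyshev interpolation on a hyperrectangle -/

lemma unscale_mem {x : Fin D → ℝ} (hx : x ∈ G.box) (i : Fin D) :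
    G.unscale x i ∈ Set.Icc (-1 : ℝ) 1 := by
  have h := sub_pos.2 (G.lo_lt_hi i)
  obtain ⟨h1, h2⟩ := hx i
  have h3 : 2 * (G.hi i - x i) / (G.hi i - G.lo i) ≤ 2 := by
    rw [div_le_iff₀ h]
    linarith
  have h4 : 0 ≤ 2 * (G.hi i - x i) / (G.hi i - G.lo i) := div_nonneg (by linarith) h.le
  constructor <;> rw [unscale] <;> linarith

lemma unscale_scale (z : Fin D → ℝ) : G.unscale (G.scale z) = z := by
  funext i
  have h := (sub_pos.2 (G.lo_lt_hi i)).ne'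
  rw [unscale, scale]
  field_simp
  ring

lemma scale_unscale (x : Fin D → ℝ) : G.scale (G.unscale x) = x := by
  funext i
  have h := (sub_pos.2 (G.lo_lt_hi i)).ne'
  rw [scale, unscale]
  field_simp
  ring

lemma scale_mem_box {z : Fin D → ℝ} (hz : ∀ i, z i ∈ Set.Icc (-1 : ℝ) 1) : G.scale z ∈ G.box := by
  intro i
  have h := sub_pos.2 (G.lo_lt_hi i)
  obtain ⟨h1, h2⟩ := hz i
  rw [scale]
  constructor <;> nlinarith

lemma node_mem_box (k : G.Idx) : G.node k ∈ G.box :=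
  G.scale_mem_box fun _ => chebNode_mem _ _

lemma box_eq_Icc : G.box = Set.Icc G.lo G.hi := by
  ext x
  simp [box, Pi.le_def, forall_and]

lemma measurableSet_box : MeasurableSet G.box := by
  rw [box_eq_Icc]
  exact measurableSet_Icc

lemma box_nonempty : G.box.Nonempty := ⟨_, G.node_mem_box fun _ => 0⟩

lemma lagrange_eq (j : G.Idx) (x : Fin D → ℝ) :
    G.lagrange j x = ∏ i, lag (G.N i) (j i) (G.unscale x i) := rfl

lemma unscale_node (k : G.Idx) (i : Fin D) : G.unscale (G.node k) i = chebNode (G.N i) (k i) := by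
  rw [node, unscale_scale]
  rfl

lemma chebT_refNode (j k : G.Idx) :
    G.chebT j (G.refNode k) =
      ∏ i, Real.cos ((j i : ℕ) * (Real.pi * (k i : ℕ) / (G.N i : ℝ))) := by
  refine Finset.prod_congr rfl fun i _ => ?_
  have hN : (0 : ℝ) < G.N i := by exact_mod_cast G.N_pos i
  have hk : ((k i : ℕ) : ℝ) ≤ G.N i := by exact_mod_cast Nat.lt_succ_iff.1 (k i).2
  rw [refNode, Real.arccos_cos (by positivity)]
  rw [div_le_iff₀ hN]
  exact mul_le_mul_of_nonneg_left hk Real.pi_pos.le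

/-- The product of the univariate cosine sums is multiplied out, giving an expansion in products of
Chebyshev polynomials. -/
lemma lagrange_eq_sum {x : Fin D → ℝ} (hx : x ∈ G.box) (k : G.Idx) :
    G.lagrange k x = ∑ j : G.Idx, ∏ i, (endWeight (G.N i) (k i) *
      (2 / (G.N i : ℝ) * endWeight (G.N i) (j i)) *
      Real.cos ((j i : ℕ) * (Real.pi * (k i : ℕ) / (G.N i : ℝ))) *
      Real.cos ((j i : ℕ) * Real.arccos (G.unscale x i))) := by
  have h : ∀ i, lag (G.N i) (k i) (G.unscale x i) = ∑ j : Fin (G.N i + 1),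
      (endWeight (G.N i) (k i) *
      (2 / (G.N i : ℝ) * endWeight (G.N i) j) *
      Real.cos ((j : ℕ) * (Real.pi * (k i : ℕ) / (G.N i : ℝ))) *
      Real.cos ((j : ℕ) * Real.arccos (G.unscale x i))) := by
    intro i
    have hm := G.unscale_mem hx i
    conv_lhs => rw [← Real.cos_arccos hm.1 hm.2]
    rw [lag_cos (G.N_pos i), lagTrig_eq, Finset.sum_range]
  rw [lagrange_eq, Finset.prod_congr rfl fun i _ => h i, Finset.prod_univ_sum,
    Fintype.piFinset_univ]

lemma coe_poly_apply (a : G.Idx → ℝ) (x : Fin D → ℝ) :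
    (G.poly a : (Fin D → ℝ) → ℝ) x = ∑ j, a j * G.chebP j x := by
  simp [poly, basisP]

/-- The Chebyshev coefficients are the ones of the Lagrange interpolation polynomial. -/
lemma poly_chebCoeff_apply (v : G.Idx → ℝ) {x : Fin D → ℝ} (hx : x ∈ G.box) :
    (G.poly (G.chebCoeff v) : (Fin D → ℝ) → ℝ) x = ∑ k, G.lagrange k x * v k := by
  simp only [coe_poly_apply, chebCoeff, G.lagrange_eq_sum hx, Finset.mul_sum, Finset.sum_mul]
  rw [Finset.sum_comm]
  refine Finset.sum_congr rfl fun k _ => Finset.sum_congr rfl fun j _ => ?_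
  rw [chebT_refNode, chebP, Set.indicator_of_mem hx, chebT, primeWeight]
  rw [show ∀ a b c d e : ℝ, a * (b * (c * d)) * e = (b * a * d * e) * c by intros; ring]
  rw [← Finset.prod_mul_distrib, ← Finset.prod_mul_distrib, ← Finset.prod_mul_distrib]
  congr 1
  refine Finset.prod_congr rfl fun i _ => ?_
  have hj : (j i : ℕ) ≤ G.N i := Nat.lt_succ_iff.1 (j i).2
  congr 2
  simp only [endWeight]
  congr 1
  -- The coefficient factor, 1 at the ends and 2 inside, is 2 * `endWeight`.
  by_cases h : (j i : ℕ) = 0 ∨ (j i : ℕ) = G.N i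
  · rw [if_neg (by omega), if_pos h]
    ring
  · rw [if_pos (by omega), if_neg h]
    ring

lemma poly_apply_of_notMem (p : G.polySpace) {x : Fin D → ℝ} (hx : x ∉ G.box) :
    (p : (Fin D → ℝ) → ℝ) x = 0 := by
  obtain ⟨p, hp⟩ := p
  refine Submodule.span_induction (p := fun p _ => p x = 0) ?_ rfl ?_ ?_ hp
  · rintro _ ⟨j, rfl⟩
    exact Set.indicator_of_notMem hx _
  · intro p q _ _ h1 h2
    simp [h1, h2]
  · intro c p _ h
    simp [h]

/-- The sum over multi-indices factors over the coordinates. Boundedness is needed for `sSup` to be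
an upper bound at all. -/
lemma bddAbove_lebesgue : BddAbove ((fun x => ∑ j, |G.lagrange j x|) '' G.box) := by
  refine ⟨∏ i, lebNum (G.N i), ?_⟩
  rintro _ ⟨x, hx, rfl⟩
  have h : ∑ j, |G.lagrange j x| = ∏ i, ∑ k, |lag (G.N i) k (G.unscale x i)| := by
    rw [Finset.prod_univ_sum, Fintype.piFinset_univ]
    refine Finset.sum_congr rfl fun j _ => ?_
    rw [lagrange_eq, Finset.abs_prod]
  simp only [h]
  exact Finset.prod_le_prod (fun i _ => Finset.sum_nonneg fun _ _ => abs_nonneg _)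
    fun i _ => (sum_abs_lag_le (G.N_pos i) (G.unscale_mem hx i)).trans
      (lebesgueBound_le_lebNum _)

lemma sum_abs_lagrange_le {x : Fin D → ℝ} (hx : x ∈ G.box) :
    ∑ j, |G.lagrange j x| ≤ G.lebesgue :=
  le_csSup G.bddAbove_lebesgue ⟨x, hx, rfl⟩

lemma lebesgue_nonneg : 0 ≤ G.lebesgue := by
  obtain ⟨x, hx⟩ := G.box_nonempty
  exact (Finset.sum_nonneg fun _ _ => abs_nonneg _).trans (G.sum_abs_lagrange_le hx)

/-! ### The interpolation error of analytic functions -/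

variable {G}

/-- The complexification of `Grid.scale`. -/
def cscale (G : Grid D) (z : Fin D → ℂ) : Fin D → ℂ :=
  fun i => (G.hi i : ℂ) + ((G.lo i - G.hi i : ℝ) : ℂ) / 2 * (1 - z i)

lemma cscale_mem_ellipse {ρ : Fin D → ℝ} {z : Fin D → ℂ} (hz : ∀ i, z i ∈ bernstein (ρ i)) :
    G.cscale z ∈ G.ellipse ρ := fun i => ⟨z i, hz i, rfl⟩

lemma cscale_ofReal (z : Fin D → ℝ) :
    G.cscale (fun i => (z i : ℂ)) = fun i => (G.scale z i : ℂ) := by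
  funext i
  simp only [cscale, scale]
  push_cast
  ring

lemma sepHolo_comp_cscale {ρ : Fin D → ℝ} {F : (Fin D → ℂ) → ℂ} {B : ℝ}
    (hF : AnalyticOnNhd ℂ F (G.ellipse ρ)) (hB : ∀ z ∈ G.ellipse ρ, ‖F z‖ ≤ B) :
    SepHolo ρ (fun z => F (G.cscale z)) B where
  holo z hz i w hw := by
    have hmem : G.cscale (Function.update z i w) ∈ G.ellipse ρ := by
      refine cscale_mem_ellipse fun j => ?_
      rcases eq_or_ne j i with rfl | h
      · simpa using hw
      · simpa [h] using hz j
    have h1 : DifferentiableAt ℂ (fun w => G.cscale (Function.update z i w)) w := by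
      refine differentiableAt_pi.2 fun j => ?_
      simp only [cscale]
      have : DifferentiableAt ℂ (fun w => Function.update z i w j) w := by
        rcases eq_or_ne j i with rfl | h
        · simp
        · simp [h]
      fun_prop
    exact ((hF _ hmem).differentiableAt.comp w h1).differentiableWithinAt
  bound z hz := hB _ (cscale_mem_ellipse hz)

/-- Distributing 2^D under the root over the coordinates produces the factors `ellipseFactor`, the
form suited to induction. -/
lemma epsInt_eq (ρ : Fin D → ℝ) (B : ℝ) :
    G.epsInt ρ B =
      Real.sqrt (4 * ((∑ i, ((ρ i)⁻¹ ^ 2) ^ G.N i) * ∏ i, ellipseFactor (ρ i))) * B := by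
  have e1 : ∏ i, ellipseFactor (ρ i) = 2 ^ D * ∏ j, 1 / (1 - ρ j ^ (-2 : ℤ)) := by
    have : (2 : ℝ) ^ D = ∏ _i : Fin D, (2 : ℝ) := by simp
    rw [this, ← Finset.prod_mul_distrib]
    refine Finset.prod_congr rfl fun i _ => ?_
    rw [ellipseFactor, inv_pow, zpow_neg, mul_one_div]
    norm_cast
  have e2 : ∑ i, ((ρ i)⁻¹ ^ 2) ^ G.N i = ∑ i, ρ i ^ (-(2 * (G.N i : ℤ))) := by
    refine Finset.sum_congr rfl fun i _ => ?_
    rw [← pow_mul, inv_pow, zpow_neg]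
    norm_cast
  rw [epsInt, e1, e2, ← Real.sqrt_eq_rpow]
  rw [show ∀ S P : ℝ, 4 * (S * (2 ^ D * P)) = (2 ^ 2 * 2 ^ D) * (S * P) by intros; ring,
    Real.sqrt_mul (by positivity : (0 : ℝ) ≤ 2 ^ 2 * 2 ^ D),
    Real.sqrt_mul (by positivity : (0 : ℝ) ≤ 2 ^ 2), Real.sqrt_sq (by norm_num),
    Real.sqrt_eq_rpow (2 ^ D), ← Real.rpow_natCast 2 D, ← Real.rpow_mul (by norm_num),
    Real.rpow_add (by norm_num), Real.rpow_one]
  ring_nf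

/-- The interpolation error of a function with a bounded analytic extension. -/
lemma HasAnalyticExtension.abs_sub_le {h : (Fin D → ℝ) → ℝ} {ρ : Fin D → ℝ} {B : ℝ}
    (hh : G.HasAnalyticExtension h ρ B) (hρ : ∀ i, 1 < ρ i) {x : Fin D → ℝ} (hx : x ∈ G.box) :
    |h x - ∑ k, G.lagrange k x * h (G.node k)| ≤ G.epsInt ρ B := by
  obtain ⟨F, hF, hFh, hB⟩ := hh
  have key := mInterp_error_le hρ G.N_pos (sepHolo_comp_cscale hF hB) (G.unscale_mem hx)
  rw [← epsInt_eq, cscale_ofReal, scale_unscale, hFh x hx] at key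
  have e : mInterp G.N (fun z => F (G.cscale z)) (G.unscale x) =
      ((∑ k, G.lagrange k x * h (G.node k) : ℝ) : ℂ) := by
    rw [mInterp]
    push_cast
    refine Finset.sum_congr rfl fun k _ => ?_
    rw [lagrange_eq, ← hFh _ (G.node_mem_box k)]
    push_cast
    congr 2
    rw [cscale_ofReal]
    rfl
  rw [e, ← Complex.ofReal_sub, Complex.norm_real] at key
  exact key

lemma HasAnalyticExtension.abs_le_supNorm {h : (Fin D → ℝ) → ℝ} {ρ : Fin D → ℝ} {B : ℝ}
    (hh : G.HasAnalyticExtension h ρ B) (hρ : ∀ i, 1 < ρ i) {x : Fin D → ℝ} (hx : x ∈ G.box) :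
    |h x| ≤ G.supNorm h := by
  obtain ⟨F, hF, hFh, hB⟩ := hh
  refine le_csSup ⟨B, ?_⟩ ⟨x, hx, rfl⟩
  rintro _ ⟨x, hx, rfl⟩
  have h1 := cscale_mem_ellipse (G := G) (ρ := ρ)
    fun i => ofReal_mem_bernstein (hρ i) (G.unscale_mem hx i)
  have h2 := hB _ h1
  rw [cscale_ofReal, scale_unscale, hFh x hx, Complex.norm_real] at h2
  exact h2

end Grid

/-! ### Linearity, integrability and measurability of Chebyshev interpolants -/

variable {D : ℕ} {G : Grid D}

namespace Grid

/-- Recovers nodal values from the interpolant, so that a vanishing random polynomial has vanishing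
nodal values. -/
lemma poly_chebCoeff_node (w : G.Idx → ℝ) (m : G.Idx) :
    (G.poly (G.chebCoeff w) : (Fin D → ℝ) → ℝ) (G.node m) = w m := by
  rw [G.poly_chebCoeff_apply w (G.node_mem_box m), Finset.sum_eq_single m]
  · simp [lagrange_eq, unscale_node, lag_node (G.N_pos _)]
  · intro k _ hk
    obtain ⟨i, hi⟩ := Function.ne_iff.1 hk
    rw [lagrange_eq, Finset.prod_eq_zero (Finset.mem_univ i), zero_mul]
    rw [unscale_node, lag_node (G.N_pos _), if_neg (Ne.symm hi)]
  · simp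

lemma poly_smul (r : ℝ) (a : G.Idx → ℝ) : G.poly (r • a) = r • G.poly a := by
  simp only [poly, Finset.smul_sum, Pi.smul_apply, smul_smul, smul_eq_mul]

lemma poly_zero : G.poly 0 = 0 := by simp [poly]

lemma chebCoeff_zero : G.chebCoeff 0 = 0 := by
  funext j
  simp [chebCoeff]

lemma measurable_chebP (j : G.Idx) : Measurable (G.chebP j) := by
  refine Measurable.indicator ?_ G.measurableSet_box
  unfold chebT unscale
  fun_prop

lemma abs_chebP_le (j : G.Idx) (x : Fin D → ℝ) : |G.chebP j x| ≤ 1 := by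
  classical
  rw [chebP, Set.indicator_apply]
  split_ifs
  · rw [chebT, Finset.abs_prod]
    exact Finset.prod_le_one (fun _ _ => abs_nonneg _) fun _ _ => Real.abs_cos_le_one _
  · simp

lemma integrable_poly (a : G.Idx → ℝ) (μ : Measure (Fin D → ℝ)) [IsFiniteMeasure μ] :
    Integrable (G.poly a : (Fin D → ℝ) → ℝ) μ := by
  have : (G.poly a : (Fin D → ℝ) → ℝ) = fun x => ∑ j, a j * G.chebP j x :=
    funext fun x => G.coe_poly_apply a x
  rw [this]
  refine integrable_finsetSum _ fun j _ => Integrable.const_mul ?_ _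
  exact Integrable.of_bound (measurable_chebP j).aestronglyMeasurable 1
    (ae_of_all _ fun x => abs_chebP_le j x)

lemma measurable_poly_apply {Ω' : Type*} [MeasurableSpace Ω'] {a : Ω' → G.Idx → ℝ}
    (ha : ∀ j, Measurable fun ω => a ω j) :
    Measurable fun p : Ω' × (Fin D → ℝ) => (G.poly (a p.1) : (Fin D → ℝ) → ℝ) p.2 := by
  simp only [coe_poly_apply]
  exact Finset.measurable_fun_sum _ fun j _ =>
    ((ha j).comp measurable_fst).mul ((measurable_chebP j).comp measurable_snd)

lemma measurable_chebCoeff {Ω' : Type*} [MeasurableSpace Ω'] {w : Ω' → G.Idx → ℝ}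
    (hw : ∀ k, Measurable fun ω => w ω k) (j : G.Idx) :
    Measurable fun ω => G.chebCoeff (w ω) j := by
  simp only [chebCoeff]
  exact (Finset.measurable_fun_sum _ fun k _ => ((hw k).mul_const _).const_mul _).const_mul _

end Grid

open Grid

lemma apply_poly (φ : G.polySpace →ₗ[ℝ] ℝ) (a : G.Idx → ℝ) :
    φ (G.poly a) = ∑ j, a j * φ (G.basisP j) := by
  simp [poly, map_sum]

lemma exactOp_poly_smul (t : ℕ → ℝ≥0) (κ : ℝ≥0 → ℝ≥0 → Kernel (Fin D → ℝ) (Fin D → ℝ)) (u : ℕ)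
    (k : G.Idx) (r : ℝ) (a : G.Idx → ℝ) :
    exactOp G t κ u k (G.poly (r • a)) = r * exactOp G t κ u k (G.poly a) := by
  rw [poly_smul, exactOp, exactOp, ← integral_const_mul]
  rfl

/-! ### The algorithm -/

section Algorithm

variable {n : ℕ} {t : ℕ → ℝ≥0} {g : ℝ≥0 → (Fin D → ℝ) → ℝ} {f : ℝ → ℝ → ℝ} {L : ℝ}

/-- The nodal values computed by the algorithm at time `t u`. -/
def nodalValue (G : Grid D) (n : ℕ) (t : ℕ → ℝ≥0) (g : ℝ≥0 → (Fin D → ℝ) → ℝ) (f : ℝ → ℝ → ℝ)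
    (Γ : ℕ → G.Idx → (G.polySpace →ₗ[ℝ] ℝ)) (u : ℕ) (k : G.Idx) : ℝ :=
  if u < n then f (g (t u) (G.node k)) (Γ u k (approxValue G n t g f Γ (u + 1)))
  else g (t n) (G.node k)

lemma coeffBack_eq (Γ : ℕ → G.Idx → (G.polySpace →ₗ[ℝ] ℝ)) {u : ℕ} (hu : u ≤ n) :
    coeffBack G n t g f Γ (n - u) = G.chebCoeff (nodalValue G n t g f Γ u) := by
  rcases hu.lt_or_eq with h | rfl
  · obtain ⟨m, rfl⟩ := Nat.exists_eq_add_of_lt h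
    have e1 : u + m + 1 - u = m + 1 := by omega
    have e2 : u + m + 1 - (m + 1) = u := by omega
    have e3 : u + m + 1 - (u + 1) = m := by omega
    rw [e1, coeffBack, e2]
    congr 1
    funext k
    rw [nodalValue, if_pos h, approxValue, e3, apply_poly]
  · rw [Nat.sub_self, coeffBack]
    congr 1
    funext k
    rw [nodalValue, if_neg (lt_irrefl _)]

lemma approxValue_eq (Γ : ℕ → G.Idx → (G.polySpace →ₗ[ℝ] ℝ)) {u : ℕ} (hu : u ≤ n) :
    approxValue G n t g f Γ u = G.poly (G.chebCoeff (nodalValue G n t g f Γ u)) := by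
  rw [approxValue, coeffBack_eq Γ hu]

lemma nonneg_of_forall_abs_sub_le
    (hf : ∀ x₁ y₁ x₂ y₂, |f x₁ y₁ - f x₂ y₂| ≤ L * (|x₁ - x₂| + |y₁ - y₂|)) : 0 ≤ L := by
  have := (abs_nonneg _).trans (hf 1 0 0 0)
  simpa using this

lemma continuous_of_forall_abs_sub_le
    (hf : ∀ x₁ y₁ x₂ y₂, |f x₁ y₁ - f x₂ y₂| ≤ L * (|x₁ - x₂| + |y₁ - y₂|)) (x : ℝ) :
    Continuous (f x) := by
  refine (LipschitzWith.of_dist_le_mul (K := ⟨L, nonneg_of_forall_abs_sub_le hf⟩)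
    fun y₁ y₂ => ?_).continuous
  have := hf x y₁ x y₂
  rw [Real.dist_eq, Real.dist_eq]
  change _ ≤ L * _
  simpa using this

/-- The first m backward steps use only operators of the times n - m, …, n - 1, all later than u by
`u + m < n`. So the polynomial at time u + 1 is admissible in `GMStar` at time u. -/
lemma measurable_coeffBack
    (hf : ∀ x₁ y₁ x₂ y₂, |f x₁ y₁ - f x₂ y₂| ≤ L * (|x₁ - x₂| + |y₁ - y₂|))
    {Ω' : Type*} [MeasurableSpace Ω'] {Γ : ℕ → G.Idx → Ω' → (G.polySpace →ₗ[ℝ] ℝ)} {u : ℕ}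
    (hΓ : ∀ v ∈ Set.Ioo u n, ∀ k q, Measurable fun ω => Γ v k ω q) :
    ∀ (m : ℕ), u + m < n → ∀ j,
      Measurable fun ω => coeffBack G n t g f (fun v k => Γ v k ω) m j
  | 0, _, _ => measurable_const
  | m + 1, hm, j => by
    simp only [coeffBack]
    refine measurable_chebCoeff (fun k => ?_) j
    refine (continuous_of_forall_abs_sub_le hf _).measurable.comp ?_
    exact Finset.measurable_fun_sum _ fun j _ =>
      (measurable_coeffBack hf hΓ m (by omega) j).mul (hΓ _ ⟨by omega, by omega⟩ k _)

lemma laterSigma_le {Ω' : Type*} [mΩ' : MeasurableSpace Ω']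
    {Γ : ℕ → G.Idx → Ω' → (G.polySpace →ₗ[ℝ] ℝ)}
    (hΓ : ∀ v < n, ∀ k q, Measurable fun ω => Γ v k ω q) (u : ℕ) : laterSigma G n Γ u ≤ mΩ' :=
  iSup₂_le fun v hv => iSup_le fun k => iSup_le fun q => (hΓ v hv.2 k q).comap_le

lemma measurable_laterSigma {Ω' : Type*} (Γ : ℕ → G.Idx → Ω' → (G.polySpace →ₗ[ℝ] ℝ)) {u v : ℕ}
    (hv : v ∈ Set.Ioo u n) (k : G.Idx) (q : G.polySpace) :
    Measurable[laterSigma G n Γ u] fun ω => Γ v k ω q := by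
  refine Measurable.of_comap_le ?_
  exact le_iSup₂_of_le v hv (le_iSup_of_le k (le_iSup_of_le q le_rfl))

end Algorithm

/-! ### One step of the error propagation -/

section Step

variable {n : ℕ} {t : ℕ → ℝ≥0} {κ : ℝ≥0 → ℝ≥0 → Kernel (Fin D → ℝ) (Fin D → ℝ)}
  {g : ℝ≥0 → (Fin D → ℝ) → ℝ} {f : ℝ → ℝ → ℝ} {L : ℝ} {V : ℕ → (Fin D → ℝ) → ℝ}
  {Ω' : Type*} [mΩ' : MeasurableSpace Ω'] {P' : Measure Ω'}
  {Γ : ℕ → G.Idx → Ω' → (G.polySpace →ₗ[ℝ] ℝ)} {δ : ℝ}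

/-- The bound on the error of the random operators, without the normalization of the random
polynomial. -/
lemma GMStar.lintegral_le (hG : GMStar G n t P' κ Γ δ)
    (hΓ : ∀ v < n, ∀ k q, Measurable fun ω => Γ v k ω q) {u : ℕ} (hu : u < n) (k : G.Idx)
    {w : Ω' → G.Idx → ℝ} (hw : ∀ j, Measurable[laterSigma G n Γ u] fun ω => G.chebCoeff (w ω) j)
    (hfin : starNorm G P' (fun ω => G.poly (G.chebCoeff (w ω))) ≠ ∞) :
    ∫⁻ ω, ‖exactOp G t κ u k (G.poly (G.chebCoeff (w ω))) -
        Γ u k ω (G.poly (G.chebCoeff (w ω)))‖ₑ ∂P' ≤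
      ENNReal.ofReal δ * starNorm G P' (fun ω => G.poly (G.chebCoeff (w ω))) := by
  set s := starNorm G P' (fun ω => G.poly (G.chebCoeff (w ω))) with hs
  -- A polynomial of norm 0 cannot be normalized; but then its nodal values, hence the polynomial,
  -- vanish almost surely. Otherwise divide by s.
  rcases eq_or_ne s 0 with h0 | h0
  · have h1 : ∀ m, ∀ᵐ ω ∂P', w ω m = 0 := by
      intro m
      have h2 : ∫⁻ ω, ‖(G.poly (G.chebCoeff (w ω)) : (Fin D → ℝ) → ℝ) (G.node m)‖ₑ ∂P' = 0 := by
        rw [← nonpos_iff_eq_zero, ← h0, hs]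
        exact le_iSup₂ (f := fun x _ => ∫⁻ ω,
          ‖(G.poly (G.chebCoeff (w ω)) : (Fin D → ℝ) → ℝ) x‖ₑ ∂P') _ (G.node_mem_box m)
      have hmeas : Measurable fun ω =>
          ‖(G.poly (G.chebCoeff (w ω)) : (Fin D → ℝ) → ℝ) (G.node m)‖ₑ :=
        ((measurable_poly_apply fun j => (hw j).mono (laterSigma_le hΓ u) le_rfl).comp
          (measurable_id.prodMk measurable_const)).enorm
      rw [lintegral_eq_zero_iff hmeas] at h2
      filter_upwards [h2] with ω hω
      simpa [poly_chebCoeff_node] using hω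
    have h3 : ∀ᵐ ω ∂P', ‖exactOp G t κ u k (G.poly (G.chebCoeff (w ω))) -
        Γ u k ω (G.poly (G.chebCoeff (w ω)))‖ₑ = 0 := by
      filter_upwards [ae_all_iff.2 h1] with ω hω
      have : w ω = 0 := funext hω
      rw [this, chebCoeff_zero, poly_zero]
      simp [exactOp]
    rw [lintegral_congr_ae h3]
    simp
  · have hr : 0 < s.toReal := ENNReal.toReal_pos h0 hfin
    set r := s.toReal⁻¹ with hrdef
    have hre : ‖r‖ₑ = s⁻¹ := by
      rw [Real.enorm_eq_ofReal (by positivity), hrdef, ENNReal.ofReal_inv_of_pos hr,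
        ENNReal.ofReal_toReal hfin]
    have h1 : starNorm G P' (fun ω => G.poly (r • G.chebCoeff (w ω))) = 1 := by
      have h2 : ∀ x : Fin D → ℝ,
          ∫⁻ ω, ‖(G.poly (r • G.chebCoeff (w ω)) : (Fin D → ℝ) → ℝ) x‖ₑ ∂P' =
          s⁻¹ * ∫⁻ ω, ‖(G.poly (G.chebCoeff (w ω)) : (Fin D → ℝ) → ℝ) x‖ₑ ∂P' := by
        intro x
        rw [← hre, ← lintegral_const_mul' _ _ enorm_ne_top]
        refine lintegral_congr fun ω => ?_
        rw [poly_smul, ← enorm_mul]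
        rfl
      simp only [starNorm, h2, ← ENNReal.mul_iSup]
      exact ENNReal.inv_mul_cancel h0 hfin
    have h2 := hG.2 u hu k (fun ω => r • G.chebCoeff (w ω)) (fun j => by
      exact (hw j).const_mul r) h1
    have h3 : ∀ ω, ‖exactOp G t κ u k (G.poly (r • G.chebCoeff (w ω))) -
        Γ u k ω (G.poly (r • G.chebCoeff (w ω)))‖ₑ =
        s⁻¹ * ‖exactOp G t κ u k (G.poly (G.chebCoeff (w ω))) -
        Γ u k ω (G.poly (G.chebCoeff (w ω)))‖ₑ := by
      intro ω
      rw [exactOp_poly_smul, poly_smul, map_smul, smul_eq_mul, ← mul_sub, enorm_mul, hre]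
    simp only [h3] at h2
    rw [lintegral_const_mul' _ _ (ENNReal.inv_ne_top.2 h0), mul_comm, ← div_eq_mul_inv,
      ENNReal.div_le_iff h0 hfin] at h2
    exact h2

/-- The error of the approximation at `t u` in terms of the errors of the nodal values. -/
lemma errorStar_le [IsProbabilityMeasure P'] {u : ℕ} (hu : u ≤ n)
    {ρ : Fin D → ℝ} (hρ : ∀ i, 1 < ρ i) {B : ℝ} (hB : G.HasAnalyticExtension (V u) ρ B)
    (hmeas : ∀ k, Measurable fun ω => nodalValue G n t g f (fun v k => Γ v k ω) u k)
    {M : ℝ≥0∞} (hM : ∀ k, ∫⁻ ω, ‖V u (G.node k) -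
      nodalValue G n t g f (fun v k => Γ v k ω) u k‖ₑ ∂P' ≤ M) :
    errorStar G n t P' g f V Γ u ≤
      ENNReal.ofReal (G.epsInt ρ B) + ENNReal.ofReal G.lebesgue * M := by
  refine iSup₂_le fun x hx => ?_
  have hmk : ∀ k, Measurable fun ω => ‖G.lagrange k x‖ₑ *
      ‖V u (G.node k) - nodalValue G n t g f (fun v k => Γ v k ω) u k‖ₑ := fun k =>
    ((hmeas k).const_sub _).enorm.const_mul _
  calc _ ≤ ∫⁻ ω, (ENNReal.ofReal (G.epsInt ρ B) + ∑ k, ‖G.lagrange k x‖ₑ *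
          ‖V u (G.node k) - nodalValue G n t g f (fun v k => Γ v k ω) u k‖ₑ) ∂P' := by
        refine lintegral_mono fun ω => ?_
        rw [approxValue_eq _ hu, G.poly_chebCoeff_apply _ hx]
        set v := nodalValue G n t g f (fun v k => Γ v k ω) u
        -- The interpolation error of `V u` plus the interpolant of the nodal errors.
        have e : V u x - ∑ k, G.lagrange k x * v k =
            (V u x - ∑ k, G.lagrange k x * V u (G.node k)) +
              ∑ k, G.lagrange k x * (V u (G.node k) - v k) := by
          simp only [mul_sub, Finset.sum_sub_distrib]
          ring
        rw [e]
        refine (enorm_add_le _ _).trans (add_le_add ?_ ?_)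
        · rw [Real.enorm_eq_ofReal_abs]
          exact ENNReal.ofReal_le_ofReal (hB.abs_sub_le hρ hx)
        · refine (enorm_sum_le _ _).trans (le_of_eq ?_)
          simp only [enorm_mul]
    _ = ENNReal.ofReal (G.epsInt ρ B) + ∑ k, ‖G.lagrange k x‖ₑ *
          ∫⁻ ω, ‖V u (G.node k) - nodalValue G n t g f (fun v k => Γ v k ω) u k‖ₑ ∂P' := by
        rw [lintegral_add_left measurable_const, lintegral_finsetSum _ fun k _ => hmk k]
        simp only [lintegral_const, measure_univ, mul_one]
        congr 1
        exact Finset.sum_congr rfl fun k _ => lintegral_const_mul' _ _ enorm_ne_top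
    _ ≤ ENNReal.ofReal (G.epsInt ρ B) + ∑ k, ‖G.lagrange k x‖ₑ * M := by
        gcongr with k
        exact hM k
    _ ≤ _ := by
        rw [← Finset.sum_mul]
        gcongr
        simp only [Real.enorm_eq_ofReal_abs]
        rw [← ENNReal.ofReal_sum_of_nonneg fun _ _ => abs_nonneg _]
        exact ENNReal.ofReal_le_ofReal (G.sum_abs_lagrange_le hx)

/-- The mean error of the approximation, integrated over the hyperrectangle. -/
lemma lintegral_enorm_integral_sub_le [SFinite P'] {h : (Fin D → ℝ) → ℝ}
    {μ : Measure (Fin D → ℝ)} [IsProbabilityMeasure μ] (hh : Integrable h μ)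
    {a : Ω' → G.Idx → ℝ} (ha : ∀ j, Measurable fun ω => a ω j) {E : ℝ≥0∞}
    (hE : ∀ x ∈ G.box, ∫⁻ ω, ‖h x - (G.poly (a ω) : (Fin D → ℝ) → ℝ) x‖ₑ ∂P' ≤ E) :
    ∫⁻ ω, ‖∫ y, (G.box.indicator h y - (G.poly (a ω) : (Fin D → ℝ) → ℝ) y) ∂μ‖ₑ ∂P' ≤ E := by
  have hmeas : AEMeasurable (Function.uncurry fun (ω : Ω') (y : Fin D → ℝ) =>
      ‖G.box.indicator h y - (G.poly (a ω) : (Fin D → ℝ) → ℝ) y‖ₑ) (P'.prod μ) := by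
    refine AEMeasurable.enorm (AEMeasurable.sub ?_ (measurable_poly_apply ha).aemeasurable)
    exact (hh.indicator G.measurableSet_box).aestronglyMeasurable.aemeasurable.comp_snd
  calc _ ≤ ∫⁻ ω, ∫⁻ y, ‖G.box.indicator h y - (G.poly (a ω) : (Fin D → ℝ) → ℝ) y‖ₑ ∂μ ∂P' :=
        lintegral_mono fun ω => enorm_integral_le_lintegral_enorm _
    -- The supremum over x stands outside the expectation, so the expectation has to become the
    -- inner integral. Outside the box both functions vanish.
    _ = ∫⁻ y, ∫⁻ ω, ‖G.box.indicator h y - (G.poly (a ω) : (Fin D → ℝ) → ℝ) y‖ₑ ∂P' ∂μ :=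
        lintegral_lintegral_swap hmeas
    _ ≤ ∫⁻ _, E ∂μ := by
        refine lintegral_mono fun y => ?_
        by_cases hy : y ∈ G.box
        · simpa [hy] using hE y hy
        · simp [hy, G.poly_apply_of_notMem _ hy]
    _ = E := by simp

end Step

section Step

variable {n : ℕ} {t : ℕ → ℝ≥0} {κ : ℝ≥0 → ℝ≥0 → Kernel (Fin D → ℝ) (Fin D → ℝ)}
  {g : ℝ≥0 → (Fin D → ℝ) → ℝ} {f : ℝ → ℝ → ℝ} {L : ℝ} {V : ℕ → (Fin D → ℝ) → ℝ}
  {Ω' : Type*} [mΩ' : MeasurableSpace Ω'] {P' : Measure Ω'}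
  {Γ : ℕ → G.Idx → Ω' → (G.polySpace →ₗ[ℝ] ℝ)} {δ : ℝ}

/-- Triangle inequality for V - (V - V̂): it bounds the norm that multiplies δ, and shows it finite
when the error is. -/
lemma starNorm_approxValue_le [IsProbabilityMeasure P'] {u : ℕ} {b : ℝ}
    (hb : ∀ x ∈ G.box, |V u x| ≤ b) :
    starNorm G P' (fun ω => approxValue G n t g f (fun v k => Γ v k ω) u) ≤
      ENNReal.ofReal b + errorStar G n t P' g f V Γ u := by
  refine iSup₂_le fun x hx => ?_
  calc _ ≤ ∫⁻ ω, (ENNReal.ofReal b + ‖V u x -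
        (approxValue G n t g f (fun v k => Γ v k ω) u : (Fin D → ℝ) → ℝ) x‖ₑ) ∂P' := by
        refine lintegral_mono fun ω => ?_
        set y := (approxValue G n t g f (fun v k => Γ v k ω) u : (Fin D → ℝ) → ℝ) x
        calc ‖y‖ₑ = ‖V u x - (V u x - y)‖ₑ := by rw [sub_sub_cancel]
          _ ≤ ‖V u x‖ₑ + ‖V u x - y‖ₑ := enorm_sub_le
          _ ≤ _ := by
            gcongr
            rw [Real.enorm_eq_ofReal_abs]
            exact ENNReal.ofReal_le_ofReal (hb x hx)
    _ ≤ _ := by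
        rw [lintegral_add_left measurable_const]
        simp only [lintegral_const, measure_univ, mul_one]
        gcongr
        exact le_iSup₂ (f := fun x _ => ∫⁻ ω, ‖V u x -
          (approxValue G n t g f (fun v k => Γ v k ω) u : (Fin D → ℝ) → ℝ) x‖ₑ ∂P') x hx

lemma measurable_nodalValue
    (hf : ∀ x₁ y₁ x₂ y₂, |f x₁ y₁ - f x₂ y₂| ≤ L * (|x₁ - x₂| + |y₁ - y₂|))
    (hΓ : ∀ v < n, ∀ k q, Measurable fun ω => Γ v k ω q) (u : ℕ) (k : G.Idx) :
    Measurable fun ω => nodalValue G n t g f (fun v k => Γ v k ω) u k := by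
  by_cases hu : u < n
  · simp only [nodalValue, if_pos hu]
    refine (continuous_of_forall_abs_sub_le hf _).measurable.comp ?_
    simp only [approxValue, apply_poly]
    exact Finset.measurable_fun_sum _ fun j _ =>
      (measurable_coeffBack hf (fun v hv k q => hΓ v hv.2 k q) (u := u) _ (by omega) j).mul
        (hΓ _ hu k _)
  · simp only [nodalValue, if_neg hu]
    exact measurable_const

/-- The error of the nodal values in terms of the error at the next time step. -/
lemma lintegral_nodalValue_sub_le [IsProbabilityMeasure P']
    (hf : ∀ x₁ y₁ x₂ y₂, |f x₁ y₁ - f x₂ y₂| ≤ L * (|x₁ - x₂| + |y₁ - y₂|))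
    (hV : IsValueFunction n t g f κ V) {εtr : ℝ} (hTR : TR G n t κ V εtr)
    (hΓ : ∀ v < n, ∀ k q, Measurable fun ω => Γ v k ω q) (hG : GMStar G n t P' κ Γ δ)
    {u : ℕ} (hu : u < n) [IsMarkovKernel (κ (t u) (t (u + 1)))] {b : ℝ}
    (hb : ∀ x ∈ G.box, |V (u + 1) x| ≤ b) (hfin : errorStar G n t P' g f V Γ (u + 1) ≠ ∞)
    (k : G.Idx) :
    ∫⁻ ω, ‖V u (G.node k) - nodalValue G n t g f (fun v k => Γ v k ω) u k‖ₑ ∂P' ≤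
      ENNReal.ofReal L * (ENNReal.ofReal εtr + (errorStar G n t P' g f V Γ (u + 1) +
        ENNReal.ofReal δ * (ENNReal.ofReal b + errorStar G n t P' g f V Γ (u + 1)))) := by
  set w : Ω' → G.Idx → ℝ := fun ω => nodalValue G n t g f (fun v k => Γ v k ω) (u + 1) with hw
  set μ := κ (t u) (t (u + 1)) (G.node k) with hμ
  set S := errorStar G n t P' g f V Γ (u + 1) with hS
  have hp : ∀ ω, approxValue G n t g f (fun v k => Γ v k ω) (u + 1) =
      G.poly (G.chebCoeff (w ω)) := fun ω => approxValue_eq _ hu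
  have hint := hV.integrable u hu (G.node k)
  have hcm : ∀ j, Measurable fun ω => G.chebCoeff (w ω) j :=
    measurable_chebCoeff (measurable_nodalValue hf hΓ (u + 1))
  have hcm' : ∀ j, Measurable[laterSigma G n Γ u] fun ω => G.chebCoeff (w ω) j := by
    intro j
    simp only [hw, ← coeffBack_eq _ (Nat.succ_le_of_lt hu)]
    -- The measurability argument is run with the σ-algebra of the later steps instead of the
    -- ambient one.
    exact @measurable_coeffBack D G n t g f L hf Ω' (laterSigma G n Γ u) Γ u
      (fun v hv k q => measurable_laterSigma Γ hv k q) _ (by omega) j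
  have hstar := starNorm_approxValue_le (n := n) (t := t) (g := g) (f := f) (P' := P') (Γ := Γ) hb
  simp only [hp] at hstar
  have h1 : ∫⁻ ω, ‖∫ y, (G.box.indicator (V (u + 1)) y -
      (G.poly (G.chebCoeff (w ω)) : (Fin D → ℝ) → ℝ) y) ∂μ‖ₑ ∂P' ≤ S := by
    refine lintegral_enorm_integral_sub_le hint hcm fun x hx => ?_
    simp only [← hp]
    exact le_iSup₂ (f := fun x _ => ∫⁻ ω, ‖V (u + 1) x -
      (approxValue G n t g f (fun v k => Γ v k ω) (u + 1) : (Fin D → ℝ) → ℝ) x‖ₑ ∂P') x hx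
  have h2 := hG.lintegral_le hΓ hu k hcm'
    (ne_top_of_le_ne_top (ENNReal.add_ne_top.2 ⟨ENNReal.ofReal_ne_top, hfin⟩) hstar)
  have h3 : Measurable fun ω => ‖∫ y, (G.box.indicator (V (u + 1)) y -
      (G.poly (G.chebCoeff (w ω)) : (Fin D → ℝ) → ℝ) y) ∂μ‖ₑ := by
    have e : ∀ ω, ∫ y, (G.box.indicator (V (u + 1)) y -
        (G.poly (G.chebCoeff (w ω)) : (Fin D → ℝ) → ℝ) y) ∂μ =
        ∫ y, G.box.indicator (V (u + 1)) y ∂μ -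
          ∫ y, (G.poly (G.chebCoeff (w ω)) : (Fin D → ℝ) → ℝ) y ∂μ := fun ω =>
      integral_sub (hint.indicator G.measurableSet_box) (integrable_poly _ _)
    simp only [e]
    exact ((measurable_poly_apply hcm).stronglyMeasurable.integral_prod_right'.measurable.const_sub
      _).enorm
  calc _ ≤ ∫⁻ ω, ENNReal.ofReal L * (ENNReal.ofReal εtr +
          (‖∫ y, (G.box.indicator (V (u + 1)) y -
            (G.poly (G.chebCoeff (w ω)) : (Fin D → ℝ) → ℝ) y) ∂μ‖ₑ +
          ‖exactOp G t κ u k (G.poly (G.chebCoeff (w ω))) -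
            Γ u k ω (G.poly (G.chebCoeff (w ω)))‖ₑ)) ∂P' := by
        refine lintegral_mono fun ω => ?_
        rw [hV.step u hu, nodalValue, if_pos hu, hp, Real.enorm_eq_ofReal_abs]
        refine (ENNReal.ofReal_le_ofReal (hf _ _ _ _)).trans ?_
        rw [sub_self, abs_zero, zero_add,
          ENNReal.ofReal_mul (nonneg_of_forall_abs_sub_le hf), ← Real.enorm_eq_ofReal_abs]
        gcongr
        -- Truncation term, propagated error at the next date, and operator error on the computed
        -- polynomial.
        have e : ∫ y, V (u + 1) y ∂μ - Γ u k ω (G.poly (G.chebCoeff (w ω))) =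
            exactOp G t κ u k (G.boxᶜ.indicator (V (u + 1))) +
            (∫ y, (G.box.indicator (V (u + 1)) y -
              (G.poly (G.chebCoeff (w ω)) : (Fin D → ℝ) → ℝ) y) ∂μ +
            (exactOp G t κ u k (G.poly (G.chebCoeff (w ω))) -
              Γ u k ω (G.poly (G.chebCoeff (w ω))))) := by
          rw [integral_sub (hint.indicator G.measurableSet_box) (integrable_poly _ _),
            integral_indicator G.measurableSet_box, exactOp, exactOp,
            integral_indicator G.measurableSet_box.compl,
            ← integral_add_compl G.measurableSet_box hint]
          ring
        rw [e]
        refine (enorm_add_le _ _).trans (add_le_add ?_ (enorm_add_le _ _))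
        rw [Real.enorm_eq_ofReal_abs]
        exact ENNReal.ofReal_le_ofReal (hTR u hu k)
    _ = ENNReal.ofReal L * (ENNReal.ofReal εtr +
          (∫⁻ ω, ‖∫ y, (G.box.indicator (V (u + 1)) y -
            (G.poly (G.chebCoeff (w ω)) : (Fin D → ℝ) → ℝ) y) ∂μ‖ₑ ∂P' +
          ∫⁻ ω, ‖exactOp G t κ u k (G.poly (G.chebCoeff (w ω))) -
            Γ u k ω (G.poly (G.chebCoeff (w ω)))‖ₑ ∂P')) := by
        rw [lintegral_const_mul' _ _ ENNReal.ofReal_ne_top, lintegral_add_left measurable_const,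
          lintegral_add_left h3]
        simp only [lintegral_const, measure_univ, mul_one]
    _ ≤ _ := by
        gcongr
        exact h2.trans (by gcongr)

end Step

/-! ### Error propagation -/

lemma errorBound_self (Λ L δ ε : ℝ) (εint Vbar : ℕ → ℝ) (n : ℕ) :
    errorBound Λ L δ ε εint Vbar n n = εint n := by
  simp [errorBound]

/-- Splitting off the first term of each sum leaves a factor C; in this form the bound matches one
step of the error recursion. -/
lemma errorBound_eq_of_lt (Λ L δ ε : ℝ) (εint Vbar : ℕ → ℝ) {u n : ℕ} (hu : u < n) :
    errorBound Λ L δ ε εint Vbar u n = εint u + Λ * (L * (ε + (errorBound Λ L δ ε εint Vbar (u + 1) n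
      + δ * (Vbar (u + 1) + errorBound Λ L δ ε εint Vbar (u + 1) n)))) := by
  have h : ∀ (C : ℝ) (a : ℕ → ℝ) (v : ℕ), v ≤ n → ∑ j ∈ Finset.Icc v n, C ^ (j - v) * a j =
      a v + C * ∑ j ∈ Finset.Icc (v + 1) n, C ^ (j - (v + 1)) * a j := by
    intro C a v hv
    rw [← Finset.add_sum_Ioc_eq_sum_Icc hv, Nat.sub_self, pow_zero, one_mul, Finset.mul_sum]
    congr 1
    refine Finset.sum_congr (Finset.ext fun j => by
      simp only [Finset.mem_Ioc, Finset.mem_Icc, Nat.add_one_le_iff]) fun j hj => ?_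
    rw [← mul_assoc, ← pow_succ']
    congr 2
    have := (Finset.mem_Icc.1 hj).1
    omega
  rw [errorBound, errorBound, h _ _ u hu.le, h _ (fun j => ε + δ * Vbar j) (u + 1) hu]
  ring

/-- Backward induction from n. Nonnegativity is carried along because `ENNReal.ofReal` is additive
only on nonnegative reals; the bound at the next date also supplies the finiteness required to
normalize in `GMStar`. -/
theorem errorStar_le_errorBound {n : ℕ} {t : ℕ → ℝ≥0}
    {κ : ℝ≥0 → ℝ≥0 → Kernel (Fin D → ℝ) (Fin D → ℝ)}
    (hκ : ∀ v < n, IsMarkovKernel (κ (t v) (t (v + 1))))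
    {g : ℝ≥0 → (Fin D → ℝ) → ℝ} {f : ℝ → ℝ → ℝ} {L : ℝ}
    (hf : ∀ x₁ y₁ x₂ y₂, |f x₁ y₁ - f x₂ y₂| ≤ L * (|x₁ - x₂| + |y₁ - y₂|))
    {V : ℕ → (Fin D → ℝ) → ℝ} (hV : IsValueFunction n t g f κ V)
    {u : ℕ} (hu : u ≤ n) {ρ : ℕ → Fin D → ℝ} {B : ℕ → ℝ}
    (hρ : ∀ j, u ≤ j → j ≤ n → ∀ i, 1 < ρ j i)
    (hB : ∀ j, u ≤ j → j ≤ n → G.HasAnalyticExtension (V j) (ρ j) (B j))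
    {εtr : ℝ} (hTR : TR G n t κ V εtr)
    {Ω' : Type*} [MeasurableSpace Ω'] {P' : Measure Ω'} [IsProbabilityMeasure P']
    {Γ : ℕ → G.Idx → Ω' → (G.polySpace →ₗ[ℝ] ℝ)} {δ : ℝ}
    (hΓ : ∀ v < n, ∀ k q, Measurable fun ω => Γ v k ω q) (hG : GMStar G n t P' κ Γ δ) :
    0 ≤ errorBound G.lebesgue L δ εtr (fun j => G.epsInt (ρ j) (B j))
        (fun j => G.supNorm (V j)) u n ∧
    errorStar G n t P' g f V Γ u ≤ ENNReal.ofReal (errorBound G.lebesgue L δ εtr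
        (fun j => G.epsInt (ρ j) (B j)) (fun j => G.supNorm (V j)) u n) := by
  obtain ⟨x, hx⟩ := G.box_nonempty
  have hint : ∀ j, u ≤ j → j ≤ n → 0 ≤ G.epsInt (ρ j) (B j) := fun j h1 h2 =>
    (abs_nonneg _).trans ((hB j h1 h2).abs_sub_le (hρ j h1 h2) hx)
  have hL := nonneg_of_forall_abs_sub_le hf
  have hΛ := G.lebesgue_nonneg
  induction hu using Nat.decreasingInduction with
  | self =>
    rw [errorBound_self]
    refine ⟨hint n le_rfl le_rfl, ?_⟩
    -- The terminal nodal values are exact, so M = 0.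
    have h := errorStar_le (P' := P') (t := t) (g := g) (f := f) (Γ := Γ) (M := 0)
      le_rfl (hρ n le_rfl le_rfl) (hB n le_rfl le_rfl) (measurable_nodalValue hf hΓ n)
      fun k => by simp [nodalValue, hV.terminal]
    simpa using h
  | of_succ v hv ih =>
    obtain ⟨h0, ih⟩ := ih (fun j h1 h2 => hρ j (by omega) h2) (fun j h1 h2 => hB j (by omega) h2)
      (fun j h1 h2 => hint j (by omega) h2)
    set E := errorBound G.lebesgue L δ εtr (fun j => G.epsInt (ρ j) (B j))
      (fun j => G.supNorm (V j)) (v + 1) n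
    have hb : ∀ x ∈ G.box, |V (v + 1) x| ≤ G.supNorm (V (v + 1)) := fun x hx =>
      (hB (v + 1) (by omega) hv).abs_le_supNorm (hρ (v + 1) (by omega) hv) hx
    have hb0 : 0 ≤ G.supNorm (V (v + 1)) := (abs_nonneg _).trans (hb x hx)
    have hε : 0 ≤ εtr := (abs_nonneg _).trans (hTR v hv fun _ => 0)
    have hδ := hG.1
    have hi := hint v le_rfl hv.le
    have := hκ v hv
    rw [errorBound_eq_of_lt _ _ _ _ _ _ hv]
    refine ⟨by positivity, ?_⟩
    refine (errorStar_le hv.le (hρ v le_rfl hv.le) (hB v le_rfl hv.le)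
      (measurable_nodalValue hf hΓ v) (lintegral_nodalValue_sub_le hf hV hTR hΓ hG hv hb
        (ne_top_of_le_ne_top ENNReal.ofReal_ne_top ih))).trans ?_
    rw [ENNReal.ofReal_add (by positivity) (by positivity), ENNReal.ofReal_mul hΛ,
      ENNReal.ofReal_mul hL, ENNReal.ofReal_add (by positivity) (by positivity),
      ENNReal.ofReal_add (by positivity) (by positivity), ENNReal.ofReal_mul hδ,
      ENNReal.ofReal_add (by positivity) (by positivity)]
    gcongr

/-! ### Deterministic operators -/

/-- The constant polynomial serves as the test function that forces δ ≥ 0 under `GM`. -/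
lemma supNorm_basisP_zero : G.supNorm (G.basisP (fun _ => 0) : (Fin D → ℝ) → ℝ) = 1 := by
  have h : (fun x => |(G.basisP (fun _ => 0) : (Fin D → ℝ) → ℝ) x|) '' G.box = {1} := by
    refine (Set.image_congr fun x hx => ?_).trans (G.box_nonempty.image_const 1)
    simp [basisP, chebP, chebT, hx]
  rw [supNorm, h, csSup_singleton]

lemma supNorm_eq_one {h : (Fin D → ℝ) → ℝ} (hh : ⨆ x ∈ G.box, ‖h x‖ₑ = 1) : G.supNorm h = 1 := by
  have h1 : ∀ x ∈ G.box, |h x| ≤ 1 := by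
    intro x hx
    have := le_iSup₂ (f := fun x (_ : x ∈ G.box) => ‖h x‖ₑ) x hx
    rw [hh, Real.enorm_eq_ofReal_abs] at this
    simpa using this
  have hbdd : BddAbove ((fun x => |h x|) '' G.box) := ⟨1, by rintro _ ⟨x, hx, rfl⟩; exact h1 x hx⟩
  refine le_antisymm (csSup_le (G.box_nonempty.image _) (by rintro _ ⟨x, hx, rfl⟩; exact h1 x hx)) ?_
  have h2 : (1 : ℝ≥0∞) ≤ ENNReal.ofReal (G.supNorm h) := by
    rw [← hh]
    refine iSup₂_le fun x hx => ?_
    rw [Real.enorm_eq_ofReal_abs]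
    exact ENNReal.ofReal_le_ofReal (le_csSup hbdd ⟨x, hx, rfl⟩)
  simpa using h2

/-- On a one-point probability space expectations are evaluations, and the two norms agree. -/
lemma GM.gmStar {n : ℕ} {t : ℕ → ℝ≥0} {κ : ℝ≥0 → ℝ≥0 → Kernel (Fin D → ℝ) (Fin D → ℝ)}
    {Γ : ℕ → G.Idx → (G.polySpace →ₗ[ℝ] ℝ)} {δ : ℝ} (h : GM G n t κ Γ δ) (hδ : 0 ≤ δ) :
    GMStar G n t (Measure.dirac ()) κ (fun v k _ => Γ v k) δ := by
  refine ⟨hδ, fun u hu k a _ hs => ?_⟩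
  simp only [starNorm, lintegral_dirac] at hs
  rw [lintegral_dirac, Real.enorm_eq_ofReal_abs]
  exact ENNReal.ofReal_le_ofReal (h u hu k _ (supNorm_eq_one hs))

lemma error_eq_errorStar (n : ℕ) (t : ℕ → ℝ≥0) (g : ℝ≥0 → (Fin D → ℝ) → ℝ) (f : ℝ → ℝ → ℝ)
    (V : ℕ → (Fin D → ℝ) → ℝ) (Γ : ℕ → G.Idx → (G.polySpace →ₗ[ℝ] ℝ)) (u : ℕ) :
    error G n t g f V Γ u =
      errorStar G n t (Measure.dirac ()) g f V (fun v k _ => Γ v k) u := by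
  simp only [error, errorStar, lintegral_dirac]

lemma IsMarkovProcess.isMarkovKernel_of_grid {Ω : Type*} [mΩ : MeasurableSpace Ω] {P : Measure Ω}
    {ℱ : Filtration ℝ≥0 mΩ} {T : ℝ≥0} {X : ℝ≥0 → Ω → Fin D → ℝ}
    {κ : ℝ≥0 → ℝ≥0 → Kernel (Fin D → ℝ) (Fin D → ℝ)} (hX : IsMarkovProcess P ℱ T X κ)
    {n : ℕ} {t : ℕ → ℝ≥0} (ht : ∀ u < n, t u < t (u + 1)) (htT : t n = T) {v : ℕ} (hv : v < n) :
    IsMarkovKernel (κ (t v) (t (v + 1))) := by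
  refine hX.isMarkovKernel _ _ (ht v hv).le ?_
  have hle : ∀ m ≤ n, t m ≤ t n := fun m hm => by
    induction hm using Nat.decreasingInduction with
    | self => exact le_rfl
    | of_succ k hk ih => exact (ht k hk).le.trans ih
  exact (hle _ hv).trans htT.le

end DynCheb

end

/-! ### The error estimate in both cases -/

theorem theorem3p3 {D : ℕ} (G : DynCheb.Grid D)
    -- the Markov process and its transition kernels
    {Ω : Type*} [mΩ : MeasurableSpace Ω] (P : Measure Ω) [IsProbabilityMeasure P]
    (ℱ : Filtration ℝ≥0 mΩ) (T : ℝ≥0) (X : ℝ≥0 → Ω → Fin D → ℝ)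
    (κ : ℝ≥0 → ℝ≥0 → Kernel (Fin D → ℝ) (Fin D → ℝ))
    (hX : DynCheb.IsMarkovProcess P ℱ T X κ)
    -- the time grid
    (n : ℕ) (t : ℕ → ℝ≥0) (ht : ∀ u < n, t u < t (u + 1)) (htT : t n = T)
    -- the dynamic programming problem
    (g : ℝ≥0 → (Fin D → ℝ) → ℝ) (f : ℝ → ℝ → ℝ) (L : ℝ)
    (hf : ∀ x₁ y₁ x₂ y₂, |f x₁ y₁ - f x₂ y₂| ≤ L * (|x₁ - x₂| + |y₁ - y₂|))
    (V : ℕ → (Fin D → ℝ) → ℝ) (hV : DynCheb.IsValueFunction n t g f κ V)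
    -- the time step at which the error is estimated
    (u : ℕ) (hu : u ≤ n)
    -- analyticity of the value functions
    (ρ : ℕ → Fin D → ℝ) (B : ℕ → ℝ) (hρ : ∀ j, u ≤ j → j ≤ n → ∀ i, 1 < ρ j i)
    (hB : ∀ j, u ≤ j → j ≤ n → G.HasAnalyticExtension (V j) (ρ j) (B j))
    -- the truncation error
    (εtr : ℝ) (hTR : DynCheb.TR G n t κ V εtr) :
    -- deterministic approximation of the generalized moments
    (∀ (Γ : ℕ → G.Idx → (G.polySpace →ₗ[ℝ] ℝ)) (δ : ℝ), DynCheb.GM G n t κ Γ δ →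
      DynCheb.error G n t g f V Γ u ≤
        ENNReal.ofReal (DynCheb.errorBound G.lebesgue L δ εtr
          (fun j => G.epsInt (ρ j) (B j)) (fun j => G.supNorm (V j)) u n)) ∧
    -- stochastic approximation of the generalized moments
    (∀ {Ω' : Type*} [MeasurableSpace Ω'] (P' : Measure Ω') [IsProbabilityMeasure P']
      (Γ : ℕ → G.Idx → Ω' → (G.polySpace →ₗ[ℝ] ℝ)) (δ : ℝ),
      (∀ v < n, ∀ k q, Measurable fun ω => Γ v k ω q) → DynCheb.GMStar G n t P' κ Γ δ →
      DynCheb.errorStar G n t P' g f V Γ u ≤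
        ENNReal.ofReal (DynCheb.errorBound G.lebesgue L δ εtr
          (fun j => G.epsInt (ρ j) (B j)) (fun j => G.supNorm (V j)) u n)) := by
  have hκ := fun v (hv : v < n) => hX.isMarkovKernel_of_grid ht htT hv
  refine ⟨fun Γ δ hG => ?_, fun P' _ Γ δ hΓ hG =>
    (DynCheb.errorStar_le_errorBound hκ hf hV hu hρ hB hTR hΓ hG).2⟩
  rw [DynCheb.error_eq_errorStar]
  -- For n = 0, `GM` is vacuous and δ may be negative; the bound then does not involve δ, so 0 is
  -- used instead. For n > 0, testing on the constant polynomial gives δ ≥ 0.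
  rcases Nat.eq_zero_or_pos n with rfl | hn
  · obtain rfl : u = 0 := by omega
    have hG0 : DynCheb.GM G 0 t κ Γ 0 := fun v hv => absurd hv (Nat.not_lt_zero v)
    rw [DynCheb.errorBound_self]
    have h := (DynCheb.errorStar_le_errorBound (P' := Measure.dirac ()) (Γ := fun v k _ => Γ v k)
      hκ hf hV hu hρ hB hTR (fun _ _ _ _ => measurable_const) (hG0.gmStar le_rfl)).2
    rwa [DynCheb.errorBound_self] at h
  · have hδ : 0 ≤ δ :=
      (abs_nonneg _).trans (hG 0 hn (fun _ => 0) _ DynCheb.supNorm_basisP_zero)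
    exact (DynCheb.errorStar_le_errorBound (P' := Measure.dirac ()) (Γ := fun v k _ => Γ v k)
      hκ hf hV hu hρ hB hTR (fun _ _ _ _ => measurable_const) (hG.gmStar hδ)).2
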